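/- Let $s\in(0,1)$, $N\in\mathbb N$ with $N>2s$, $2^*_s=\frac{2N}{N-2s}$ and $\varepsilon>0$. Write $[u]^2=\iint_{\mathbb R^{2N}}\frac{|u(x)-u(y)|^2}{|x-y|^{N+2s}}\,dx\,dy$ and $H^s(\mathbb R^N)=\{u\in L^2(\mathbb R^N):[u]^2<\infty\}$. **Assumptions.** Let $V,W:\mathbb R^N\to\mathbb R$ be continuous with $\inf V=\inf W=:V_0>0$, such that $V(x)=W(x)=V_0$ for some $x\in\mathbb R^N$. Put $V_\infty=\liminf_{|x|\to\infty}V(x)$ and $W_\infty=\liminf_{|x|\to\infty}W(x)$ in $(0,\infty]$, and assume $V_0<\max\{V_\infty,W_\infty\}$. Let $Q:[0,\infty)^2\to\mathbb R$ be of class $C^1$ on $[0,\infty)^2$ and $C^2$ on $(0,\infty)^2$, and assume: * $Q(tu,tv)=t^qQ(u,v)$ for all $t>0$ and $u,v\ge0$, where $q\in(2,2^*_s)$; * there is $C>0$ with $|Q_u(u,v)|+|Q_v(u,v)|\le C(u^{q-1}+v^{q-1})$ for all $u,v\ge0$; * $Q_u(0,1)=Q_v(1,0)=Q_u(1,0)=Q_v(0,1)=0$;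 * $Q_{uv}(u,v)>0$ for all $u,v>0$. Extend $Q$ by $Q(u,v)=0$ if $u\le0$ or $v\le0$. Let $\alpha,\beta\ge1$ with $\alpha+\beta=2^*_s$. **The functional.** Let $X_\varepsilon$ be the Hilbert space of all $(u,v)\in H^s(\mathbb R^N)\times H^s(\mathbb R^N)$ with $\int_{\mathbb R^N}(V(\varepsilon x)u^2+W(\varepsilon x)v^2)\,dx<\infty$, with norm $$\|(u,v)\|_\varepsilon^2=[u]^2+[v]^2+\int_{\mathbb R^N}(V(\varepsilon x)u^2+W(\varepsilon x)v^2)\,dx .$$ On $X_\varepsilon$ let $$J_\varepsilon(u,v)=\tfrac12\|(u,v)\|_\varepsilon^2-\int_{\mathbb R^N}Q(u,v)\,dx-\tfrac1{\alpha+\beta}\int_{\mathbb R^N}(u^+)^\alpha(v^+)^\beta\,dx .$$ Let $I_\varepsilon(z)=\langle J_\varepsilon'(z),z\rangle$, the derivative of $J_\varepsilon$ at $z$ in the direction $z$ (it always exists), and let $\mathcal M_\varepsilon=\{z\in X_\varepsilon\setminus\{0\}: I_\varepsilon(z)=0\}$. **The levels.** If $\max\{V_\infty,W_\infty\}<\infty$,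 let $$m_\infty=\inf_{(u,v)\ne(0,0)}\ \sup_{t\ge0}J_\infty(tu,tv)\in[0,\infty],$$ where $(u,v)$ ranges over $H^s(\mathbb R^N)\times H^s(\mathbb R^N)$ and $$J_\infty(u,v)=\tfrac12\Big([u]^2+[v]^2+\int_{\mathbb R^N}(V_\infty u^2+W_\infty v^2)\,dx\Big)-\int_{\mathbb R^N}Q(u,v)\,dx-\tfrac1{\alpha+\beta}\int_{\mathbb R^N}(u^+)^\alpha(v^+)^\beta\,dx .$$ If $\max\{V_\infty,W_\infty\}=\infty$, let $m_\infty=\infty$. Let $$\widetilde S_*=\inf\Big\{\frac{[u]^2+[v]^2}{\big(\int_{\mathbb R^N}|u|^\alpha|v|^\beta\,dx\big)^{2/2^*_s}}:\ u,v\in H^s(\mathbb R^N),\ \int_{\mathbb R^N}|u|^\alpha|v|^\beta\,dx>0\Big\}.$$ **Claims.** 1. If $\alpha,\beta>1$, then $J_\varepsilon\in C^1(X_\varepsilon,\mathbb R)$. 2. For every real $d<\min\{m_\infty,\frac sN\widetilde S_*^{N/(2s)}\}$, $J_\varepsilon$ constrained to $\mathcal M_\varepsilon$ satisfies $(PS)_d$: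 every sequence $(z_n)\subset\mathcal M_\varepsilon$ with $J_\varepsilon(z_n)\to d$ and $\|J_\varepsilon'(z_n)|_{\ker I_\varepsilon'(z_n)}\|_*\to0$ has a subsequence that converges in $X_\varepsilon$ to a point of $\mathcal M_\varepsilon$. 3. If $z\in\mathcal M_\varepsilon$ is a critical point of $J_\varepsilon$ constrained to $\mathcal M_\varepsilon$, i.e. $J_\varepsilon'(z)=0$ on $\ker I_\varepsilon'(z)$, then $J_\varepsilon'(z)=0$ on $X_\varepsilon$. In 2 and 3, $J_\varepsilon$ is required to be Fréchet differentiable at the points $z_n$ and $z$ (by 1, this is a restriction only if $\alpha=1$ or $\beta=1$). Where $I_\varepsilon$ is not Fréchet differentiable, $\ker I_\varepsilon'$ is read as $X_\varepsilon$. -/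

import Mathlib

open MeasureTheory Filter Topology Set

/-- The space `ℝ^N` with its Euclidean norm and Lebesgue measure. -/
abbrev RN (N : ℕ) : Type := EuclideanSpace ℝ (Fin N)

/-- The critical fractional Sobolev exponent `2*_s = 2N / (N - 2s)`. -/
noncomputable def critExp (N : ℕ) (s : ℝ) : ℝ := 2 * (N : ℝ) / ((N : ℝ) - 2 * s)

/-! ### The fractional Sobolev space -/

/-- The quotient `(u(x) - u(y)) / |x - y|^((N + 2s) / 2)`; its square is the Gagliardo integrand. -/
noncomputable def gagQuot (N : ℕ) (s : ℝ) (u : RN N → ℝ) (p : RN N × RN N) : ℝ :=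
  (u p.1 - u p.2) / ‖p.1 - p.2‖ ^ (((N : ℝ) + 2 * s) / 2)

/-- `u ∈ H^s(ℝ^N)`: `u ∈ L²` and `∬ |u(x) - u(y)|² / |x - y|^(N + 2s) dx dy < ∞`. -/
def MemHs (N : ℕ) (s : ℝ) (u : RN N → ℝ) : Prop :=
  MemLp u 2 volume ∧ MemLp (gagQuot N s u) 2 volume

/-- `∬ (u(x) - u(y)) (φ(x) - φ(y)) / |x - y|^(N + 2s) dx dy`. -/
noncomputable def gagForm (N : ℕ) (s : ℝ) (u φ : RN N → ℝ) : ℝ :=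
  ∫ p : RN N × RN N, gagQuot N s u p * gagQuot N s φ p

/-- `∫ |(-Δ)^(s/2) u|² dx = ∬ |u(x) - u(y)|² / |x - y|^(N + 2s) dx dy`. -/
noncomputable def gagSq (N : ℕ) (s : ℝ) (u : RN N → ℝ) : ℝ :=
  ∫ p : RN N × RN N, |u p.1 - u p.2| ^ 2 / ‖p.1 - p.2‖ ^ ((N : ℝ) + 2 * s)

theorem gagForm_self (N : ℕ) (s : ℝ) (u : RN N → ℝ) : gagForm N s u u = gagSq N s u := by
  unfold gagForm gagSq gagQuot
  congr 1
  funext p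
  have h : ‖p.1 - p.2‖ ^ ((N : ℝ) + 2 * s)
      = (‖p.1 - p.2‖ ^ (((N : ℝ) + 2 * s) / 2)) ^ 2 := by
    rw [← Real.rpow_mul_natCast (norm_nonneg _)]
    congr 1
    push_cast
    ring
  rw [h, sq_abs, ← div_pow]
  ring

theorem gagQuot_congr {N : ℕ} {s : ℝ} {u v : RN N → ℝ} (h : u =ᵐ[volume] v) :
    gagQuot N s u =ᵐ[volume] gagQuot N s v := by
  have h1 : (fun p : RN N × RN N => u p.1) =ᵐ[volume] fun p => v p.1 :=
    (Measure.quasiMeasurePreserving_fst (μ := (volume : Measure (RN N)))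
      (ν := (volume : Measure (RN N)))).ae_eq_comp h
  have h2 : (fun p : RN N × RN N => u p.2) =ᵐ[volume] fun p => v p.2 :=
    (Measure.quasiMeasurePreserving_snd (μ := (volume : Measure (RN N)))
      (ν := (volume : Measure (RN N)))).ae_eq_comp h
  filter_upwards [h1, h2] with p hp1 hp2
  simp only [gagQuot, hp1, hp2]

theorem gagQuot_add (N : ℕ) (s : ℝ) (u v : RN N → ℝ) :
    gagQuot N s (u + v) = gagQuot N s u + gagQuot N s v := by
  funext p
  simp only [gagQuot, Pi.add_apply]
  ring

theorem gagQuot_smul (N : ℕ) (s c : ℝ) (u : RN N → ℝ) :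
    gagQuot N s (c • u) = c • gagQuot N s u := by
  funext p
  simp only [gagQuot, Pi.smul_apply, smul_eq_mul]
  ring

theorem MemHs.congr {N : ℕ} {s : ℝ} {u v : RN N → ℝ} (hu : MemHs N s u)
    (h : u =ᵐ[volume] v) : MemHs N s v :=
  ⟨hu.1.ae_eq h, hu.2.ae_eq (gagQuot_congr h)⟩

theorem MemHs.add {N : ℕ} {s : ℝ} {u v : RN N → ℝ} (hu : MemHs N s u) (hv : MemHs N s v) :
    MemHs N s (u + v) :=
  ⟨hu.1.add hv.1, by rw [gagQuot_add]; exact hu.2.add hv.2⟩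

theorem MemHs.smul {N : ℕ} {s : ℝ} {u : RN N → ℝ} (c : ℝ) (hu : MemHs N s u) :
    MemHs N s (c • u) :=
  ⟨hu.1.const_smul c, by rw [gagQuot_smul]; exact hu.2.const_smul c⟩

theorem MemHs.zero (N : ℕ) (s : ℝ) : MemHs N s 0 := by
  have h : gagQuot N s 0 = 0 := by
    funext p
    simp [gagQuot]
  exact ⟨MemLp.zero, by rw [h]; exact MemLp.zero⟩

/-! ### Potentials -/

/-- A continuous potential on `ℝ^N` with positive infimum. -/
structure Potential (N : ℕ) where
  /-- the underlying function -/
  toFun : RN N → ℝ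
  cont : Continuous toFun
  inf_pos : 0 < ⨅ x, toFun x

/-- `V_0 = inf V`. -/
noncomputable def Potential.inf {N : ℕ} (V : Potential N) : ℝ := ⨅ x, V.toFun x

/-- `V_∞ = liminf_{|x| → ∞} V(x)`, possibly `+∞`. -/
noncomputable def Potential.atInfty {N : ℕ} (V : Potential N) : EReal :=
  liminf (fun x => ((V.toFun x : ℝ) : EReal)) (cocompact (RN N))

theorem Potential.pos {N : ℕ} (V : Potential N) (x : RN N) : 0 < V.toFun x := by
  have hb : BddBelow (range V.toFun) := by
    by_contra hb
    have h0 := V.inf_pos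
    rw [iInf, Real.sInf_of_not_bddBelow hb] at h0
    exact lt_irrefl _ h0
  exact V.inf_pos.trans_le (ciInf_le hb x)

/-- `∫ V(ε x) u(x)² dx < ∞`. -/
def FinPot {N : ℕ} (ε : ℝ) (V : Potential N) (u : RN N → ℝ) : Prop :=
  Integrable (fun x => V.toFun (ε • x) * u x ^ 2) volume

theorem FinPot.congr {N : ℕ} {ε : ℝ} {V : Potential N} {u v : RN N → ℝ} (hu : FinPot ε V u)
    (h : u =ᵐ[volume] v) : FinPot ε V v := by
  refine Integrable.congr hu ?_
  filter_upwards [h] with x hx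
  rw [hx]

theorem FinPot.mul {N : ℕ} {ε : ℝ} {V : Potential N} {u v : RN N → ℝ}
    (hu : FinPot ε V u) (hv : FinPot ε V v)
    (mu : AEStronglyMeasurable u volume) (mv : AEStronglyMeasurable v volume) :
    Integrable (fun x => V.toFun (ε • x) * (u x * v x)) volume := by
  have hm : Continuous fun x : RN N => V.toFun (ε • x) :=
    V.cont.comp (continuous_const_smul ε)
  refine Integrable.mono' (Integrable.add hu hv)
    (hm.aestronglyMeasurable.mul (mu.mul mv)) (Eventually.of_forall fun x => ?_)
  have hV := V.pos (ε • x)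
  rw [Real.norm_eq_abs, abs_mul, abs_of_pos hV, Pi.add_apply, ← mul_add]
  refine mul_le_mul_of_nonneg_left ?_ hV.le
  rw [abs_le]
  constructor <;> nlinarith [sq_nonneg (u x + v x), sq_nonneg (u x - v x),
    sq_nonneg (u x), sq_nonneg (v x)]

theorem FinPot.add {N : ℕ} {ε : ℝ} {V : Potential N} {u v : RN N → ℝ}
    (hu : FinPot ε V u) (hv : FinPot ε V v)
    (mu : AEStronglyMeasurable u volume) (mv : AEStronglyMeasurable v volume) :
    FinPot ε V (u + v) := by
  have h := (Integrable.add hu hv).add ((hu.mul hv mu mv).const_mul 2)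
  refine h.congr (Eventually.of_forall fun x => ?_)
  simp only [Pi.add_apply]
  ring

theorem FinPot.smul {N : ℕ} {ε : ℝ} {V : Potential N} {u : RN N → ℝ} (c : ℝ)
    (hu : FinPot ε V u) : FinPot ε V (c • u) := by
  refine (Integrable.const_mul hu (c ^ 2)).congr (Eventually.of_forall fun x => ?_)
  simp only [Pi.smul_apply, smul_eq_mul]
  ring

theorem FinPot.zero {N : ℕ} (ε : ℝ) (V : Potential N) : FinPot ε V 0 := by
  simp [FinPot]

/-! ### The Hilbert space `X_ε` -/

/-- Pairs `(u, v)` of (classes of) functions in `H^s(ℝ^N)` with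
`∫ (V(ε x) u² + W(ε x) v²) dx < ∞`. -/
def XSub (N : ℕ) (s ε : ℝ) (V W : Potential N) :
    Submodule ℝ ((RN N →ₘ[volume] ℝ) × (RN N →ₘ[volume] ℝ)) where
  carrier := {z | (MemHs N s z.1 ∧ MemHs N s z.2) ∧ FinPot ε V z.1 ∧ FinPot ε W z.2}
  zero_mem' := by
    have h : (0 : RN N → ℝ) =ᵐ[volume] ⇑(0 : RN N →ₘ[volume] ℝ) :=
      (AEEqFun.coeFn_zero (α := RN N) (β := ℝ)).symm
    exact ⟨⟨(MemHs.zero N s).congr h, (MemHs.zero N s).congr h⟩,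
      (FinPot.zero ε V).congr h, (FinPot.zero ε W).congr h⟩
  add_mem' := by
    rintro a b ⟨⟨h1, h2⟩, h3, h4⟩ ⟨⟨k1, k2⟩, k3, k4⟩
    have e1 := (AEEqFun.coeFn_add a.1 b.1).symm
    have e2 := (AEEqFun.coeFn_add a.2 b.2).symm
    exact ⟨⟨(h1.add k1).congr e1, (h2.add k2).congr e2⟩,
      (h3.add k3 h1.1.1 k1.1.1).congr e1, (h4.add k4 h2.1.1 k2.1.1).congr e2⟩
  smul_mem' := by
    rintro c a ⟨⟨h1, h2⟩, h3, h4⟩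
    have e1 := (AEEqFun.coeFn_smul c a.1).symm
    have e2 := (AEEqFun.coeFn_smul c a.2).symm
    exact ⟨⟨(h1.smul c).congr e1, (h2.smul c).congr e2⟩,
      (h3.smul c).congr e1, (h4.smul c).congr e2⟩

/-- The space `X_ε`. -/
def XSpace (N : ℕ) (s ε : ℝ) (V W : Potential N) : Type := XSub N s ε V W

namespace XSpace

variable {N : ℕ} {s ε : ℝ} {V W : Potential N}

noncomputable instance : AddCommGroup (XSpace N s ε V W) :=
  inferInstanceAs (AddCommGroup (XSub N s ε V W))

noncomputable instance : Module ℝ (XSpace N s ε V W) :=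
  inferInstanceAs (Module ℝ (XSub N s ε V W))

/-- The first component `u` of `(u, v) ∈ X_ε`. -/
noncomputable def u (z : XSpace N s ε V W) : RN N → ℝ := z.val.1

/-- The second component `v` of `(u, v) ∈ X_ε`. -/
noncomputable def v (z : XSpace N s ε V W) : RN N → ℝ := z.val.2

theorem memHs_u (z : XSpace N s ε V W) : MemHs N s z.u := z.property.1.1
theorem memHs_v (z : XSpace N s ε V W) : MemHs N s z.v := z.property.1.2
theorem finPot_u (z : XSpace N s ε V W) : FinPot ε V z.u := z.property.2.1
theorem finPot_v (z : XSpace N s ε V W) : FinPot ε W z.v := z.property.2.2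

theorem u_add (z w : XSpace N s ε V W) : (z + w).u =ᵐ[volume] z.u + w.u :=
  AEEqFun.coeFn_add z.val.1 w.val.1
theorem v_add (z w : XSpace N s ε V W) : (z + w).v =ᵐ[volume] z.v + w.v :=
  AEEqFun.coeFn_add z.val.2 w.val.2
theorem u_smul (c : ℝ) (z : XSpace N s ε V W) : (c • z).u =ᵐ[volume] c • z.u :=
  AEEqFun.coeFn_smul c z.val.1
theorem v_smul (c : ℝ) (z : XSpace N s ε V W) : (c • z).v =ᵐ[volume] c • z.v :=
  AEEqFun.coeFn_smul c z.val.2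

/-- The scalar product of `X_ε` whose associated norm is `‖(u, v)‖_ε`. -/
noncomputable def form (z w : XSpace N s ε V W) : ℝ :=
  gagForm N s z.u w.u + gagForm N s z.v w.v
    + ((∫ x, V.toFun (ε • x) * (z.u x * w.u x)) + ∫ x, W.toFun (ε • x) * (z.v x * w.v x))

end XSpace

theorem gagForm_congr_left {N : ℕ} {s : ℝ} {a b c : RN N → ℝ} (h : a =ᵐ[volume] b) :
    gagForm N s a c = gagForm N s b c := by
  refine integral_congr_ae ?_
  filter_upwards [gagQuot_congr (s := s) h] with p hp
  rw [hp]

theorem gagForm_add_left {N : ℕ} {s : ℝ} {a b c : RN N → ℝ} (ha : MemHs N s a)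
    (hb : MemHs N s b) (hc : MemHs N s c) :
    gagForm N s (a + b) c = gagForm N s a c + gagForm N s b c := by
  have i1 : Integrable (fun p => gagQuot N s a p * gagQuot N s c p) volume :=
    MemLp.integrable_mul ha.2 hc.2
  have i2 : Integrable (fun p => gagQuot N s b p * gagQuot N s c p) volume :=
    MemLp.integrable_mul hb.2 hc.2
  unfold gagForm
  rw [← integral_add i1 i2]
  congr 1
  funext p
  rw [gagQuot_add, Pi.add_apply]
  ring

theorem gagForm_smul_left {N : ℕ} {s : ℝ} (r : ℝ) (a c : RN N → ℝ) :
    gagForm N s (r • a) c = r * gagForm N s a c := by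
  unfold gagForm
  rw [← integral_const_mul]
  congr 1
  funext p
  rw [gagQuot_smul, Pi.smul_apply, smul_eq_mul]
  ring

theorem weighted_add_left {N : ℕ} {ε : ℝ} {V : Potential N} {a b c d : RN N → ℝ}
    (h : d =ᵐ[volume] a + b) (ha : FinPot ε V a) (hb : FinPot ε V b) (hc : FinPot ε V c)
    (ma : AEStronglyMeasurable a volume) (mb : AEStronglyMeasurable b volume)
    (mc : AEStronglyMeasurable c volume) :
    ∫ x, V.toFun (ε • x) * (d x * c x)
      = (∫ x, V.toFun (ε • x) * (a x * c x)) + ∫ x, V.toFun (ε • x) * (b x * c x) := by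
  rw [← integral_add (ha.mul hc ma mc) (hb.mul hc mb mc)]
  refine integral_congr_ae ?_
  filter_upwards [h] with x hx
  rw [hx, Pi.add_apply]
  ring

theorem weighted_smul_left {N : ℕ} {ε : ℝ} {V : Potential N} {a c d : RN N → ℝ} (r : ℝ)
    (h : d =ᵐ[volume] r • a) :
    ∫ x, V.toFun (ε • x) * (d x * c x) = r * ∫ x, V.toFun (ε • x) * (a x * c x) := by
  rw [← integral_const_mul]
  refine integral_congr_ae ?_
  filter_upwards [h] with x hx
  rw [hx, Pi.smul_apply, smul_eq_mul]
  ring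

theorem gagForm_self_nonneg (N : ℕ) (s : ℝ) (a : RN N → ℝ) : 0 ≤ gagForm N s a a :=
  integral_nonneg fun _ => mul_self_nonneg _

theorem weighted_self_nonneg {N : ℕ} (ε : ℝ) (V : Potential N) (a : RN N → ℝ) :
    0 ≤ ∫ x, V.toFun (ε • x) * (a x * a x) :=
  integral_nonneg fun _ => mul_nonneg (V.pos _).le (mul_self_nonneg _)

theorem weighted_self_eq_zero {N : ℕ} {ε : ℝ} {V : Potential N} {a : RN N → ℝ}
    (ha : FinPot ε V a) (ma : AEStronglyMeasurable a volume)
    (h : ∫ x, V.toFun (ε • x) * (a x * a x) = 0) : a =ᵐ[volume] 0 := by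
  rw [integral_eq_zero_iff_of_nonneg
    (fun _ => mul_nonneg (V.pos _).le (mul_self_nonneg _)) (ha.mul ha ma ma)] at h
  filter_upwards [h] with x hx
  have hV := (V.pos (ε • x)).ne'
  simpa [hV] using hx

namespace XSpace

variable {N : ℕ} {s ε : ℝ} {V W : Potential N}

noncomputable instance core : InnerProductSpace.Core ℝ (XSpace N s ε V W) where
  inner z w := form z w
  conj_inner_symm z w := by
    simp only [form, gagForm, conj_trivial]
    simp only [mul_comm]
  re_inner_nonneg z := by
    simp only [form, RCLike.re_to_real]
    have h1 := gagForm_self_nonneg N s z.u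
    have h2 := gagForm_self_nonneg N s z.v
    have h3 := weighted_self_nonneg ε V z.u
    have h4 := weighted_self_nonneg ε W z.v
    positivity
  add_left x y z := by
    simp only [form]
    rw [gagForm_congr_left (u_add x y), gagForm_congr_left (v_add x y),
      gagForm_add_left x.memHs_u y.memHs_u z.memHs_u,
      gagForm_add_left x.memHs_v y.memHs_v z.memHs_v,
      weighted_add_left (u_add x y) x.finPot_u y.finPot_u z.finPot_u
        x.memHs_u.1.1 y.memHs_u.1.1 z.memHs_u.1.1,
      weighted_add_left (v_add x y) x.finPot_v y.finPot_v z.finPot_v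
        x.memHs_v.1.1 y.memHs_v.1.1 z.memHs_v.1.1]
    ring
  smul_left x y r := by
    simp only [form, conj_trivial]
    rw [gagForm_congr_left (u_smul r x), gagForm_congr_left (v_smul r x),
      gagForm_smul_left, gagForm_smul_left,
      weighted_smul_left r (u_smul r x), weighted_smul_left r (v_smul r x)]
    ring
  definite z h := by
    simp only [form] at h
    have h1 := gagForm_self_nonneg N s z.u
    have h2 := gagForm_self_nonneg N s z.v
    have h3 := weighted_self_nonneg ε V z.u
    have h4 := weighted_self_nonneg ε W z.v
    have k3 : ∫ x, V.toFun (ε • x) * (z.u x * z.u x) = 0 := by linarith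
    have k4 : ∫ x, W.toFun (ε • x) * (z.v x * z.v x) = 0 := by linarith
    have e1 := weighted_self_eq_zero z.finPot_u z.memHs_u.1.1 k3
    have e2 := weighted_self_eq_zero z.finPot_v z.memHs_v.1.1 k4
    have f1 : z.val.1 = 0 := AEEqFun.ext (e1.trans AEEqFun.coeFn_zero.symm)
    have f2 : z.val.2 = 0 := AEEqFun.ext (e2.trans AEEqFun.coeFn_zero.symm)
    exact Subtype.ext (Prod.ext f1 f2)

noncomputable instance : NormedAddCommGroup (XSpace N s ε V W) :=
  core.toNormedAddCommGroup

noncomputable instance : InnerProductSpace ℝ (XSpace N s ε V W) :=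
  InnerProductSpace.ofCore core.toCore

/-- The norm of `X_ε` is
`‖(u,v)‖² = ∫ (|(-Δ)^(s/2) u|² + |(-Δ)^(s/2) v|²) + ∫ (V(ε x) u² + W(ε x) v²)`. -/
theorem norm_sq_eq (z : XSpace N s ε V W) :
    ‖z‖ ^ 2 = gagSq N s z.u + gagSq N s z.v
      + ∫ x, (V.toFun (ε • x) * z.u x ^ 2 + W.toFun (ε • x) * z.v x ^ 2) := by
  have h : ‖z‖ ^ 2 = form z z := by
    rw [← real_inner_self_eq_norm_sq]
    rfl
  rw [h, form, gagForm_self, gagForm_self, integral_add z.finPot_u z.finPot_v]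
  simp only [pow_two]

end XSpace

/-! ### The nonlinearity -/

/-- The closed quadrant `ℝ²_+`. -/
def quadrant : Set (ℝ × ℝ) := Ici 0 ×ˢ Ici 0

/-- The partial derivative `Q_u` on the closed quadrant (one-sided where `u = 0`). -/
noncomputable def dU (Q : ℝ × ℝ → ℝ) (a b : ℝ) : ℝ := derivWithin (fun t => Q (t, b)) (Ici 0) a

/-- The partial derivative `Q_v` on the closed quadrant (one-sided where `v = 0`). -/
noncomputable def dV (Q : ℝ × ℝ → ℝ) (a b : ℝ) : ℝ := derivWithin (fun t => Q (a, t)) (Ici 0) b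

/-- The assumptions on `Q`: it is `C¹` on the closed quadrant, `C²` in its interior,
positively homogeneous of degree `q ∈ (2, 2*_s)`, with the growth, boundary and monotonicity
conditions below.  Only the values of `Q` on the closed quadrant matter. -/
structure IsAdmissible (N : ℕ) (s q : ℝ) (Q : ℝ × ℝ → ℝ) : Prop where
  contDiff_one : ContDiffOn ℝ 1 Q quadrant
  contDiff_two : ContDiffOn ℝ 2 Q (Ioi 0 ×ˢ Ioi 0)
  two_lt : 2 < q
  lt_crit : q < critExp N s
  homogeneous : ∀ t a b : ℝ, 0 < t → 0 ≤ a → 0 ≤ b → Q (t * a, t * b) = t ^ q * Q (a, b)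
  growth : ∃ C : ℝ, 0 < C ∧ ∀ a b : ℝ, 0 ≤ a → 0 ≤ b →
    |dU Q a b| + |dV Q a b| ≤ C * (a ^ (q - 1) + b ^ (q - 1))
  dU_zero_one : dU Q 0 1 = 0
  dV_one_zero : dV Q 1 0 = 0
  dU_one_zero : dU Q 1 0 = 0
  dV_zero_one : dV Q 0 1 = 0
  mixed_pos : ∀ a b : ℝ, 0 < a → 0 < b → 0 < deriv (fun t => dU Q a t) b

/-- The extension of `Q` by zero: `Q(u, v) = 0` if `u ≤ 0` or `v ≤ 0`. -/
noncomputable def extQ (Q : ℝ × ℝ → ℝ) (a b : ℝ) : ℝ :=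
  open Classical in if a ≤ 0 ∨ b ≤ 0 then 0 else Q (a, b)

/-- `∫ Q(u, v) dx + 1/(α+β) ∫ (u⁺)^α (v⁺)^β dx`. -/
noncomputable def nonlinTerm {N : ℕ} (α β : ℝ) (Q : ℝ × ℝ → ℝ) (u v : RN N → ℝ) : ℝ :=
  (∫ x, extQ Q (u x) (v x)) + 1 / (α + β) * ∫ x, max (u x) 0 ^ α * max (v x) 0 ^ β

/-! ### Functionals and levels -/

/-- The functional
`J_ε(u, v) = ½ ‖(u, v)‖_ε² - ∫ Q(u, v) dx - 1/(α+β) ∫ (u⁺)^α (v⁺)^β dx` on `X_ε`. -/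
noncomputable def JEps {N : ℕ} {s ε : ℝ} {V W : Potential N} (α β : ℝ) (Q : ℝ × ℝ → ℝ)
    (z : XSpace N s ε V W) : ℝ :=
  1 / 2 * ‖z‖ ^ 2 - nonlinTerm α β Q z.u z.v

/-- The autonomous functional with constant potentials `a` and `b`:
`½ (∫ (|(-Δ)^(s/2) u|² + |(-Δ)^(s/2) v|²) + ∫ (a u² + b v²)) - ∫ Q(u, v)
  - 1/(α+β) ∫ (u⁺)^α (v⁺)^β`. -/
noncomputable def JConst (N : ℕ) (s a b α β : ℝ) (Q : ℝ × ℝ → ℝ) (u v : RN N → ℝ) : ℝ :=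
  1 / 2 * (gagSq N s u + gagSq N s v + ∫ x, (a * u x ^ 2 + b * v x ^ 2)) - nonlinTerm α β Q u v

/-- The level `m_∞ = inf_{(u, v) ∈ H^s × H^s, (u, v) ≠ (0, 0)} sup_{t ≥ 0} J_∞(t u, t v)` of the
limit functional with potentials `V_∞`, `W_∞`; it is `+∞` if `max {V_∞, W_∞} = ∞`. -/
noncomputable def mInfty {N : ℕ} (s : ℝ) (V W : Potential N) (α β : ℝ) (Q : ℝ × ℝ → ℝ) : EReal :=
  open Classical in
  if max V.atInfty W.atInfty = ⊤ then ⊤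
  else ⨅ (u : RN N → ℝ) (v : RN N → ℝ)
      (_ : MemHs N s u ∧ MemHs N s v ∧ ¬(u =ᵐ[volume] 0 ∧ v =ᵐ[volume] 0)),
    ⨆ (t : ℝ) (_ : 0 ≤ t),
      ((JConst N s V.atInfty.toReal W.atInfty.toReal α β Q (t • u) (t • v) : ℝ) : EReal)

/-- The constant `S̃_*(α, β)`: the infimum over `u, v ∈ H^s(ℝ^N)` of
`∫ (|(-Δ)^(s/2) u|² + |(-Δ)^(s/2) v|²) / (∫ |u|^α |v|^β)^(2/2*_s)`;
pairs for which the denominator vanishes (quotient `+∞`) do not count. -/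
noncomputable def sTilde (N : ℕ) (s α β : ℝ) : ℝ :=
  sInf {r : ℝ | ∃ u v : RN N → ℝ, MemHs N s u ∧ MemHs N s v ∧
    0 < (∫ x, |u x| ^ α * |v x| ^ β) ∧
    r = (gagSq N s u + gagSq N s v) / (∫ x, |u x| ^ α * |v x| ^ β) ^ (2 / critExp N s)}

/-! ### The Nehari manifold, constrained critical points and the Palais–Smale condition -/

section Nehari

variable {E : Type*} [NormedAddCommGroup E] [NormedSpace ℝ E]

/-- The function `z ↦ ⟨J'(z), z⟩` (derivative of `J` at `z` in the direction `z`). -/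
noncomputable def nehariFun (J : E → ℝ) (z : E) : ℝ := lineDeriv ℝ J z z

/-- The Nehari manifold `{z ≠ 0 : ⟨J'(z), z⟩ = 0}`. -/
def nehari (J : E → ℝ) : Set E := {z | z ≠ 0 ∧ nehariFun J z = 0}

/-- The restriction of `J'(z)` to the tangent space `ker I'(z)` of the Nehari manifold at `z`,
where `I(z) = ⟨J'(z), z⟩`. -/
noncomputable def constrainedDeriv (J : E → ℝ) (z : E) :
    LinearMap.ker (fderiv ℝ (nehariFun J) z : E →ₗ[ℝ] ℝ) →L[ℝ] ℝ :=
  (fderiv ℝ J z).comp (LinearMap.ker (fderiv ℝ (nehariFun J) z : E →ₗ[ℝ] ℝ)).subtypeL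

/-- `z` is a critical point of `J` on the whole space. -/
def IsCritical (J : E → ℝ) (z : E) : Prop := HasFDerivAt J (0 : E →L[ℝ] ℝ) z

/-- `z` is a critical point of `J` constrained to the Nehari manifold. -/
def IsConstrainedCritical (J : E → ℝ) (z : E) : Prop :=
  z ∈ nehari J ∧ DifferentiableAt ℝ J z ∧ constrainedDeriv J z = 0

/-- `J` constrained to its Nehari manifold satisfies the Palais–Smale condition at level `d`:
every sequence on the manifold with `J(z_n) → d` and `‖J'(z_n)|_{T}‖_* → 0` has a subsequence
that converges in norm to a point of the manifold. -/
def ConstrainedPS (J : E → ℝ) (d : ℝ) : Prop :=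
  ∀ z : ℕ → E, (∀ n, z n ∈ nehari J) → (∀ n, DifferentiableAt ℝ J (z n)) →
    Tendsto (fun n => J (z n)) atTop (𝓝 d) →
    Tendsto (fun n => ‖constrainedDeriv J (z n)‖) atTop (𝓝 0) →
    ∃ φ : ℕ → ℕ, StrictMono φ ∧ ∃ w ∈ nehari J, Tendsto (fun k => z (φ k)) atTop (𝓝 w)

end Nehari

/-!
Write `J(z) = ½ ‖z‖² - A(z) - B(z) / p` with `p = α + β = 2*_s`, where `A = ∫ Q(u, v)` and
`B = ∫ (u⁺)^α (v⁺)^β` are nonnegative, positively homogeneous of degrees `2 < q < p`, and Lipschitz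
on bounded subsets of `X_ε`. Homogeneity gives `I(z) = ‖z‖² - q A(z) - B(z)`, also at points where
`J` is not differentiable.

*Regularity.* The integrands have continuous derivatives of power growth when `α, β > 1`, so their
integrals are `C¹` on `L^q` and `L^p`, and `X_ε` embeds into these spaces by the fractional Sobolev
inequality (`exists_sobolev_const`, `HasPowerGrowthDeriv.contDiff_integral`).

*Natural constraint.* On the Nehari manifold `J'(z) z = 0` and `I'(z) z ≤ -(q - 2) ‖z‖² < 0`, so
every vector is a tangent vector plus a multiple of `z`, and the full derivative is controlled by the
constrained one (`abs_fderiv_energy_le`).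

*Palais–Smale condition.* A constrained Palais–Smale sequence is bounded, and a subsequence converges
to some `z₀`, weakly, in `L²_loc`, and almost everywhere (`XSpace.exists_weak_subseq`). When `α = 1`
or `β = 1` the critical integrand is not differentiable, so only the derivative in the direction `z₀`
is passed to the limit: it converges to `I(z₀)`, because Euler's identity for homogeneous Lipschitz
functions is stable (`HomLip.tendsto_slope`). Thus `I(z₀) = 0`, hence `J(z₀) ≥ 0`, and the
Brezis–Lieb splitting shows that the differences `w_k = z_k - z₀` satisfy `I(w_k) → 0` and
`J(w_k) → d - J(z₀) ≤ d`. If they did not tend to zero, their energy would be too large: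

* if `V_∞` and `W_∞` are finite, the `w_k`, which vanish locally, do not see where `V(ε ·)` and
  `W(ε ·)` lie below these values; the maximum of the limit functional on the ray through `w_k` is
  then at most `J(w_k)` up to an error that tends to zero, so `m_∞ ≤ d`
  (`XSpace.mInfty_le_of_vanishing`);
* if one potential is coercive, its component tends to zero in `L²`, so `A(w_k) → 0`, since `Q`
  vanishes on the axes; only the critical term survives, and the definition of `S̃_*` gives
  `(s / N) S̃_*^(N / 2s) ≤ d` (`XSpace.sTilde_level_le`).

The second threshold is thus needed only in the coercive case.
-/

/-! ### Elementary inequalities and a convergence lemma -/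

/-- Young's inequality with a small constant in front of the first term. -/
theorem exists_young_const {p δ : ℝ} (hp : 1 < p) (hδ : 0 < δ) :
    ∃ K : ℝ, 0 ≤ K ∧ ∀ a b : ℝ, 0 ≤ a → 0 ≤ b → a ^ (p - 1) * b ≤ δ * a ^ p + K * b ^ p := by
  have hsplit : ∀ c : ℝ, 0 ≤ c → c ^ p = c ^ (p - 1) * c := fun c hc => by
    conv_lhs => rw [show p = p - 1 + 1 by ring]
    rw [Real.rpow_add_one' hc (by linarith)]
  refine ⟨(δ⁻¹) ^ (p - 1), by positivity, fun a b ha hb => ?_⟩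
  have hap := Real.rpow_nonneg ha p
  have hbp := Real.rpow_nonneg hb p
  rcases le_total b (δ * a) with h | h
  · calc a ^ (p - 1) * b ≤ a ^ (p - 1) * (δ * a) := by gcongr
      _ = δ * a ^ p := by rw [hsplit a ha]; ring
      _ ≤ _ := le_add_of_nonneg_right (by positivity)
  · have h' : a ≤ δ⁻¹ * b := by
      rw [inv_mul_eq_div, le_div_iff₀ hδ]; linarith
    calc a ^ (p - 1) * b ≤ (δ⁻¹ * b) ^ (p - 1) * b := by
          gcongr
      _ = (δ⁻¹) ^ (p - 1) * b ^ p := by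
          rw [Real.mul_rpow (by positivity) hb, hsplit b hb]; ring
      _ ≤ _ := le_add_of_nonneg_left (by positivity)

/-- An intermediate power is bounded by a small multiple of the higher power and a large multiple
of the square. -/
theorem exists_interpolation_const {q p δ : ℝ} (hq : 2 ≤ q) (hqp : q < p) (hδ : 0 < δ) :
    ∃ K : ℝ, 0 ≤ K ∧ ∀ t : ℝ, 0 ≤ t → t ^ q ≤ K * t ^ 2 + δ * t ^ p := by
  set T : ℝ := δ ^ (-(p - q)⁻¹) with hT
  have hTpos : 0 < T := by positivity
  have hTd : T ^ (p - q) = δ⁻¹ := by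
    rw [hT, ← Real.rpow_mul hδ.le, neg_mul, inv_mul_cancel₀ (by linarith), Real.rpow_neg_one]
  refine ⟨T ^ (q - 2), by positivity, fun t ht => ?_⟩
  rcases ht.eq_or_lt with rfl | ht
  · rw [Real.zero_rpow (by linarith), Real.zero_rpow (by linarith)]; simp
  rcases le_total t T with h | h
  · calc t ^ q = t ^ (q - 2) * t ^ 2 := by
          rw [← Real.rpow_natCast t 2, ← Real.rpow_add ht]; norm_num
      _ ≤ T ^ (q - 2) * t ^ 2 := by
          gcongr
      _ ≤ _ := le_add_of_nonneg_right (by positivity)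
  · have h1 : δ⁻¹ ≤ t ^ (p - q) := by
      rw [← hTd]; gcongr
    have h2 : t ^ p = t ^ (p - q) * t ^ q := by
      rw [← Real.rpow_add ht]; ring_nf
    calc t ^ q = δ * (δ⁻¹ * t ^ q) := by field_simp
      _ ≤ δ * t ^ p := by rw [h2]; gcongr
      _ ≤ _ := le_add_of_nonneg_left (by positivity)

theorem add_rpow_le_two_rpow_mul {a b p : ℝ} (ha : 0 ≤ a) (hb : 0 ≤ b) (hp : 0 ≤ p) :
    (a + b) ^ p ≤ 2 ^ p * (a ^ p + b ^ p) := by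
  have h : (max a b) ^ p ≤ a ^ p + b ^ p := by
    have := Real.rpow_nonneg ha p
    have := Real.rpow_nonneg hb p
    rcases max_choice a b with h | h <;> rw [h] <;> linarith
  calc (a + b) ^ p ≤ (2 * max a b) ^ p := by
        gcongr; linarith [le_max_left a b, le_max_right a b]
    _ = 2 ^ p * (max a b) ^ p := Real.mul_rpow (by norm_num) (le_max_of_le_left ha)
    _ ≤ _ := by gcongr

section

variable {Ω : Type*} [MeasurableSpace Ω] {μ : Measure Ω}

/-- A variant of dominated convergence: the dominating function may depend on the index through a
part whose integral is eventually as small as desired. -/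
theorem tendsto_integral_abs_of_dominated_up_to {G : ℕ → Ω → ℝ}
    (hmeas : ∀ n, AEStronglyMeasurable (G n) μ)
    (hlim : ∀ᵐ x ∂μ, Tendsto (fun n => G n x) atTop (𝓝 0))
    (hdom : ∀ δ > 0, ∃ (k : Ω → ℝ) (b : ℕ → Ω → ℝ), Integrable k μ ∧ (∀ n, Integrable (b n) μ) ∧
      (∀ n x, 0 ≤ b n x) ∧ (∀ᶠ n in atTop, ∫ x, b n x ∂μ ≤ δ) ∧
      ∀ n, ∀ᵐ x ∂μ, |G n x| ≤ k x + b n x) :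
    Tendsto (fun n => ∫ x, |G n x| ∂μ) atTop (𝓝 0) := by
  rw [Metric.tendsto_atTop']
  intro η hη
  obtain ⟨k, b, hk, hb, hb0, hbi, hG⟩ := hdom (η / 2) (by positivity)
  have hGi : ∀ n, Integrable (fun x => |G n x|) μ := fun n =>
    (hk.add (hb n)).mono' (hmeas n).norm <| by
      filter_upwards [hG n] with x hx
      simpa using hx
  have key : Tendsto (fun n => ∫ x, max (|G n x| - b n x) 0 ∂μ) atTop (𝓝 (∫ _, (0:ℝ) ∂μ)) := by
    refine tendsto_integral_of_dominated_convergence (fun x => |k x|) (fun n => ?_) hk.abs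
      (fun n => ?_) ?_
    · exact ((hGi n).sub (hb n)).1.sup aestronglyMeasurable_const
    · filter_upwards [hG n] with x hx
      rw [Real.norm_eq_abs, abs_of_nonneg (le_max_right _ _)]
      exact max_le (by linarith [le_abs_self (k x)]) (abs_nonneg _)
    · filter_upwards [hlim] with x hx
      refine squeeze_zero (fun n => le_max_right _ _) (fun n => ?_)
        (by simpa using hx.abs : Tendsto (fun n => |G n x|) atTop (𝓝 0))
      exact max_le (by linarith [hb0 n x]) (abs_nonneg _)
  rw [integral_zero] at key
  obtain ⟨M, hM⟩ := eventually_atTop.1 ((key.eventually (gt_mem_nhds (half_pos hη))).and hbi)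
  refine ⟨M, fun n hn => ?_⟩
  obtain ⟨h1, h2⟩ := hM n hn.le
  rw [Real.dist_eq, sub_zero, abs_of_nonneg (integral_nonneg fun _ => abs_nonneg _)]
  have h3 : ∫ x, |G n x| ∂μ ≤ ∫ x, (max (|G n x| - b n x) 0 + b n x) ∂μ := by
    refine integral_mono (hGi n) ?_ fun x => ?_
    · exact (((hGi n).sub (hb n)).sup (integrable_zero _ _ _)).add (hb n)
    · simp only; linarith [le_max_left (|G n x| - b n x) 0]
  have h4 : ∫ x, (max (|G n x| - b n x) 0 + b n x) ∂μ
      = (∫ x, max (|G n x| - b n x) 0 ∂μ) + ∫ x, b n x ∂μ :=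
    integral_add (((hGi n).sub (hb n)).sup (integrable_zero _ _ _)) (hb n)
  linarith

/-- If `G n → 0` almost everywhere and `|G n| ≤ C (a n + b)^(p-1) b`, where the `a n` are bounded in
`L^p` and `b ∈ L^p`, then `G n → 0` in `L¹`. -/
theorem tendsto_integral_abs_of_mixed_growth {p C M : ℝ} (hp : 1 < p) (hC : 0 ≤ C)
    {G : ℕ → Ω → ℝ} {a : ℕ → Ω → ℝ} {b : Ω → ℝ}
    (hmeas : ∀ n, AEStronglyMeasurable (G n) μ)
    (hlim : ∀ᵐ x ∂μ, Tendsto (fun n => G n x) atTop (𝓝 0))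
    (ha0 : ∀ n x, 0 ≤ a n x) (hb0 : ∀ x, 0 ≤ b x)
    (ha : ∀ n, Integrable (fun x => a n x ^ p) μ) (hb : Integrable (fun x => b x ^ p) μ)
    (haM : ∀ n, ∫ x, a n x ^ p ∂μ ≤ M)
    (hG : ∀ n, ∀ᵐ x ∂μ, |G n x| ≤ C * ((a n x + b x) ^ (p - 1) * b x)) :
    Tendsto (fun n => ∫ x, |G n x| ∂μ) atTop (𝓝 0) := by
  refine tendsto_integral_abs_of_dominated_up_to hmeas hlim fun δ hδ => ?_
  set η : ℝ := δ / ((C * 2 ^ p + 1) * (|M| + 1)) with hηdef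
  have hη : 0 < η := by positivity
  obtain ⟨K, hK, hY⟩ := exists_young_const hp hη
  refine ⟨fun x => C * (η * 2 ^ p + K) * b x ^ p, fun n x => C * η * 2 ^ p * a n x ^ p,
    hb.const_mul _, fun n => (ha n).const_mul _, fun n x => ?_, Eventually.of_forall fun n => ?_,
    fun n => ?_⟩
  · have := Real.rpow_nonneg (ha0 n x) p
    positivity
  · rw [integral_const_mul]
    have h0 : 0 ≤ ∫ x, a n x ^ p ∂μ := integral_nonneg fun x => Real.rpow_nonneg (ha0 n x) p
    have h1 : C * η * 2 ^ p * ∫ x, a n x ^ p ∂μ ≤ C * η * 2 ^ p * (|M| + 1) := by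
      have := haM n
      gcongr
      linarith [le_abs_self M]
    refine h1.trans ?_
    have h2 : (C * 2 ^ p + 1) * (|M| + 1) * η = δ := by
      rw [hηdef]; field_simp
    nlinarith [show 0 ≤ (|M| + 1) * η by positivity]
  · filter_upwards [hG n] with x hx
    have h1 := hY (a n x + b x) (b x) (add_nonneg (ha0 n x) (hb0 x)) (hb0 x)
    have h2 := add_rpow_le_two_rpow_mul (ha0 n x) (hb0 x) (by linarith : 0 ≤ p)
    calc |G n x| ≤ C * (η * (2 ^ p * (a n x ^ p + b x ^ p)) + K * b x ^ p) := by
          refine hx.trans ?_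
          gcongr
          refine h1.trans ?_
          gcongr
      _ = _ := by ring

end

/-! ### Positively homogeneous, locally Lipschitz integrands -/

section HomLip

variable {E : Type*} [NormedAddCommGroup E] [NormedSpace ℝ E]

/-- `F` is positively homogeneous of degree `p`, and Lipschitz on balls with the constant that
homogeneity dictates.  No differentiability is required, so that `(u⁺)(v⁺)^β` is covered. -/
structure HomLip (p : ℝ) (F : E → ℝ) : Prop where
  lip : ∃ C : ℝ, 0 ≤ C ∧ ∀ x y, |F x - F y| ≤ C * ((‖x‖ + ‖y‖) ^ (p - 1) * ‖x - y‖)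
  hom : ∀ t : ℝ, 0 < t → ∀ x, F (t • x) = t ^ p * F x

variable {p : ℝ} {F : E → ℝ}

theorem HomLip.zero (h : HomLip p F) (hp : 1 < p) : F 0 = 0 := by
  have h1 := h.hom 2 two_pos 0
  rw [smul_zero] at h1
  have h2 : (1:ℝ) < 2 ^ p := Real.one_lt_rpow one_lt_two (by linarith)
  nlinarith [h1, h2, sq_nonneg (F 0)]

theorem HomLip.continuous (h : HomLip p F) (hp : 1 < p) : Continuous F := by
  obtain ⟨C, hC, hF⟩ := h.lip
  rw [continuous_iff_continuousAt]
  intro y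
  rw [ContinuousAt, tendsto_iff_dist_tendsto_zero]
  have h1 : Tendsto (fun x => C * ((‖x‖ + ‖y‖) ^ (p - 1) * ‖x - y‖)) (𝓝 y)
      (𝓝 (C * ((‖y‖ + ‖y‖) ^ (p - 1) * ‖y - y‖))) := by
    have : Continuous fun x => C * ((‖x‖ + ‖y‖) ^ (p - 1) * ‖x - y‖) := by
      have h2 : Continuous fun x : E => (‖x‖ + ‖y‖) ^ (p - 1) :=
        (continuous_norm.add continuous_const).rpow_const fun x => Or.inr (by linarith)
      fun_prop
    exact this.tendsto y
  rw [sub_self, norm_zero, mul_zero, mul_zero] at h1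
  exact squeeze_zero (fun _ => dist_nonneg) (fun x => by rw [Real.dist_eq]; exact hF x y) h1

theorem rpow_sub_one_mul_self {a p : ℝ} (ha : 0 ≤ a) (hp : 1 < p) : a ^ (p - 1) * a = a ^ p := by
  conv_rhs => rw [show p = p - 1 + 1 by ring]
  rw [Real.rpow_add_one' ha (by linarith)]

theorem HomLip.abs_le (h : HomLip p F) (hp : 1 < p) :
    ∃ C : ℝ, 0 ≤ C ∧ ∀ x, |F x| ≤ C * ‖x‖ ^ p := by
  obtain ⟨C, hC, hF⟩ := h.lip
  refine ⟨C, hC, fun x => ?_⟩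
  have := hF x 0
  rwa [h.zero hp, sub_zero, norm_zero, add_zero, sub_zero,
    rpow_sub_one_mul_self (norm_nonneg _) hp] at this

/-- The difference quotients of `F` at points near `y`, in the direction `y`, converge to the value
`p F(y)` of Euler's identity, although `F` need not be differentiable at `y`: up to the Lipschitz
error, a step from `y + e` in the direction `y` is a dilation. -/
theorem HomLip.tendsto_slope (h : HomLip p F) (hp : 1 < p) (y : E) {e : ℕ → E} {t : ℕ → ℝ}
    (he : Tendsto e atTop (𝓝 0)) (ht0 : ∀ n, 0 < t n) (ht : Tendsto t atTop (𝓝 0)) :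
    Tendsto (fun n => (F (e n + y + t n • y) - F (e n + y)) / t n) atTop (𝓝 (p * F y)) := by
  obtain ⟨C, hC, hF⟩ := h.lip
  have hcont := h.continuous hp
  set c : ℕ → ℝ := fun n => (1 + t n)⁻¹ with hc
  have hc1 : Tendsto c atTop (𝓝 1) := by
    have : Tendsto (fun n => (1 + t n)⁻¹) atTop (𝓝 (1 + 0)⁻¹) :=
      (tendsto_const_nhds.add ht).inv₀ (by norm_num)
    simpa using this
  have hce : Tendsto (fun n => c n • e n + y) atTop (𝓝 y) := by
    simpa using (hc1.smul he).add_const y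
  have hey : Tendsto (fun n => e n + y) atTop (𝓝 y) := by simpa using he.add_const y
  have hid : ∀ n, (F (e n + y + t n • y) - F (e n + y)) / t n
      = ((1 + t n) ^ p - 1) / t n * F (c n • e n + y)
        + (F (c n • e n + y) - F (e n + y)) / t n := by
    intro n
    have h1 : 0 < 1 + t n := by linarith [ht0 n]
    have h2 : e n + y + t n • y = (1 + t n) • (c n • e n + y) := by
      simp only [hc]
      rw [smul_add, smul_smul, mul_inv_cancel₀ h1.ne', one_smul, add_smul, one_smul, add_assoc]
    rw [h2, h.hom _ h1]
    ring
  simp_rw [hid]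
  have hA : Tendsto (fun n => ((1 + t n) ^ p - 1) / t n) atTop (𝓝 p) := by
    have hd : HasDerivAt (fun r : ℝ => (1 + r) ^ p) p 0 := by
      have := (Real.hasDerivAt_rpow_const (x := 1) (p := p) (Or.inl one_ne_zero))
      have h2 := HasDerivAt.comp_const_add (f := fun r : ℝ => r ^ p) (1:ℝ) (0:ℝ) (by simpa using this)
      simpa using h2
    have h3 := hd.tendsto_slope_zero
    have h4 : Tendsto t atTop (𝓝[≠] 0) :=
      tendsto_nhdsWithin_iff.2 ⟨ht, Eventually.of_forall fun n => (ht0 n).ne'⟩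
    refine (h3.comp h4).congr fun n => ?_
    simp only [Function.comp, zero_add, add_zero, Real.one_rpow, smul_eq_mul]
    rw [inv_mul_eq_div]
  have hB : Tendsto (fun n => (F (c n • e n + y) - F (e n + y)) / t n) atTop (𝓝 0) := by
    refine squeeze_zero_norm (a := fun n =>
      C * ((‖c n • e n + y‖ + ‖e n + y‖) ^ (p - 1) * (c n * ‖e n‖))) (fun n => ?_) ?_
    · have h1 : 0 < 1 + t n := by linarith [ht0 n]
      have h2 : c n • e n + y - (e n + y) = -((t n * c n) • e n) := by
        rw [add_sub_add_right_eq_sub, ← neg_smul, sub_eq_iff_eq_add]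
        conv_rhs => rw [← one_smul ℝ (e n), smul_smul, ← add_smul]
        congr 1
        simp only [hc]; field_simp; ring
      rw [Real.norm_eq_abs, abs_div, abs_of_pos (ht0 n), div_le_iff₀ (ht0 n)]
      refine (hF _ _).trans (le_of_eq ?_)
      have hc0 : 0 < c n := inv_pos.2 h1
      rw [h2, norm_neg, norm_smul, Real.norm_eq_abs, abs_of_pos (mul_pos (ht0 n) hc0)]
      ring
    · have h1 : Tendsto (fun n => (‖c n • e n + y‖ + ‖e n + y‖) ^ (p - 1)) atTop
          (𝓝 ((‖y‖ + ‖y‖) ^ (p - 1))) :=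
        (hce.norm.add hey.norm).rpow_const (Or.inr (by linarith))
      have h2 := (h1.mul (hc1.mul he.norm)).const_mul C
      simpa using h2
  simpa using (hA.mul ((hcont.tendsto y).comp hce)).add hB

variable {Ω : Type*} [MeasurableSpace Ω] {μ : Measure Ω}

theorem integrable_norm_rpow_ofReal {G : Type*} [NormedAddCommGroup G] {p : ℝ} (hp : 1 < p)
    {f : Ω → G} (hf : MemLp f (ENNReal.ofReal p) μ) : Integrable (fun x => ‖f x‖ ^ p) μ := by
  have h0 : ENNReal.ofReal p ≠ 0 := by simpa using by linarith
  have := hf.integrable_norm_rpow h0 ENNReal.ofReal_ne_top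
  rwa [ENNReal.toReal_ofReal (by linarith)] at this

theorem HomLip.integrable (h : HomLip p F) (hp : 1 < p) {f : Ω → E}
    (hf : MemLp f (ENNReal.ofReal p) μ) : Integrable (fun x => F (f x)) μ := by
  obtain ⟨C, hC, hF⟩ := h.abs_le hp
  exact ((integrable_norm_rpow_ofReal hp hf).const_mul C).mono'
    ((h.continuous hp).comp_aestronglyMeasurable hf.1) (Eventually.of_forall fun x => hF _)

/-- The Brezis–Lieb splitting. -/
theorem HomLip.tendsto_integral_add (h : HomLip p F) (hp : 1 < p) {w : ℕ → Ω → E} {f : Ω → E}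
    {M : ℝ} (hw : ∀ n, MemLp (w n) (ENNReal.ofReal p) μ) (hf : MemLp f (ENNReal.ofReal p) μ)
    (hM : ∀ n, ∫ x, ‖w n x‖ ^ p ∂μ ≤ M)
    (hlim : ∀ᵐ x ∂μ, Tendsto (fun n => w n x) atTop (𝓝 0)) :
    Tendsto (fun n => (∫ x, F (w n x + f x) ∂μ) - ∫ x, F (w n x) ∂μ) atTop
      (𝓝 (∫ x, F (f x) ∂μ)) := by
  obtain ⟨C, hC, hF⟩ := h.lip
  have hcont := h.continuous hp
  have i1 : ∀ n, Integrable (fun x => F (w n x + f x)) μ := fun n =>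
    h.integrable hp ((hw n).add hf)
  have i2 : ∀ n, Integrable (fun x => F (w n x)) μ := fun n => h.integrable hp (hw n)
  have i3 : Integrable (fun x => F (f x)) μ := h.integrable hp hf
  have key := tendsto_integral_abs_of_mixed_growth (μ := μ) (p := p) (C := C * 2 ^ (p - 1) + C)
    (M := M) hp (by positivity) (G := fun n x => F (w n x + f x) - F (w n x) - F (f x))
    (a := fun n x => ‖w n x‖) (b := fun x => ‖f x‖)
    (fun n => (((i1 n).sub (i2 n)).sub i3).1) ?_ (fun _ _ => norm_nonneg _)
    (fun _ => norm_nonneg _) (fun n => integrable_norm_rpow_ofReal hp (hw n))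
    (integrable_norm_rpow_ofReal hp hf) hM ?_
  · rw [tendsto_iff_dist_tendsto_zero]
    refine squeeze_zero (fun _ => dist_nonneg) (fun n => ?_) key
    have e : ∫ x, (F (w n x + f x) - F (w n x) - F (f x)) ∂μ
        = (∫ x, (F (w n x + f x) - F (w n x)) ∂μ) - ∫ x, F (f x) ∂μ :=
      integral_sub ((i1 n).sub (i2 n)) i3
    rw [Real.dist_eq, ← integral_sub (i1 n) (i2 n), ← e]
    exact abs_integral_le_integral_abs
  · filter_upwards [hlim] with x hx
    have h1 := (hcont.tendsto _).comp (hx.add_const (f x))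
    have h2 := (hcont.tendsto _).comp hx
    have h3 := (h1.sub h2).sub_const (F (f x))
    simpa [Function.comp_def, h.zero hp] using h3
  · refine fun n => Eventually.of_forall fun x => ?_
    have h1 := hF (w n x + f x) (w n x)
    have h2 := hF (f x) 0
    rw [h.zero hp, sub_zero, norm_zero, add_zero, sub_zero] at h2
    rw [add_sub_cancel_left] at h1
    have hn := norm_add_le (w n x) (f x)
    have e1 : (‖w n x + f x‖ + ‖w n x‖) ^ (p - 1) ≤
        2 ^ (p - 1) * (‖w n x‖ + ‖f x‖) ^ (p - 1) := by
      rw [← Real.mul_rpow (by norm_num) (by positivity)]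
      gcongr
      linarith [norm_nonneg (f x)]
    have e2 : ‖f x‖ ^ (p - 1) ≤ (‖w n x‖ + ‖f x‖) ^ (p - 1) := by
      gcongr
      linarith [norm_nonneg (w n x)]
    calc |F (w n x + f x) - F (w n x) - F (f x)|
        ≤ |F (w n x + f x) - F (w n x)| + |F (f x)| := abs_sub _ _
      _ ≤ C * (2 ^ (p - 1) * (‖w n x‖ + ‖f x‖) ^ (p - 1) * ‖f x‖)
          + C * ((‖w n x‖ + ‖f x‖) ^ (p - 1) * ‖f x‖) := by
          refine add_le_add (h1.trans ?_) (h2.trans ?_) <;> gcongr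
      _ = _ := by ring

/-- The difference quotients of `∫ F` at `w n + f` in the direction `f` converge to `p ∫ F(f)`. -/
theorem HomLip.tendsto_integral_slope (h : HomLip p F) (hp : 1 < p) {w : ℕ → Ω → E} {f : Ω → E}
    {M : ℝ} {t : ℕ → ℝ} (hw : ∀ n, MemLp (w n) (ENNReal.ofReal p) μ)
    (hf : MemLp f (ENNReal.ofReal p) μ) (hM : ∀ n, ∫ x, ‖w n x‖ ^ p ∂μ ≤ M)
    (hlim : ∀ᵐ x ∂μ, Tendsto (fun n => w n x) atTop (𝓝 0))
    (ht0 : ∀ n, 0 < t n) (ht1 : ∀ n, t n ≤ 1) (ht : Tendsto t atTop (𝓝 0)) :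
    Tendsto (fun n => ((∫ x, F (w n x + f x + t n • f x) ∂μ) - ∫ x, F (w n x + f x) ∂μ) / t n) atTop
      (𝓝 (p * ∫ x, F (f x) ∂μ)) := by
  obtain ⟨C, hC, hF⟩ := h.lip
  have hcont := h.continuous hp
  have i1 : ∀ n, Integrable (fun x => F (w n x + f x + t n • f x)) μ := fun n =>
    h.integrable hp (((hw n).add hf).add (hf.const_smul (t n)))
  have i2 : ∀ n, Integrable (fun x => F (w n x + f x)) μ := fun n =>
    h.integrable hp ((hw n).add hf)
  have i3 : Integrable (fun x => p * F (f x)) μ := (h.integrable hp hf).const_mul p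
  have key := tendsto_integral_abs_of_mixed_growth (μ := μ) (p := p)
    (C := C * 3 ^ (p - 1) + p * C)
    (M := M) hp (by positivity)
    (G := fun n x => (F (w n x + f x + t n • f x) - F (w n x + f x)) / t n - p * F (f x))
    (a := fun n x => ‖w n x‖) (b := fun x => ‖f x‖)
    (fun n => ((((i1 n).sub (i2 n)).div_const _).sub i3).1) ?_ (fun _ _ => norm_nonneg _)
    (fun _ => norm_nonneg _) (fun n => integrable_norm_rpow_ofReal hp (hw n))
    (integrable_norm_rpow_ofReal hp hf) hM ?_
  · rw [tendsto_iff_dist_tendsto_zero]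
    refine squeeze_zero (fun _ => dist_nonneg) (fun n => ?_) key
    have e : ∫ x, ((F (w n x + f x + t n • f x) - F (w n x + f x)) / t n - p * F (f x)) ∂μ
        = (∫ x, (F (w n x + f x + t n • f x) - F (w n x + f x)) / t n ∂μ)
          - ∫ x, p * F (f x) ∂μ :=
      integral_sub (((i1 n).sub (i2 n)).div_const _) i3
    rw [Real.dist_eq, ← integral_sub (i1 n) (i2 n), ← integral_div, ← integral_const_mul, ← e]
    exact abs_integral_le_integral_abs
  · filter_upwards [hlim] with x hx
    simpa using (h.tendsto_slope hp (f x) hx ht0 ht).sub_const (p * F (f x))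
  · refine fun n => Eventually.of_forall fun x => ?_
    have h1 := hF (w n x + f x + t n • f x) (w n x + f x)
    have h2 := hF (f x) 0
    rw [h.zero hp, sub_zero, norm_zero, add_zero, sub_zero] at h2
    have htn : ‖t n • f x‖ = t n * ‖f x‖ := by
      rw [norm_smul, Real.norm_eq_abs, abs_of_pos (ht0 n)]
    rw [add_sub_cancel_left, htn] at h1
    have hn := norm_add_le (w n x) (f x)
    have hn2 := norm_add_le (w n x + f x) (t n • f x)
    have htl : t n * ‖f x‖ ≤ ‖f x‖ := mul_le_of_le_one_left (norm_nonneg _) (ht1 n)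
    have e1 : (‖w n x + f x + t n • f x‖ + ‖w n x + f x‖) ^ (p - 1) ≤
        3 ^ (p - 1) * (‖w n x‖ + ‖f x‖) ^ (p - 1) := by
      rw [← Real.mul_rpow (by norm_num) (by positivity)]
      gcongr
      linarith [norm_nonneg (f x), norm_nonneg (w n x)]
    have e2 : ‖f x‖ ^ (p - 1) ≤ (‖w n x‖ + ‖f x‖) ^ (p - 1) := by
      gcongr
      linarith [norm_nonneg (w n x)]
    have h3 : |(F (w n x + f x + t n • f x) - F (w n x + f x)) / t n| ≤
        C * (3 ^ (p - 1) * (‖w n x‖ + ‖f x‖) ^ (p - 1) * ‖f x‖) := by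
      rw [abs_div, abs_of_pos (ht0 n), div_le_iff₀ (ht0 n)]
      calc _ ≤ _ := h1
        _ ≤ C * (3 ^ (p - 1) * (‖w n x‖ + ‖f x‖) ^ (p - 1) * (t n * ‖f x‖)) := by
          have := ht0 n
          gcongr
        _ = _ := by ring
    have h4 : |p * F (f x)| ≤ p * (C * ((‖w n x‖ + ‖f x‖) ^ (p - 1) * ‖f x‖)) := by
      rw [abs_mul, abs_of_pos (by linarith : 0 < p)]
      gcongr
      refine h2.trans ?_
      gcongr
    calc _ ≤ _ := abs_sub _ _
      _ ≤ _ := add_le_add h3 h4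
      _ = _ := by ring

end HomLip

/-! ### Integral functionals on Lebesgue spaces -/

section Nemytskii

variable {E : Type*} [NormedAddCommGroup E]
variable {Ω : Type*} [MeasurableSpace Ω] {μ : Measure Ω} {p : ℝ}

theorem Lp_norm_rpow_eq_integral (hp : 1 < p) (f : Lp E (ENNReal.ofReal p) μ) :
    ‖f‖ ^ p = ∫ x, ‖f x‖ ^ p ∂μ := by
  have h0 : ENNReal.ofReal p ≠ 0 := by simpa using by linarith
  have hI : 0 ≤ ∫ x, ‖f x‖ ^ p ∂μ := integral_nonneg fun _ => by positivity
  rw [Lp.norm_def, (Lp.memLp f).eLpNorm_eq_integral_rpow_norm h0 ENNReal.ofReal_ne_top,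
    ENNReal.toReal_ofReal (by linarith : 0 ≤ p), ENNReal.toReal_ofReal (by positivity),
    ← Real.rpow_mul hI, inv_mul_cancel₀ (by linarith), Real.rpow_one]

/-- On bounded sets of `L^p` the functional `f ↦ ∫ F(f)` is Lipschitz. -/
theorem HomLip.exists_lipschitz_const [NormedSpace ℝ E] [Fact (1 ≤ ENNReal.ofReal p)] {F : E → ℝ}
    (h : HomLip p F) (hp : 1 < p) {M : ℝ} (hM0 : 0 ≤ M) :
    ∃ L : ℝ, 0 ≤ L ∧ ∀ f g : Lp E (ENNReal.ofReal p) μ, ‖f‖ ≤ M → ‖g‖ ≤ M →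
      |(∫ x, F (f x) ∂μ) - ∫ x, F (g x) ∂μ| ≤ L * ‖f - g‖ := by
  obtain ⟨C, hC, hF⟩ := h.lip
  refine ⟨C * (2 ^ p * (M ^ p + M ^ p) + 1), by positivity, fun f g hf hg => ?_⟩
  rcases (norm_nonneg (f - g)).eq_or_lt with h0 | hη
  · have : f = g := sub_eq_zero.1 (norm_eq_zero.1 h0.symm)
    simp [this]
  set η := ‖f - g‖
  have i1 := h.integrable hp (Lp.memLp f)
  have i2 := h.integrable hp (Lp.memLp g)
  have n1 := integrable_norm_rpow_ofReal hp (Lp.memLp f)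
  have n2 := integrable_norm_rpow_ofReal hp (Lp.memLp g)
  have n3 := integrable_norm_rpow_ofReal hp (Lp.memLp (f - g))
  have hy : ∀ a b : ℝ, 0 ≤ a → 0 ≤ b → a ^ (p - 1) * b ≤ a ^ p + b ^ p := by
    intro a b ha hb
    have ha' := Real.rpow_nonneg ha p
    have hb' := Real.rpow_nonneg hb p
    rcases le_total a b with hab | hab
    · calc a ^ (p - 1) * b ≤ b ^ (p - 1) * b := by gcongr
        _ ≤ _ := by rw [rpow_sub_one_mul_self hb hp]; linarith
    · calc a ^ (p - 1) * b ≤ a ^ (p - 1) * a := by gcongr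
        _ ≤ _ := by rw [rpow_sub_one_mul_self ha hp]; linarith
  have hpt : ∀ᵐ x ∂μ, |F (f x) - F (g x)| ≤
      C * (η * (2 ^ p * (‖f x‖ ^ p + ‖g x‖ ^ p) + η ^ (-p) * ‖(f - g) x‖ ^ p)) := by
    filter_upwards [Lp.coeFn_sub f g] with x hx
    refine (hF _ _).trans ?_
    rw [← Pi.sub_apply, ← hx]
    refine mul_le_mul_of_nonneg_left ?_ hC
    have h1 := hy (‖f x‖ + ‖g x‖) (‖(f - g) x‖ / η) (by positivity) (by positivity)
    have h2 := add_rpow_le_two_rpow_mul (norm_nonneg (f x)) (norm_nonneg (g x))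
      (by linarith : 0 ≤ p)
    have h3 : (‖(f - g) x‖ / η) ^ p = η ^ (-p) * ‖(f - g) x‖ ^ p := by
      rw [Real.div_rpow (norm_nonneg _) hη.le, Real.rpow_neg hη.le]; ring
    rw [h3] at h1
    calc (‖f x‖ + ‖g x‖) ^ (p - 1) * ‖(f - g) x‖
        = η * ((‖f x‖ + ‖g x‖) ^ (p - 1) * (‖(f - g) x‖ / η)) := by field_simp
      _ ≤ _ := by gcongr; linarith
  rw [← integral_sub i1 i2]
  have iR : Integrable (fun x =>
      C * (η * (2 ^ p * (‖f x‖ ^ p + ‖g x‖ ^ p) + η ^ (-p) * ‖(f - g) x‖ ^ p))) μ :=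
    ((((n1.add n2).const_mul _).add (n3.const_mul _)).const_mul _).const_mul _
  calc |∫ x, (F (f x) - F (g x)) ∂μ| ≤ ∫ x, |F (f x) - F (g x)| ∂μ :=
        abs_integral_le_integral_abs
    _ ≤ _ := integral_mono_ae (i1.sub i2).abs iR hpt
    _ = C * (η * (2 ^ p * (‖f‖ ^ p + ‖g‖ ^ p) + η ^ (-p) * ‖f - g‖ ^ p)) := by
        have e1 : ∫ x, (2 ^ p * (‖f x‖ ^ p + ‖g x‖ ^ p) + η ^ (-p) * ‖(f - g) x‖ ^ p) ∂μ
            = (∫ x, 2 ^ p * (‖f x‖ ^ p + ‖g x‖ ^ p) ∂μ) + ∫ x, η ^ (-p) * ‖(f - g) x‖ ^ p ∂μ :=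
          integral_add ((n1.add n2).const_mul _) (n3.const_mul _)
        rw [integral_const_mul, integral_const_mul, e1, integral_const_mul, integral_const_mul,
          integral_add n1 n2, ← Lp_norm_rpow_eq_integral hp, ← Lp_norm_rpow_eq_integral hp,
          ← Lp_norm_rpow_eq_integral hp]
    _ ≤ C * (η * (2 ^ p * (M ^ p + M ^ p) + 1)) := by
        have e2 : η ^ (-p) * ‖f - g‖ ^ p = 1 := by
          rw [Real.rpow_neg hη.le, inv_mul_cancel₀]; positivity
        rw [e2]
        gcongr
    _ = _ := by ring

/-- Continuity of superposition operators: if `|g x h| ≤ C (‖f x‖ + ‖h‖)^p`, and `g x h → 0` as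
`h → 0`, then `∫ |g x (h n x)| → 0` whenever `h n → 0` in `L^p`. -/
theorem tendsto_integral_superposition (hp : 1 < p) {C : ℝ} (hC : 0 ≤ C) {g : Ω → E → ℝ}
    (f : Lp E (ENNReal.ofReal p) μ) {h : ℕ → Lp E (ENNReal.ofReal p) μ}
    (hh : Tendsto (fun n => ‖h n‖) atTop (𝓝 0))
    (hmeas : ∀ n, AEStronglyMeasurable (fun x => g x (h n x)) μ)
    (hg0 : ∀ x, Tendsto (g x) (𝓝 0) (𝓝 0))
    (hg : ∀ x y, |g x y| ≤ C * (‖f x‖ + ‖y‖) ^ p) :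
    Tendsto (fun n => ∫ x, |g x (h n x)| ∂μ) atTop (𝓝 0) := by
  have hp0 : ENNReal.ofReal p ≠ 0 := by simpa using by linarith
  refine tendsto_of_subseq_tendsto fun ns hns => ?_
  have hm : TendstoInMeasure μ (fun n => (h (ns n) : Ω → E)) atTop (fun _ => (0 : E)) := by
    refine tendstoInMeasure_of_tendsto_eLpNorm hp0 (fun n => (Lp.memLp _).1)
      aestronglyMeasurable_const ?_
    have h1 : Tendsto (fun n => ENNReal.ofReal ‖h (ns n)‖) atTop (𝓝 (ENNReal.ofReal 0)) :=
      ENNReal.tendsto_ofReal (hh.comp hns)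
    rw [ENNReal.ofReal_zero] at h1
    refine h1.congr fun n => ?_
    rw [Lp.norm_def, ENNReal.ofReal_toReal (Lp.memLp _).2.ne]
    congr 1
    funext x
    simp
  obtain ⟨ms, hms, hae⟩ := hm.exists_seq_tendsto_ae
  refine ⟨ms, tendsto_integral_abs_of_dominated_up_to (G := fun n x => g x (h (ns (ms n)) x))
    (fun n => hmeas _) ?_ fun δ hδ => ?_⟩
  · filter_upwards [hae] with x hx
    exact (hg0 x).comp hx
  · refine ⟨fun x => C * 2 ^ p * ‖f x‖ ^ p, fun n x => C * 2 ^ p * ‖h (ns (ms n)) x‖ ^ p,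
      (integrable_norm_rpow_ofReal hp (Lp.memLp f)).const_mul _,
      fun n => (integrable_norm_rpow_ofReal hp (Lp.memLp _)).const_mul _,
      fun n x => by positivity, ?_, fun n => Eventually.of_forall fun x => ?_⟩
    · have h1 : Tendsto (fun n => C * 2 ^ p * ‖h (ns (ms n))‖ ^ p) atTop (𝓝 (C * 2 ^ p * 0 ^ p)) :=
        ((hh.comp (hns.comp hms.tendsto_atTop)).rpow_const (Or.inr (by linarith))).const_mul _
      rw [Real.zero_rpow (by linarith), mul_zero] at h1
      filter_upwards [h1.eventually (gt_mem_nhds hδ)] with n hn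
      rw [integral_const_mul, ← Lp_norm_rpow_eq_integral hp]
      exact hn.le
    · refine (hg x _).trans ?_
      have := add_rpow_le_two_rpow_mul (norm_nonneg (f x)) (norm_nonneg (h (ns (ms n)) x))
        (by linarith : 0 ≤ p)
      calc _ ≤ C * (2 ^ p * (‖f x‖ ^ p + ‖h (ns (ms n)) x‖ ^ p)) := by gcongr
        _ = _ := by ring

variable [NormedSpace ℝ E]

/-- `F` is continuously differentiable with derivative `F'`, whose norm grows at most like the power
`p - 1`. -/
structure HasPowerGrowthDeriv (p : ℝ) (F : E → ℝ) (F' : E → E →L[ℝ] ℝ) : Prop where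
  deriv : ∀ x, HasFDerivAt F (F' x) x
  cont : Continuous F'
  bound : ∃ C : ℝ, 0 ≤ C ∧ ∀ x, ‖F' x‖ ≤ C * ‖x‖ ^ (p - 1)

variable {F : E → ℝ} {F' : E → E →L[ℝ] ℝ}

theorem HasPowerGrowthDeriv.lip (h : HasPowerGrowthDeriv p F F') (hp : 1 < p) :
    ∃ C : ℝ, 0 ≤ C ∧ ∀ x y, |F x - F y| ≤ C * ((‖x‖ + ‖y‖) ^ (p - 1) * ‖x - y‖) := by
  obtain ⟨C, hC, hb⟩ := h.bound
  refine ⟨C, hC, fun x y => ?_⟩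
  have := (convex_closedBall (0 : E) (‖x‖ + ‖y‖)).norm_image_sub_le_of_norm_hasFDerivWithin_le
    (f := F) (f' := F') (C := C * (‖x‖ + ‖y‖) ^ (p - 1)) (x := y) (y := x)
    (fun z _ => (h.deriv z).hasFDerivWithinAt) (fun z hz => ?_) (by simp) (by simp)
  · rw [← mul_assoc]; exact this
  · refine (hb z).trans ?_
    rw [mem_closedBall_zero_iff] at hz
    gcongr

theorem HasPowerGrowthDeriv.homLip (h : HasPowerGrowthDeriv p F F') (hp : 1 < p)
    (hom : ∀ t : ℝ, 0 < t → ∀ x, F (t • x) = t ^ p * F x) : HomLip p F :=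
  ⟨h.lip hp, hom⟩

variable {p' : ℝ}

theorem HasPowerGrowthDeriv.memLp (h : HasPowerGrowthDeriv p F F') (hpp : p.HolderConjugate p')
    (f : Lp E (ENNReal.ofReal p) μ) : MemLp (fun x => F' (f x)) (ENNReal.ofReal p') μ := by
  obtain ⟨C, hC, hb⟩ := h.bound
  have hp0' : ENNReal.ofReal p' ≠ 0 := by simpa using hpp.symm.pos
  have hm : AEStronglyMeasurable (fun x => F' (f x)) μ :=
    h.cont.comp_aestronglyMeasurable (Lp.memLp f).1
  rw [← integrable_norm_rpow_iff hm hp0' ENNReal.ofReal_ne_top,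
    ENNReal.toReal_ofReal hpp.symm.nonneg]
  refine ((integrable_norm_rpow_ofReal hpp.lt (Lp.memLp f)).const_mul (C ^ p')).mono'
    ((hm.norm.aemeasurable.pow_const _).aestronglyMeasurable) (Eventually.of_forall fun x => ?_)
  rw [Real.norm_eq_abs, abs_of_nonneg (by positivity)]
  calc ‖F' (f x)‖ ^ p' ≤ (C * ‖f x‖ ^ (p - 1)) ^ p' :=
        Real.rpow_le_rpow (norm_nonneg _) (hb _) hpp.symm.nonneg
    _ = _ := by
      rw [Real.mul_rpow hC (by positivity), ← Real.rpow_mul (norm_nonneg _), hpp.sub_one_mul_conj]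

/-- The superposition operator `f ↦ F'(f)` from `L^p` to the dual exponent. -/
noncomputable def HasPowerGrowthDeriv.superposition (h : HasPowerGrowthDeriv p F F')
    (hpp : p.HolderConjugate p') (f : Lp E (ENNReal.ofReal p) μ) :
    Lp (E →L[ℝ] ℝ) (ENNReal.ofReal p') μ := (h.memLp hpp f).toLp _

theorem HasPowerGrowthDeriv.continuous_superposition (h : HasPowerGrowthDeriv p F F')
    (hpp : p.HolderConjugate p') [Fact (1 ≤ ENNReal.ofReal p)] [Fact (1 ≤ ENNReal.ofReal p')] :
    Continuous (h.superposition (μ := μ) hpp) := by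
  obtain ⟨C, hC, hb⟩ := h.bound
  have hp := hpp.lt
  have hp' := hpp.symm.lt
  rw [continuous_iff_continuousAt]
  intro f
  rw [ContinuousAt, tendsto_iff_seq_tendsto]
  intro fn hfn
  rw [tendsto_iff_norm_sub_tendsto_zero]
  have hh : Tendsto (fun n => ‖fn n - f‖) atTop (𝓝 0) := tendsto_iff_norm_sub_tendsto_zero.1 hfn
  have key := tendsto_integral_superposition (μ := μ) hp (C := (2 * C) ^ p') (by positivity)
    (g := fun x y => ‖F' (f x + y) - F' (f x)‖ ^ p') f hh (fun n => ?_) (fun x => ?_)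
    (fun x y => ?_)
  · have e : ∀ n, ∫ x, |‖F' (f x + (fn n - f) x) - F' (f x)‖ ^ p'| ∂μ
        = ‖h.superposition hpp (fn n) - h.superposition hpp f‖ ^ p' := fun n => by
      rw [Lp_norm_rpow_eq_integral hp']
      refine integral_congr_ae ?_
      filter_upwards [Lp.coeFn_sub (fn n) f,
        Lp.coeFn_sub (h.superposition hpp (fn n)) (h.superposition hpp f),
        (h.memLp hpp (fn n)).coeFn_toLp, (h.memLp hpp f).coeFn_toLp] with x h1 h2 h3 h4
      have h3' : (h.superposition hpp (fn n)) x = F' (fn n x) := h3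
      have h4' : (h.superposition hpp f) x = F' (f x) := h4
      rw [abs_of_nonneg (by positivity), h1, h2, Pi.sub_apply, Pi.sub_apply, h3', h4',
        add_sub_cancel]
    simp_rw [e] at key
    have k2 := key.rpow_const (p := p'⁻¹) (Or.inr (inv_nonneg.2 hpp.symm.nonneg))
    rw [Real.zero_rpow (inv_ne_zero hpp.symm.ne_zero)] at k2
    refine k2.congr fun n => ?_
    rw [Real.rpow_rpow_inv (norm_nonneg _) hpp.symm.ne_zero]
    rfl
  · have m1 : AEStronglyMeasurable (fun x => F' (f x + (fn n - f) x) - F' (f x)) μ :=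
      (h.cont.comp_aestronglyMeasurable ((Lp.memLp f).1.add (Lp.memLp _).1)).sub
        (h.cont.comp_aestronglyMeasurable (Lp.memLp f).1)
    exact (m1.norm.aemeasurable.pow_const _).aestronglyMeasurable
  · have hc : Continuous fun y => ‖F' (f x + y) - F' (f x)‖ ^ p' := by
      have := h.cont
      exact Continuous.rpow_const (by fun_prop) fun y => Or.inr hpp.symm.nonneg
    simpa [Real.zero_rpow hpp.symm.ne_zero] using hc.tendsto 0
  · rw [abs_of_nonneg (by positivity)]
    have h1 : ‖F' (f x + y) - F' (f x)‖ ≤ 2 * C * (‖f x‖ + ‖y‖) ^ (p - 1) := by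
      have e1 : ‖F' (f x + y)‖ ≤ C * (‖f x‖ + ‖y‖) ^ (p - 1) := by
        refine (hb _).trans ?_
        gcongr
        exact norm_add_le _ _
      have e2 : ‖F' (f x)‖ ≤ C * (‖f x‖ + ‖y‖) ^ (p - 1) := by
        refine (hb _).trans ?_
        gcongr
        linarith [norm_nonneg y]
      linarith [norm_sub_le (F' (f x + y)) (F' (f x))]
    calc _ ≤ (2 * C * (‖f x‖ + ‖y‖) ^ (p - 1)) ^ p' :=
          Real.rpow_le_rpow (norm_nonneg _) h1 hpp.symm.nonneg
      _ = _ := by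
        rw [Real.mul_rpow (by positivity) (by positivity), ← Real.rpow_mul (by positivity),
          hpp.sub_one_mul_conj]

/-- The functional `f ↦ ∫ F(f)` is Fréchet differentiable on `L^p`; its derivative is
`w ↦ ∫ F'(f) w`. -/
theorem HasPowerGrowthDeriv.hasFDerivAt_integral (h : HasPowerGrowthDeriv p F F')
    (hom : ∀ t : ℝ, 0 < t → ∀ x, F (t • x) = t ^ p * F x)
    (hpp : p.HolderConjugate p') [Fact (1 ≤ ENNReal.ofReal p)] [Fact (1 ≤ ENNReal.ofReal p')]
    [ENNReal.HolderConjugate (ENNReal.ofReal p') (ENNReal.ofReal p)]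
    (f : Lp E (ENNReal.ofReal p) μ) :
    HasFDerivAt (fun f : Lp E (ENNReal.ofReal p) μ => ∫ x, F (f x) ∂μ)
      ((ContinuousLinearMap.id ℝ (E →L[ℝ] ℝ)).lpPairing μ (ENNReal.ofReal p') (ENNReal.ofReal p)
        (h.superposition hpp f)) f := by
  obtain ⟨C, hC, hb⟩ := h.bound
  have hp := hpp.lt
  have hp' := hpp.symm.lt
  have hF := h.homLip hp hom
  obtain ⟨C', hC', hl⟩ := hF.lip
  rw [hasFDerivAt_iff_tendsto, tendsto_iff_seq_tendsto]
  intro fn hfn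
  have hh : Tendsto (fun n => ‖fn n - f‖) atTop (𝓝 0) := tendsto_iff_norm_sub_tendsto_zero.1 hfn
  set R : Ω → E → ℝ := fun x y => |F (f x + y) - F (f x) - F' (f x) y| / ‖y‖ with hR
  have hR0 : ∀ x y, 0 ≤ R x y := fun x y => by positivity
  have hRb : ∀ x y, R x y ≤ (C' * 2 ^ (p - 1) + C) * (‖f x‖ + ‖y‖) ^ (p - 1) := by
    intro x y
    refine div_le_of_le_mul₀ (norm_nonneg _) (by positivity) ?_
    have e1 := hl (f x + y) (f x)
    rw [add_sub_cancel_left] at e1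
    have e2 : (‖f x + y‖ + ‖f x‖) ^ (p - 1) ≤ 2 ^ (p - 1) * (‖f x‖ + ‖y‖) ^ (p - 1) := by
      rw [← Real.mul_rpow (by norm_num) (by positivity)]
      gcongr
      linarith [norm_add_le (f x) y, norm_nonneg y]
    have e3 : |F' (f x) y| ≤ C * (‖f x‖ + ‖y‖) ^ (p - 1) * ‖y‖ := by
      refine ((F' (f x)).le_opNorm y).trans ?_
      gcongr
      refine (hb _).trans ?_
      gcongr
      linarith [norm_nonneg y]
    calc _ ≤ |F (f x + y) - F (f x)| + |F' (f x) y| := abs_sub _ _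
      _ ≤ C' * (2 ^ (p - 1) * (‖f x‖ + ‖y‖) ^ (p - 1) * ‖y‖)
          + C * (‖f x‖ + ‖y‖) ^ (p - 1) * ‖y‖ := by
        refine add_le_add (e1.trans ?_) e3
        gcongr
      _ = _ := by ring
  have hRm : ∀ n, AEStronglyMeasurable (fun x => R x ((fn n - f) x)) μ := fun n => by
    have m0 := (Lp.memLp (fn n - f)).1
    have m1 : AEStronglyMeasurable (fun x => F (f x + (fn n - f) x)) μ :=
      (hF.continuous hp).comp_aestronglyMeasurable ((Lp.memLp f).1.add m0)
    have m2 : AEStronglyMeasurable (fun x => F (f x)) μ :=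
      (hF.continuous hp).comp_aestronglyMeasurable (Lp.memLp f).1
    have m3 : AEStronglyMeasurable (fun x => F' (f x) ((fn n - f) x)) μ :=
      isBoundedBilinearMap_apply.continuous.comp_aestronglyMeasurable
        ((h.cont.comp_aestronglyMeasurable (Lp.memLp f).1).prodMk m0)
    exact (((m1.sub m2).sub m3).norm.aemeasurable.div m0.norm.aemeasurable).aestronglyMeasurable
  have key := tendsto_integral_superposition (μ := μ) hp (C := (C' * 2 ^ (p - 1) + C) ^ p')
    (by positivity) (g := fun x y => R x y ^ p') f hh
    (fun n => ((hRm n).aemeasurable.pow_const _).aestronglyMeasurable) (fun x => ?_)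
    (fun x y => ?_)
  rotate_left
  · have h1 := (hasFDerivAt_iff_tendsto.1 (h.deriv (f x)))
    have h2 : Tendsto (fun y : E => f x + y) (𝓝 0) (𝓝 (f x)) := by
      simpa using (continuous_const.add continuous_id).tendsto (X := E) 0 (f := fun y => f x + y)
    have h3 := (h1.comp h2).rpow_const (p := p') (Or.inr hpp.symm.nonneg)
    rw [Real.zero_rpow hpp.symm.ne_zero] at h3
    refine h3.congr fun y => ?_
    simp only [Function.comp, add_sub_cancel_left, hR, Real.norm_eq_abs]
    rw [inv_mul_eq_div]
  · rw [abs_of_nonneg (Real.rpow_nonneg (hR0 x y) _)]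
    calc R x y ^ p' ≤ ((C' * 2 ^ (p - 1) + C) * (‖f x‖ + ‖y‖) ^ (p - 1)) ^ p' :=
          Real.rpow_le_rpow (hR0 x y) (hRb x y) hpp.symm.nonneg
      _ = _ := by
        rw [Real.mul_rpow (by positivity) (by positivity), ← Real.rpow_mul (by positivity),
          hpp.sub_one_mul_conj]
  · have k2 := key.rpow_const (p := 1 / p') (Or.inr (one_div_nonneg.2 hpp.symm.nonneg))
    rw [Real.zero_rpow (one_div_ne_zero hpp.symm.ne_zero)] at k2
    have hp0' : ENNReal.ofReal p' ≠ 0 := by simpa using hpp.symm.pos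
    have hRL : ∀ n, MemLp (fun x => R x ((fn n - f) x)) (ENNReal.ofReal p') μ := fun n => by
      rw [← integrable_norm_rpow_iff (hRm n) hp0' ENNReal.ofReal_ne_top,
        ENNReal.toReal_ofReal hpp.symm.nonneg]
      refine (((((Lp.memLp f).norm.add (Lp.memLp (fn n - f)).norm).integrable_norm_rpow
        (by simpa using hpp.pos) ENNReal.ofReal_ne_top)).const_mul
        ((C' * 2 ^ (p - 1) + C) ^ p')).mono'
        (((hRm n).norm.aemeasurable.pow_const _).aestronglyMeasurable)
        (Eventually.of_forall fun x => ?_)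
      simp only [Pi.add_apply]
      rw [Real.norm_eq_abs, abs_of_nonneg (by positivity), Real.norm_eq_abs, Real.norm_eq_abs,
        abs_of_nonneg (hR0 x _), abs_of_nonneg (by positivity : 0 ≤ ‖f x‖ + ‖(fn n - f) x‖),
        ENNReal.toReal_ofReal hpp.nonneg]
      calc R x ((fn n - f) x) ^ p'
          ≤ ((C' * 2 ^ (p - 1) + C) * (‖f x‖ + ‖(fn n - f) x‖) ^ (p - 1)) ^ p' :=
            Real.rpow_le_rpow (hR0 x _) (hRb x _) hpp.symm.nonneg
        _ = _ := by
          rw [Real.mul_rpow (by positivity) (by positivity), ← Real.rpow_mul (by positivity),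
            hpp.sub_one_mul_conj]
    refine squeeze_zero (fun n => mul_nonneg (inv_nonneg.2 (norm_nonneg _)) (norm_nonneg _))
      (fun n => ?_) k2
    refine inv_mul_le_of_le_mul₀ (norm_nonneg (fn n - f))
      (Real.rpow_nonneg (integral_nonneg fun _ => abs_nonneg _) _) ?_
    have j1 := hF.integrable hp (Lp.memLp (fn n))
    have j2 := hF.integrable hp (Lp.memLp f)
    have j3 : Integrable (fun x => (ContinuousLinearMap.id ℝ (E →L[ℝ] ℝ))
        (h.superposition hpp f x) ((fn n - f) x)) μ :=
      memLp_one_iff_integrable.1 ((ContinuousLinearMap.id ℝ (E →L[ℝ] ℝ)).memLp_of_bilin 1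
        (Lp.memLp _) (Lp.memLp _))
    have j4 : Integrable (fun x => F (fn n x) - F (f x)) μ := j1.sub j2
    rw [ContinuousLinearMap.lpPairing_eq_integral, ← integral_sub j1 j2, ← integral_sub j4 j3]
    refine (norm_integral_le_integral_norm _).trans ?_
    calc _ = ∫ x, R x ((fn n - f) x) * ‖(fn n - f) x‖ ∂μ := by
          refine integral_congr_ae ?_
          filter_upwards [Lp.coeFn_sub (fn n) f, (h.memLp hpp f).coeFn_toLp] with x h1 h4
          have h4' : (h.superposition hpp f) x = F' (f x) := h4
          have h5 : fn n x = f x + (fn n - f) x := by rw [h1, Pi.sub_apply, add_sub_cancel]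
          rw [ContinuousLinearMap.id_apply, h4', Real.norm_eq_abs]
          simp only [hR]
          by_cases h0 : (fn n - f) x = 0
          · rw [h5, h0]; simp
          · rw [div_mul_cancel₀ _ (norm_ne_zero_iff.2 h0), ← h5]
      _ ≤ (∫ x, R x ((fn n - f) x) ^ p' ∂μ) ^ (1 / p') * (∫ x, ‖(fn n - f) x‖ ^ p ∂μ) ^ (1 / p) :=
          integral_mul_le_Lp_mul_Lq_of_nonneg hpp.symm (Eventually.of_forall fun x => hR0 x _)
            (Eventually.of_forall fun x => norm_nonneg _) (hRL n) (Lp.memLp _).norm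
      _ = _ := by
          rw [← Lp_norm_rpow_eq_integral hp, one_div p, Real.rpow_rpow_inv (norm_nonneg _)
            hpp.ne_zero]
          have e : ∀ x, |R x ((fn n - f) x) ^ p'| = R x ((fn n - f) x) ^ p' := fun x =>
            abs_of_nonneg (Real.rpow_nonneg (hR0 _ _) _)
          simp only [e]
          exact mul_comm _ _

/-- If `F` is `C¹`, positively homogeneous of degree `p > 1`, and `F'` has the corresponding growth,
then `f ↦ ∫ F(f)` is a `C¹` functional on `L^p`. -/
theorem HasPowerGrowthDeriv.contDiff_integral (h : HasPowerGrowthDeriv p F F')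
    (hom : ∀ t : ℝ, 0 < t → ∀ x, F (t • x) = t ^ p * F x) (hp : 1 < p)
    [Fact (1 ≤ ENNReal.ofReal p)] :
    ContDiff ℝ 1 (fun f : Lp E (ENNReal.ofReal p) μ => ∫ x, F (f x) ∂μ) := by
  have hpp := Real.HolderConjugate.conjExponent hp
  have : Fact (1 ≤ ENNReal.ofReal p.conjExponent) := ⟨by
    rw [← ENNReal.ofReal_one]; exact ENNReal.ofReal_le_ofReal hpp.symm.lt.le⟩
  have : ENNReal.HolderConjugate (ENNReal.ofReal p.conjExponent) (ENNReal.ofReal p) :=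
    hpp.symm.ennrealOfReal
  have hd := h.hasFDerivAt_integral (μ := μ) hom hpp
  rw [contDiff_one_iff_fderiv]
  refine ⟨fun f => (hd f).differentiableAt, ?_⟩
  have : fderiv ℝ (fun f : Lp E (ENNReal.ofReal p) μ => ∫ x, F (f x) ∂μ)
      = fun f => (ContinuousLinearMap.id ℝ (E →L[ℝ] ℝ)).lpPairing μ (ENNReal.ofReal p.conjExponent)
        (ENNReal.ofReal p) (h.superposition hpp f) := funext fun f => (hd f).fderiv
  rw [this]
  exact (ContinuousLinearMap.continuous _).comp (h.continuous_superposition hpp)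

end Nemytskii

/-! ### The two nonlinearities -/

/-- The critical coupling `(a⁺)^α (b⁺)^β`. -/
noncomputable def critF (α β : ℝ) (x : ℝ × ℝ) : ℝ := max x.1 0 ^ α * max x.2 0 ^ β

theorem critF_nonneg (α β : ℝ) (x : ℝ × ℝ) : 0 ≤ critF α β x :=
  mul_nonneg (Real.rpow_nonneg (le_max_right _ _) _) (Real.rpow_nonneg (le_max_right _ _) _)

theorem abs_max_zero_rpow_sub_le {α R a b : ℝ} (hα : 1 ≤ α) (ha : |a| ≤ R) (hb : |b| ≤ R) :
    |max a 0 ^ α - max b 0 ^ α| ≤ α * R ^ (α - 1) * |a - b| := by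
  have hR : 0 ≤ R := (abs_nonneg a).trans ha
  have hmem : ∀ c : ℝ, |c| ≤ R → max c 0 ∈ Icc (0:ℝ) R := fun c hc =>
    ⟨le_max_right _ _, max_le ((le_abs_self c).trans hc) hR⟩
  have h := (convex_Icc (0:ℝ) R).norm_image_sub_le_of_norm_hasDerivWithin_le
    (f := fun t : ℝ => t ^ α) (f' := fun t => α * t ^ (α - 1)) (C := α * R ^ (α - 1))
    (x := max b 0) (y := max a 0)
    (fun x _ => (Real.hasDerivAt_rpow_const (Or.inr hα)).hasDerivWithinAt)
    (fun x hx => ?_) (hmem b hb) (hmem a ha)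
  · refine h.trans ?_
    have := abs_max_sub_max_le_abs a b 0
    rw [Real.norm_eq_abs]
    gcongr
  · have hx0 := hx.1
    rw [Real.norm_eq_abs, abs_of_nonneg (by positivity)]
    gcongr
    exact hx.2

theorem critF_homLip {α β : ℝ} (hα : 1 ≤ α) (hβ : 1 ≤ β) : HomLip (α + β) (critF α β) where
  hom t ht x := by
    have h : ∀ a : ℝ, max (t * a) 0 = t * max a 0 := fun a => by
      rw [mul_max_of_nonneg _ _ ht.le, mul_zero]
    simp only [critF, Prod.smul_fst, Prod.smul_snd, smul_eq_mul, h]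
    rw [Real.mul_rpow ht.le (le_max_right _ _), Real.mul_rpow ht.le (le_max_right _ _),
      Real.rpow_add ht]
    ring
  lip := by
    refine ⟨α + β, by linarith, fun x y => ?_⟩
    set R := ‖x‖ + ‖y‖ with hR
    have hR0 : 0 ≤ R := by positivity
    have b1 : |x.1| ≤ R := (norm_fst_le x).trans (by linarith [norm_nonneg y])
    have b2 : |x.2| ≤ R := (norm_snd_le x).trans (by linarith [norm_nonneg y])
    have b3 : |y.1| ≤ R := (norm_fst_le y).trans (by linarith [norm_nonneg x])
    have b4 : |y.2| ≤ R := (norm_snd_le y).trans (by linarith [norm_nonneg x])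
    have d1 : |x.1 - y.1| ≤ ‖x - y‖ := norm_fst_le (x - y)
    have d2 : |x.2 - y.2| ≤ ‖x - y‖ := norm_snd_le (x - y)
    have e1 := abs_max_zero_rpow_sub_le hα b1 b3
    have e2 := abs_max_zero_rpow_sub_le hβ b2 b4
    have m1 : ∀ a γ : ℝ, 0 ≤ γ → |a| ≤ R → |max a 0 ^ γ| ≤ R ^ γ := fun a γ hγ ha => by
      rw [abs_of_nonneg (Real.rpow_nonneg (le_max_right _ _) _)]
      exact Real.rpow_le_rpow (le_max_right _ _) (max_le ((le_abs_self a).trans ha) hR0) hγ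
    have hid : critF α β x - critF α β y
        = (max x.1 0 ^ α - max y.1 0 ^ α) * max x.2 0 ^ β
          + max y.1 0 ^ α * (max x.2 0 ^ β - max y.2 0 ^ β) := by
      simp only [critF]; ring
    rw [hid]
    have p1 : R ^ (α - 1) * R ^ β = R ^ (α + β - 1) := by
      rw [← Real.rpow_add_of_nonneg hR0 (by linarith) (by linarith)]; ring_nf
    have p2 : R ^ α * R ^ (β - 1) = R ^ (α + β - 1) := by
      rw [← Real.rpow_add_of_nonneg hR0 (by linarith) (by linarith)]; ring_nf
    calc _ ≤ |(max x.1 0 ^ α - max y.1 0 ^ α) * max x.2 0 ^ β|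
          + |max y.1 0 ^ α * (max x.2 0 ^ β - max y.2 0 ^ β)| := abs_add_le _ _
      _ ≤ (α * R ^ (α - 1) * ‖x - y‖) * R ^ β + R ^ α * (β * R ^ (β - 1) * ‖x - y‖) := by
        rw [abs_mul, abs_mul]
        gcongr
        · exact e1.trans (by gcongr)
        · exact m1 _ _ (by linarith) b2
        · exact m1 _ _ (by linarith) b3
        · exact e2.trans (by gcongr)
      _ = α * (R ^ (α - 1) * R ^ β) * ‖x - y‖ + β * (R ^ α * R ^ (β - 1)) * ‖x - y‖ := by ring
      _ = _ := by rw [p1, p2]; ring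

theorem hasDerivAt_max_zero_rpow {α : ℝ} (hα : 1 < α) (t : ℝ) :
    HasDerivAt (fun t : ℝ => max t 0 ^ α) (α * max t 0 ^ (α - 1)) t := by
  rcases lt_trichotomy t 0 with h | rfl | h
  · rw [max_eq_right h.le, Real.zero_rpow (by linarith), mul_zero]
    refine (hasDerivAt_const t (0:ℝ)).congr_of_eventuallyEq ?_
    filter_upwards [Iio_mem_nhds h] with x hx
    rw [max_eq_right (le_of_lt hx), Real.zero_rpow (by linarith)]
  · rw [max_self, Real.zero_rpow (by linarith), mul_zero, ← hasDerivWithinAt_univ,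
      ← Iic_union_Ici (a := (0:ℝ))]
    refine HasDerivWithinAt.union ?_ ?_
    · refine (hasDerivWithinAt_const (0:ℝ) (Iic 0) (0:ℝ)).congr (fun x hx => ?_) ?_
      · rw [max_eq_right hx, Real.zero_rpow (by linarith)]
      · rw [max_self, Real.zero_rpow (by linarith)]
    · have := (Real.hasDerivAt_rpow_const (x := (0:ℝ)) (Or.inr hα.le)).hasDerivWithinAt (s := Ici 0)
      rw [Real.zero_rpow (by linarith), mul_zero] at this
      refine this.congr (fun x hx => ?_) ?_
      · rw [max_eq_left hx]
      · rw [max_self]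
  · rw [max_eq_left h.le]
    refine (Real.hasDerivAt_rpow_const (Or.inr hα.le)).congr_of_eventuallyEq ?_
    filter_upwards [Ioi_mem_nhds h] with x hx
    rw [max_eq_left (le_of_lt hx)]

/-- The derivative of the critical coupling, for exponents greater than one. -/
noncomputable def critF' (α β : ℝ) (x : ℝ × ℝ) : ℝ × ℝ →L[ℝ] ℝ :=
  (max x.1 0 ^ α) • ((β * max x.2 0 ^ (β - 1)) • ContinuousLinearMap.snd ℝ ℝ ℝ)
    + (max x.2 0 ^ β) • ((α * max x.1 0 ^ (α - 1)) • ContinuousLinearMap.fst ℝ ℝ ℝ)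

theorem critF_hasPowerGrowthDeriv {α β : ℝ} (hα : 1 < α) (hβ : 1 < β) :
    HasPowerGrowthDeriv (α + β) (critF α β) (critF' α β) where
  deriv x := by
    have h1 := (hasDerivAt_max_zero_rpow hα x.1).comp_hasFDerivAt x
      (hasFDerivAt_fst (𝕜 := ℝ) (E := ℝ) (F := ℝ) (p := x))
    have h2 := (hasDerivAt_max_zero_rpow hβ x.2).comp_hasFDerivAt x
      (hasFDerivAt_snd (𝕜 := ℝ) (E := ℝ) (F := ℝ) (p := x))
    exact h1.mul h2
  cont := by
    have h : ∀ γ : ℝ, 0 ≤ γ → Continuous fun t : ℝ => max t 0 ^ γ := fun γ hγ =>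
      (continuous_id.max continuous_const).rpow_const fun _ => Or.inr hγ
    have a1 := (h α (by linarith)).comp (continuous_fst (X := ℝ) (Y := ℝ))
    have a2 := (h (α - 1) (by linarith)).comp (continuous_fst (X := ℝ) (Y := ℝ))
    have a3 := (h β (by linarith)).comp (continuous_snd (X := ℝ) (Y := ℝ))
    have a4 := (h (β - 1) (by linarith)).comp (continuous_snd (X := ℝ) (Y := ℝ))
    exact (a1.smul ((continuous_const.mul a4).smul continuous_const)).add
      (a3.smul ((continuous_const.mul a2).smul continuous_const))
  bound := by
    refine ⟨α + β, by linarith, fun x => ?_⟩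
    set R := ‖x‖ with hR
    have hR0 : 0 ≤ R := norm_nonneg x
    have m1 : ∀ a γ : ℝ, 0 ≤ γ → |a| ≤ R → max a 0 ^ γ ≤ R ^ γ := fun a γ hγ ha =>
      Real.rpow_le_rpow (le_max_right _ _) (max_le ((le_abs_self a).trans ha) hR0) hγ
    have b1 : |x.1| ≤ R := norm_fst_le x
    have b2 : |x.2| ≤ R := norm_snd_le x
    have n0 : ∀ a γ : ℝ, 0 ≤ max a 0 ^ γ := fun a γ => Real.rpow_nonneg (le_max_right _ _) _
    have p1 : R ^ β * R ^ (α - 1) = R ^ (α + β - 1) := by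
      rw [← Real.rpow_add_of_nonneg hR0 (by linarith) (by linarith)]; ring_nf
    have p2 : R ^ α * R ^ (β - 1) = R ^ (α + β - 1) := by
      rw [← Real.rpow_add_of_nonneg hR0 (by linarith) (by linarith)]; ring_nf
    calc ‖critF' α β x‖ ≤ R ^ α * (β * R ^ (β - 1) * 1) + R ^ β * (α * R ^ (α - 1) * 1) := by
          refine (norm_add_le _ _).trans ?_
          rw [norm_smul, norm_smul, norm_smul, norm_smul, Real.norm_of_nonneg (n0 _ _),
            Real.norm_of_nonneg (n0 _ _), Real.norm_of_nonneg (mul_nonneg (by linarith) (n0 _ _)),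
            Real.norm_of_nonneg (mul_nonneg (by linarith) (n0 _ _))]
          have c1 := m1 _ α (by linarith) b1
          have c2 := m1 _ (β - 1) (by linarith) b2
          have c3 := m1 _ β (by linarith) b2
          have c4 := m1 _ (α - 1) (by linarith) b1
          have := n0 x.1 α
          have := n0 x.2 β
          have := n0 x.1 (α - 1)
          have := n0 x.2 (β - 1)
          have := ContinuousLinearMap.norm_fst_le ℝ ℝ ℝ
          have := ContinuousLinearMap.norm_snd_le ℝ ℝ ℝ
          gcongr
      _ = β * (R ^ α * R ^ (β - 1)) + α * (R ^ β * R ^ (α - 1)) := by ring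
      _ = _ := by rw [p1, p2]; ring

section Subcritical

variable {Q : ℝ × ℝ → ℝ}

theorem uniqueDiffOn_quadrant : UniqueDiffOn ℝ quadrant :=
  (uniqueDiffOn_Ici 0).prod (uniqueDiffOn_Ici 0)

theorem hasDerivWithinAt_dU (hd : DifferentiableOn ℝ Q quadrant) {a b : ℝ} (ha : 0 ≤ a)
    (hb : 0 ≤ b) : HasDerivWithinAt (fun t => Q (t, b)) (dU Q a b) (Ici 0) a ∧
      dU Q a b = fderivWithin ℝ Q quadrant (a, b) (1, 0) := by
  have h := (hd (a, b) ⟨ha, hb⟩).hasFDerivWithinAt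
  have hc : HasDerivWithinAt (fun t : ℝ => (t, b)) (1, 0) (Ici 0) a :=
    ((hasDerivAt_id a).prodMk (hasDerivAt_const a b)).hasDerivWithinAt
  have h2 : HasDerivWithinAt (fun t => Q (t, b)) _ (Ici 0) a :=
    HasFDerivWithinAt.comp_hasDerivWithinAt (l := Q) a h hc fun t ht => ⟨ht, hb⟩
  have h3 : dU Q a b = _ := h2.derivWithin (uniqueDiffOn_Ici 0 a ha)
  exact ⟨h3 ▸ h2, h3⟩

theorem hasDerivWithinAt_dV (hd : DifferentiableOn ℝ Q quadrant) {a b : ℝ} (ha : 0 ≤ a)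
    (hb : 0 ≤ b) : HasDerivWithinAt (fun t => Q (a, t)) (dV Q a b) (Ici 0) b ∧
      dV Q a b = fderivWithin ℝ Q quadrant (a, b) (0, 1) := by
  have h := (hd (a, b) ⟨ha, hb⟩).hasFDerivWithinAt
  have hc : HasDerivWithinAt (fun t : ℝ => (a, t)) (0, 1) (Ici 0) b :=
    ((hasDerivAt_const b a).prodMk (hasDerivAt_id b)).hasDerivWithinAt
  have h2 : HasDerivWithinAt (fun t => Q (a, t)) _ (Ici 0) b :=
    HasFDerivWithinAt.comp_hasDerivWithinAt (l := Q) b h hc fun t ht => ⟨ha, ht⟩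
  have h3 : dV Q a b = _ := h2.derivWithin (uniqueDiffOn_Ici 0 b hb)
  exact ⟨h3 ▸ h2, h3⟩

/-- By homogeneity, the normalization at `(1, 0)` makes `Q` and its gradient vanish on the whole
half-axis. -/
theorem vanish_on_axis {q : ℝ} (hq : 0 < q) (hd : DifferentiableOn ℝ Q quadrant)
    (hom : ∀ t a b : ℝ, 0 < t → 0 ≤ a → 0 ≤ b → Q (t * a, t * b) = t ^ q * Q (a, b))
    (h1 : dU Q 1 0 = 0) (h2 : dV Q 1 0 = 0) {a : ℝ} (ha : 0 < a) :
    Q (a, 0) = 0 ∧ dU Q a 0 = 0 ∧ dV Q a 0 = 0 := by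
  have hQ : ∀ t : ℝ, 0 < t → Q (t, 0) = t ^ q * Q (1, 0) := fun t ht => by
    simpa using hom t 1 0 ht zero_le_one le_rfl
  have hd1 : HasDerivAt (fun t => Q (t, 0)) 0 1 := by
    have := (hasDerivWithinAt_dU hd zero_le_one le_rfl).1
    rw [h1] at this
    exact this.hasDerivAt (Ici_mem_nhds zero_lt_one)
  have hd2 : HasDerivAt (fun t => Q (t, 0)) (q * 1 ^ (q - 1) * Q (1, 0)) 1 := by
    refine ((Real.hasDerivAt_rpow_const (Or.inl one_ne_zero)).mul_const _).congr_of_eventuallyEq ?_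
    filter_upwards [Ioi_mem_nhds zero_lt_one] with t ht using hQ t ht
  have h10 : Q (1, 0) = 0 := by
    have := hd1.unique hd2
    rw [Real.one_rpow, mul_one] at this
    exact (mul_eq_zero.1 this.symm).resolve_left hq.ne'
  have hQ0 : ∀ t : ℝ, 0 < t → Q (t, 0) = 0 := fun t ht => by rw [hQ t ht, h10, mul_zero]
  refine ⟨hQ0 a ha, ?_, ?_⟩
  · have h3 : HasDerivAt (fun t => Q (t, 0)) 0 a := by
      refine (hasDerivAt_const a (0:ℝ)).congr_of_eventuallyEq ?_
      filter_upwards [Ioi_mem_nhds ha] with t ht using hQ0 t ht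
    exact h3.hasDerivWithinAt.derivWithin (uniqueDiffOn_Ici 0 a ha.le)
  · have h3 := (hasDerivWithinAt_dV hd zero_le_one le_rfl).1
    rw [h2] at h3
    have h4 : HasDerivWithinAt (fun t : ℝ => a⁻¹ * t) (a⁻¹ * 1) (Ici 0) 0 :=
      ((hasDerivAt_id (0:ℝ)).const_mul a⁻¹).hasDerivWithinAt
    have h5 : HasDerivWithinAt (fun t => a ^ q * Q (1, a⁻¹ * t)) (a ^ q * (0 * (a⁻¹ * 1)))
        (Ici 0) 0 := by
      refine (HasDerivWithinAt.comp (h₂ := fun t => Q (1, t)) (h := fun t => a⁻¹ * t)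
        (s' := Ici 0) (0:ℝ) ?_ h4 fun t ht => ?_).const_mul _
      · simpa using h3
      · exact mul_nonneg (inv_nonneg.2 ha.le) ht
    have h6 : HasDerivWithinAt (fun t => Q (a, t)) 0 (Ici 0) 0 := by
      have h7 : ∀ t ∈ Ici (0:ℝ), Q (a, t) = a ^ q * Q (1, a⁻¹ * t) := fun t ht => by
        rw [← hom a 1 _ ha zero_le_one (mul_nonneg (inv_nonneg.2 ha.le) ht), mul_one,
          mul_inv_cancel_left₀ ha.ne']
      rw [zero_mul, mul_zero] at h5
      exact h5.congr h7 (h7 0 self_mem_Ici)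
    exact h6.derivWithin (uniqueDiffOn_Ici 0 0 self_mem_Ici)

variable {N : ℕ} {s q : ℝ}

theorem IsAdmissible.boundary (hQ : IsAdmissible N s q Q) {x : ℝ × ℝ} (hx : x ∈ quadrant)
    (h0 : x.1 ≤ 0 ∨ x.2 ≤ 0) : Q x = 0 ∧ dU Q x.1 x.2 = 0 ∧ dV Q x.1 x.2 = 0 := by
  have hq : 0 < q := by linarith [hQ.two_lt]
  have hd : DifferentiableOn ℝ Q quadrant := hQ.contDiff_one.differentiableOn one_ne_zero
  obtain ⟨a, b⟩ := x
  obtain ⟨ha : 0 ≤ a, hb : 0 ≤ b⟩ := hx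
  rcases ha.eq_or_lt with rfl | ha'
  · rcases hb.eq_or_lt with rfl | hb'
    · obtain ⟨C, hC, hg⟩ := hQ.growth
      have := hg 0 0 le_rfl le_rfl
      rw [Real.zero_rpow (by linarith [hQ.two_lt]), add_zero, mul_zero] at this
      have n1 := abs_nonneg (dU Q 0 0)
      have n2 := abs_nonneg (dV Q 0 0)
      refine ⟨?_, abs_eq_zero.1 (by linarith), abs_eq_zero.1 (by linarith)⟩
      have h2 := hQ.homogeneous 2 0 0 two_pos le_rfl le_rfl
      rw [mul_zero] at h2
      have h3 : (1:ℝ) < 2 ^ q := Real.one_lt_rpow one_lt_two hq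
      have h4 : (2 ^ q - 1) * Q (0, 0) = 0 := by linarith
      exact (mul_eq_zero.1 h4).resolve_left (by linarith)
    · have hsw : DifferentiableOn ℝ (Q ∘ Prod.swap) quadrant :=
        hd.comp (differentiable_snd.prodMk differentiable_fst).differentiableOn
          fun x hx => ⟨hx.2, hx.1⟩
      obtain ⟨e1, e2, e3⟩ := vanish_on_axis (Q := Q ∘ Prod.swap) hq hsw
        (fun t a b ht ha hb => hQ.homogeneous t b a ht hb ha) hQ.dV_zero_one hQ.dU_zero_one hb'
      exact ⟨e1, e3, e2⟩
  · have hb0 : b = 0 := le_antisymm (h0.resolve_left (not_le.2 ha')) hb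
    subst hb0
    exact vanish_on_axis hq hd hQ.homogeneous hQ.dU_one_zero hQ.dV_one_zero ha'

theorem fderivWithin_quadrant_apply (hd : DifferentiableOn ℝ Q quadrant) {x : ℝ × ℝ}
    (hx : x ∈ quadrant) (y : ℝ × ℝ) :
    fderivWithin ℝ Q quadrant x y = dU Q x.1 x.2 * y.1 + dV Q x.1 x.2 * y.2 := by
  have hy : y = y.1 • ((1 : ℝ), (0 : ℝ)) + y.2 • ((0 : ℝ), (1 : ℝ)) := by
    ext <;> simp
  conv_lhs => rw [hy]
  rw [map_add, map_smul, map_smul, (hasDerivWithinAt_dU hd hx.1 hx.2).2,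
    (hasDerivWithinAt_dV hd hx.1 hx.2).2]
  simp only [smul_eq_mul]
  ring

theorem IsAdmissible.fderivWithin_boundary (hQ : IsAdmissible N s q Q) {x : ℝ × ℝ}
    (hx : x ∈ quadrant) (h0 : x.1 ≤ 0 ∨ x.2 ≤ 0) : fderivWithin ℝ Q quadrant x = 0 := by
  have hd : DifferentiableOn ℝ Q quadrant := hQ.contDiff_one.differentiableOn one_ne_zero
  obtain ⟨-, h1, h2⟩ := hQ.boundary hx h0
  refine ContinuousLinearMap.ext fun y => ?_
  rw [fderivWithin_quadrant_apply hd hx, h1, h2]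
  simp

/-- The derivative of the extension of `Q` by zero. -/
noncomputable def extQ' (Q : ℝ × ℝ → ℝ) (x : ℝ × ℝ) : ℝ × ℝ →L[ℝ] ℝ :=
  open Classical in if x.1 ≤ 0 ∨ x.2 ≤ 0 then 0 else fderivWithin ℝ Q quadrant x

theorem isClosed_quadrant : IsClosed quadrant := isClosed_Ici.prod isClosed_Ici

theorem isClosed_nonpos_or : IsClosed {x : ℝ × ℝ | x.1 ≤ 0 ∨ x.2 ≤ 0} :=
  (isClosed_le continuous_fst continuous_const).union
    (isClosed_le continuous_snd continuous_const)

theorem quadrant_union_nonpos : quadrant ∪ {x : ℝ × ℝ | x.1 ≤ 0 ∨ x.2 ≤ 0} = univ := by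
  refine eq_univ_of_forall fun x => ?_
  by_cases h : x.1 ≤ 0 ∨ x.2 ≤ 0
  · exact Or.inr h
  · push Not at h
    exact Or.inl ⟨h.1.le, h.2.le⟩

theorem IsAdmissible.extQ_eq (hQ : IsAdmissible N s q Q) {x : ℝ × ℝ} (hx : x ∈ quadrant) :
    extQ Q x.1 x.2 = Q x := by
  unfold extQ
  split_ifs with h
  · exact (hQ.boundary hx h).1.symm
  · rfl

theorem IsAdmissible.extQ'_eq (hQ : IsAdmissible N s q Q) {x : ℝ × ℝ} (hx : x ∈ quadrant) :
    extQ' Q x = fderivWithin ℝ Q quadrant x := by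
  unfold extQ'
  split_ifs with h
  · exact (hQ.fderivWithin_boundary hx h).symm
  · rfl

/-- The boundary conditions on `Q` make its extension by zero continuously differentiable. -/
theorem IsAdmissible.hasPowerGrowthDeriv (hQ : IsAdmissible N s q Q) :
    HasPowerGrowthDeriv q (fun x : ℝ × ℝ => extQ Q x.1 x.2) (extQ' Q) where
  deriv x := by
    have hd : DifferentiableOn ℝ Q quadrant := hQ.contDiff_one.differentiableOn one_ne_zero
    by_cases hx : x ∈ quadrant
    · have h1 : HasFDerivWithinAt (fun x : ℝ × ℝ => extQ Q x.1 x.2) (extQ' Q x) quadrant x := by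
        rw [hQ.extQ'_eq hx]
        exact (hd x hx).hasFDerivWithinAt.congr (fun y hy => hQ.extQ_eq hy) (hQ.extQ_eq hx)
      by_cases h0 : x.1 ≤ 0 ∨ x.2 ≤ 0
      · have h2 : HasFDerivWithinAt (fun x : ℝ × ℝ => extQ Q x.1 x.2) (extQ' Q x)
            {x : ℝ × ℝ | x.1 ≤ 0 ∨ x.2 ≤ 0} x := by
          have e : extQ' Q x = 0 := if_pos h0
          rw [e]
          exact (hasFDerivWithinAt_const (0:ℝ) x _).congr (fun y hy => if_pos hy) (if_pos h0)
        have h3 := h1.union h2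
        rwa [quadrant_union_nonpos, hasFDerivWithinAt_univ] at h3
      · push Not at h0
        exact h1.hasFDerivAt (prod_mem_nhds (Ici_mem_nhds h0.1) (Ici_mem_nhds h0.2))
    · have h0 : x.1 ≤ 0 ∨ x.2 ≤ 0 := by
        have : x ∈ quadrant ∪ {x : ℝ × ℝ | x.1 ≤ 0 ∨ x.2 ≤ 0} := by
          rw [quadrant_union_nonpos]; trivial
        exact this.resolve_left hx
      have e : extQ' Q x = 0 := if_pos h0
      rw [e]
      refine (hasFDerivAt_const (0:ℝ) x).congr_of_eventuallyEq ?_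
      filter_upwards [isClosed_quadrant.isOpen_compl.mem_nhds hx] with y hy
      have : y ∈ quadrant ∪ {x : ℝ × ℝ | x.1 ≤ 0 ∨ x.2 ≤ 0} := by
        rw [quadrant_union_nonpos]; trivial
      exact if_pos (this.resolve_left hy)
  cont := by
    have h1 : ContinuousOn (extQ' Q) quadrant :=
      (hQ.contDiff_one.continuousOn_fderivWithin uniqueDiffOn_quadrant le_rfl).congr
        fun x hx => hQ.extQ'_eq hx
    have h2 : ContinuousOn (extQ' Q) {x : ℝ × ℝ | x.1 ≤ 0 ∨ x.2 ≤ 0} :=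
      (continuousOn_const (c := 0)).congr fun x hx => if_pos hx
    rw [← continuousOn_univ, ← quadrant_union_nonpos]
    exact h1.union_of_isClosed h2 isClosed_quadrant isClosed_nonpos_or
  bound := by
    have hd : DifferentiableOn ℝ Q quadrant := hQ.contDiff_one.differentiableOn one_ne_zero
    have hq := hQ.two_lt
    obtain ⟨C, hC, hg⟩ := hQ.growth
    refine ⟨2 * C, by positivity, fun x => ?_⟩
    by_cases hx : x ∈ quadrant
    · rw [hQ.extQ'_eq hx]
      refine ContinuousLinearMap.opNorm_le_bound _ (by positivity) fun y => ?_
      rw [fderivWithin_quadrant_apply hd hx]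
      have g := hg x.1 x.2 hx.1 hx.2
      have hx1 : 0 ≤ x.1 := hx.1
      have hx2 : 0 ≤ x.2 := hx.2
      have l1 : x.1 ≤ ‖x‖ := (le_abs_self _).trans (norm_fst_le x)
      have l2 : x.2 ≤ ‖x‖ := (le_abs_self _).trans (norm_snd_le x)
      have g1 : x.1 ^ (q - 1) ≤ ‖x‖ ^ (q - 1) := by gcongr; linarith
      have g2 : x.2 ^ (q - 1) ≤ ‖x‖ ^ (q - 1) := by gcongr; linarith
      have y1 : |y.1| ≤ ‖y‖ := norm_fst_le y
      have y2 : |y.2| ≤ ‖y‖ := norm_snd_le y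
      calc ‖dU Q x.1 x.2 * y.1 + dV Q x.1 x.2 * y.2‖
          ≤ |dU Q x.1 x.2| * |y.1| + |dV Q x.1 x.2| * |y.2| := by
            refine (norm_add_le _ _).trans (le_of_eq ?_)
            rw [norm_mul, norm_mul]; rfl
        _ ≤ |dU Q x.1 x.2| * ‖y‖ + |dV Q x.1 x.2| * ‖y‖ := by gcongr
        _ = (|dU Q x.1 x.2| + |dV Q x.1 x.2|) * ‖y‖ := by ring
        _ ≤ (C * (‖x‖ ^ (q - 1) + ‖x‖ ^ (q - 1))) * ‖y‖ := by
            refine mul_le_mul_of_nonneg_right (g.trans ?_) (norm_nonneg y)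
            gcongr
        _ = _ := by ring
    · have : x ∈ quadrant ∪ {x : ℝ × ℝ | x.1 ≤ 0 ∨ x.2 ≤ 0} := by
        rw [quadrant_union_nonpos]; trivial
      have e : extQ' Q x = 0 := if_pos (this.resolve_left hx)
      rw [e, norm_zero]
      positivity

theorem IsAdmissible.extQ_hom (hQ : IsAdmissible N s q Q) (t : ℝ) (ht : 0 < t) (x : ℝ × ℝ) :
    extQ Q (t • x).1 (t • x).2 = t ^ q * extQ Q x.1 x.2 := by
  simp only [extQ, Prod.smul_fst, Prod.smul_snd, smul_eq_mul]
  have h : ∀ a : ℝ, t * a ≤ 0 ↔ a ≤ 0 := fun a => by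
    rw [← not_lt, ← not_lt, mul_pos_iff_of_pos_left ht]
  by_cases h0 : x.1 ≤ 0 ∨ x.2 ≤ 0
  · rw [if_pos h0, mul_zero, if_pos (by rwa [← h x.1, ← h x.2] at h0)]
  · rw [if_neg h0, if_neg (by rwa [← h x.1, ← h x.2] at h0)]
    push Not at h0
    exact hQ.homogeneous t x.1 x.2 ht h0.1.le h0.2.le

theorem IsAdmissible.homLip (hQ : IsAdmissible N s q Q) :
    HomLip q (fun x : ℝ × ℝ => extQ Q x.1 x.2) :=
  hQ.hasPowerGrowthDeriv.homLip (by linarith [hQ.two_lt]) hQ.extQ_hom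

/-- Since `Q_u` vanishes on the axis `v = 0` and increases in `v`, it is nonnegative; since `Q`
vanishes on the axis `u = 0`, so is `Q`. -/
theorem IsAdmissible.extQ_nonneg (hQ : IsAdmissible N s q Q) (a b : ℝ) : 0 ≤ extQ Q a b := by
  have hd : DifferentiableOn ℝ Q quadrant := hQ.contDiff_one.differentiableOn one_ne_zero
  unfold extQ
  split_ifs with h0
  · exact le_rfl
  push Not at h0
  obtain ⟨ha, hb⟩ := h0
  have hU : ∀ c : ℝ, 0 < c → 0 ≤ dU Q c b := by
    intro c hc
    have hcont : ContinuousOn (fun t => dU Q c t) (Ici 0) := by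
      have h1 := hQ.contDiff_one.continuousOn_fderivWithin uniqueDiffOn_quadrant le_rfl
      have h2 : ContinuousOn (fun t : ℝ => (c, t)) (Ici 0) := by fun_prop
      have h3 : ContinuousOn (fun t : ℝ => fderivWithin ℝ Q quadrant (c, t)) (Ici 0) :=
        h1.comp h2 fun t ht => ⟨hc.le, ht⟩
      exact (h3.clm_apply continuousOn_const).congr fun t ht => (hasDerivWithinAt_dU hd hc.le ht).2
    have hmono : MonotoneOn (fun t => dU Q c t) (Ici 0) := by
      refine monotoneOn_of_deriv_nonneg (convex_Ici 0) hcont (fun t ht => ?_) fun t ht => ?_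
      · rw [interior_Ici] at ht
        exact (differentiableAt_of_deriv_ne_zero
          (hQ.mixed_pos c t hc ht).ne').differentiableWithinAt
      · rw [interior_Ici] at ht
        exact (hQ.mixed_pos c t hc ht).le
    have h4 := hmono self_mem_Ici (show (0:ℝ) ≤ b from hb.le) hb.le
    have h5 : dU Q c 0 = 0 := (hQ.boundary (x := (c, 0)) ⟨hc.le, self_mem_Ici⟩ (Or.inr le_rfl)).2.1
    simp only [h5] at h4
    exact h4
  have hmono : MonotoneOn (fun t => Q (t, b)) (Ici 0) := by
    have hdv := fun (t : ℝ) (ht : 0 ≤ t) => (hasDerivWithinAt_dU hd ht hb.le).1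
    refine monotoneOn_of_deriv_nonneg (convex_Ici 0) (fun t ht => (hdv t ht).continuousWithinAt)
      (fun t ht => ?_) fun t ht => ?_
    · rw [interior_Ici] at ht ⊢
      exact ((hdv t (le_of_lt ht)).mono Ioi_subset_Ici_self).differentiableWithinAt
    · rw [interior_Ici] at ht
      rw [((hdv t (le_of_lt ht)).hasDerivAt (Ici_mem_nhds ht)).deriv]
      exact hU t ht
  have h4 := hmono self_mem_Ici (show (0:ℝ) ≤ a from ha.le) ha.le
  have h5 : Q (0, b) = 0 := (hQ.boundary (x := (0, b)) ⟨self_mem_Ici, hb.le⟩ (Or.inl le_rfl)).1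
  simp only [h5] at h4
  exact h4

end Subcritical

/-! ### The fractional Sobolev inequality -/

theorem eLpNorm_two_sq {Ω F : Type*} [MeasurableSpace Ω] [NormedAddCommGroup F] (μ : Measure Ω)
    (f : Ω → F) : eLpNorm f 2 μ ^ 2 = ∫⁻ x, ‖f x‖ₑ ^ 2 ∂μ := by
  have h := eLpNorm_nnreal_pow_eq_lintegral (μ := μ) (f := f) (p := 2) two_ne_zero
  simpa using h

/-- The density `x ↦ ∫ |u(x) - u(y)|² / |x - y|^(N + 2s) dy` of the Gagliardo energy. -/
noncomputable def gagDensity (N : ℕ) (s : ℝ) (u : RN N → ℝ) (x : RN N) : ENNReal :=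
  ∫⁻ y, ‖gagQuot N s u (x, y)‖ₑ ^ 2

section Gagliardo

variable {N : ℕ} {s : ℝ} {u : RN N → ℝ}

theorem aestronglyMeasurable_gagQuot (hu : AEStronglyMeasurable u volume) :
    AEStronglyMeasurable (gagQuot N s u) (volume : Measure (RN N × RN N)) := by
  have h1 : AEStronglyMeasurable (fun p : RN N × RN N => u p.1) volume :=
    hu.comp_quasiMeasurePreserving Measure.quasiMeasurePreserving_fst
  have h2 : AEStronglyMeasurable (fun p : RN N × RN N => u p.2) volume :=
    hu.comp_quasiMeasurePreserving Measure.quasiMeasurePreserving_snd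
  have h3 : Measurable fun p : RN N × RN N => ‖p.1 - p.2‖ ^ (((N : ℝ) + 2 * s) / 2) := by
    fun_prop
  exact ((h1.sub h2).aemeasurable.div h3.aemeasurable).aestronglyMeasurable

theorem aemeasurable_gagDensity (hu : AEStronglyMeasurable u volume) :
    AEMeasurable (gagDensity N s u) volume :=
  AEMeasurable.lintegral_prod_right'
    (f := fun p : RN N × RN N => ‖gagQuot N s u p‖ₑ ^ 2)
    ((aestronglyMeasurable_gagQuot hu).enorm.pow_const 2)

theorem lintegral_gagDensity (hu : AEStronglyMeasurable u volume) :
    ∫⁻ x, gagDensity N s u x = eLpNorm (gagQuot N s u) 2 volume ^ 2 := by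
  rw [eLpNorm_two_sq]
  exact (lintegral_prod _ ((aestronglyMeasurable_gagQuot hu).enorm.pow_const 2)).symm

theorem ae_gagDensity_ne_top (hu : MemHs N s u) : ∀ᵐ x, gagDensity N s u x ≠ ⊤ := by
  have h := ae_lt_top' (aemeasurable_gagDensity (s := s) hu.1.1) (by
    rw [lintegral_gagDensity hu.1.1]
    exact ENNReal.pow_ne_top hu.2.2.ne)
  filter_upwards [h] with x hx using hx.ne

theorem integrable_gagDensity (hu : MemHs N s u) :
    Integrable (fun x => (gagDensity N s u x).toReal) volume :=
  integrable_toReal_of_lintegral_ne_top (aemeasurable_gagDensity hu.1.1) (by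
    rw [lintegral_gagDensity hu.1.1]
    exact ENNReal.pow_ne_top hu.2.2.ne)

theorem integral_gagDensity (hu : MemHs N s u) :
    ∫ x, (gagDensity N s u x).toReal = (eLpNorm (gagQuot N s u) 2 volume).toReal ^ 2 := by
  rw [integral_toReal (aemeasurable_gagDensity hu.1.1)
    ((ae_gagDensity_ne_top hu).mono fun x hx => hx.lt_top), lintegral_gagDensity hu.1.1,
    ENNReal.toReal_pow]

/-- The volume of the unit ball. -/
noncomputable def unitVol (N : ℕ) : ℝ := (volume (Metric.ball (0 : RN N) 1)).toReal

theorem unitVol_pos (N : ℕ) : 0 < unitVol N :=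
  ENNReal.toReal_pos (Metric.measure_ball_pos volume _ one_pos).ne' measure_ball_lt_top.ne

theorem volume_ball_eq (x : RN N) {r : ℝ} (hr : 0 < r) :
    volume (Metric.ball x r) = ENNReal.ofReal (unitVol N * r ^ N) := by
  rw [Measure.addHaar_ball_of_pos volume x hr, finrank_euclideanSpace_fin, mul_comm (unitVol N),
    ENNReal.ofReal_mul (by positivity), unitVol, ENNReal.ofReal_toReal measure_ball_lt_top.ne]

/-- A function is controlled at almost every point by its average on a ball and by the density of
its Gagliardo energy. -/
theorem sq_le_density_add_average (hs : 0 < s) (hu : AEStronglyMeasurable u volume) (x : RN N)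
    {r : ℝ} (hr : 0 < r) (hB : IntegrableOn u (Metric.ball x r) volume)
    (hD : gagDensity N s u x ≠ ⊤) :
    u x ^ 2 ≤ 2 * (r ^ (2 * s) / unitVol N * (gagDensity N s u x).toReal
      + ((∫ y in Metric.ball x r, u y) / (unitVol N * r ^ N)) ^ 2) := by
  set B := Metric.ball x r
  set b : ℝ := unitVol N * r ^ N with hb
  have hω := unitVol_pos N
  have hb0 : 0 < b := by positivity
  have hvol : volume B = ENNReal.ofReal b := volume_ball_eq x hr
  have hvr : volume.real B = b := by
    rw [Measure.real, hvol, ENNReal.toReal_ofReal hb0.le]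
  set d := (gagDensity N s u x).toReal
  have hmB : AEStronglyMeasurable u (volume.restrict B) := hu.restrict
  set f : RN N → ℝ := fun y => u x - u y with hf
  have hmf : AEStronglyMeasurable f (volume.restrict B) := aestronglyMeasurable_const.sub hmB
  have hfi : IntegrableOn f B volume :=
    (integrableOn_const (by rw [hvol]; exact ENNReal.ofReal_ne_top)).sub hB
  have h2 : ∫⁻ y in B, ‖f y‖ₑ ^ 2 ≤ ENNReal.ofReal (r ^ ((N : ℝ) + 2 * s)) * gagDensity N s u x := by
    rw [gagDensity, ← lintegral_const_mul' _ _ ENNReal.ofReal_ne_top]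
    refine (setLIntegral_mono_ae' measurableSet_ball (Eventually.of_forall fun y hy => ?_)).trans
      (setLIntegral_le_lintegral B _)
    rcases eq_or_ne x y with rfl | hxy
    · simp [hf]
    have hn : 0 < ‖x - y‖ := norm_pos_iff.2 (sub_ne_zero.2 hxy)
    have hlt : ‖x - y‖ ≤ r := by
      have := Metric.mem_ball'.1 hy
      rw [dist_eq_norm] at this
      exact this.le
    rw [← ofReal_norm, ← ofReal_norm, ← ENNReal.ofReal_pow (norm_nonneg _),
      ← ENNReal.ofReal_pow (norm_nonneg _), ← ENNReal.ofReal_mul (by positivity)]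
    refine ENNReal.ofReal_le_ofReal ?_
    have e : (‖x - y‖ ^ (((N : ℝ) + 2 * s) / 2)) ^ 2 = ‖x - y‖ ^ ((N : ℝ) + 2 * s) := by
      rw [← Real.rpow_mul_natCast (norm_nonneg _)]
      congr 1
      push_cast
      ring
    simp only [gagQuot, hf, Real.norm_eq_abs, sq_abs, div_pow, e]
    rw [mul_div_assoc', le_div_iff₀ (by positivity), mul_comm]
    gcongr
  have h1 : (∫⁻ y in B, ‖f y‖ₑ) ^ 2
      ≤ ENNReal.ofReal (r ^ ((N : ℝ) + 2 * s)) * gagDensity N s u x * ENNReal.ofReal b := by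
    have := eLpNorm_le_eLpNorm_mul_rpow_measure_univ (p := 1) (q := 2) one_le_two hmf
    rw [eLpNorm_one_eq_lintegral_enorm, Measure.restrict_apply_univ, hvol] at this
    calc _ ≤ (eLpNorm f 2 (volume.restrict B)
          * ENNReal.ofReal b ^ (1 / (1:ENNReal).toReal - 1 / (2:ENNReal).toReal)) ^ 2 := by gcongr
      _ = (∫⁻ y in B, ‖f y‖ₑ ^ 2) * ENNReal.ofReal b := by
        rw [mul_pow, eLpNorm_two_sq, ← ENNReal.rpow_mul_natCast]
        norm_num
      _ ≤ _ := by gcongr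
  have hI : (∫ y in B, ‖f y‖) ^ 2 ≤ r ^ ((N : ℝ) + 2 * s) * d * b := by
    rw [integral_norm_eq_lintegral_enorm hmf, ← ENNReal.toReal_pow]
    refine (ENNReal.toReal_mono ?_ h1).trans (le_of_eq ?_)
    · exact ENNReal.mul_ne_top (ENNReal.mul_ne_top ENNReal.ofReal_ne_top hD) ENNReal.ofReal_ne_top
    · rw [ENNReal.toReal_mul, ENNReal.toReal_mul, ENNReal.toReal_ofReal (by positivity),
        ENNReal.toReal_ofReal hb0.le]
  have hsum : b * u x = (∫ y in B, f y) + ∫ y in B, u y := by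
    rw [← integral_add hfi hB]
    simp [hf, hvr]
  have hle : (b * u x) ^ 2 ≤ 2 * (r ^ ((N : ℝ) + 2 * s) * d * b + (∫ y in B, u y) ^ 2) := by
    rw [hsum]
    refine add_sq_le.trans ?_
    gcongr
    refine le_trans ?_ hI
    rw [← sq_abs]
    gcongr
    exact norm_integral_le_integral_norm f
  have hpow : r ^ ((N : ℝ) + 2 * s) = r ^ N * r ^ (2 * s) := by
    rw [Real.rpow_add hr, Real.rpow_natCast]
  have hfin : u x ^ 2 = (b * u x) ^ 2 / b ^ 2 := by field_simp
  rw [hfin, div_le_iff₀ (by positivity)]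
  refine hle.trans (le_of_eq ?_)
  rw [hpow, hb]
  field_simp

end Gagliardo

/-- Hölder's inequality on a set of finite measure. -/
theorem setLIntegral_enorm_le_of_eLpNorm_le {Ω : Type*} [MeasurableSpace Ω] {μ : Measure Ω}
    {u : Ω → ℝ} {p M b : ℝ} {B : Set Ω} (hp : 1 ≤ p) (hM : 0 ≤ M) (hb : 0 < b)
    (hB : μ B = ENNReal.ofReal b) (hu : AEStronglyMeasurable u μ)
    (huM : eLpNorm u (ENNReal.ofReal p) μ ≤ ENNReal.ofReal M) :
    ∫⁻ y in B, ‖u y‖ₑ ∂μ ≤ ENNReal.ofReal (M * b ^ (1 - 1 / p)) := by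
  have := eLpNorm_le_eLpNorm_mul_rpow_measure_univ (p := 1) (q := ENNReal.ofReal p)
    (by rw [← ENNReal.ofReal_one]; exact ENNReal.ofReal_le_ofReal hp) (hu.restrict (s := B))
  rw [eLpNorm_one_eq_lintegral_enorm, Measure.restrict_apply_univ, hB,
    ENNReal.toReal_ofReal (by linarith), ENNReal.toReal_one, div_one,
    ENNReal.ofReal_rpow_of_pos hb] at this
  rw [ENNReal.ofReal_mul hM]
  refine this.trans ?_
  gcongr
  exact (eLpNorm_restrict_le _ _ _ _).trans huM

theorem critExp_gt_two {N : ℕ} {s : ℝ} (hs : 0 < s) (hN : 2 * s < N) : 2 < critExp N s := by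
  rw [critExp, lt_div_iff₀ (by linarith)]; linarith

/-- The pointwise estimate behind the Sobolev inequality: choose the radius of the ball so that the
average accounts for half of `u(x)²`. -/
theorem exists_pointwise_sobolev_const {N : ℕ} {s : ℝ} (hs : 0 < s) (hN : 2 * s < N) :
    ∃ K : ℝ, 0 < K ∧ ∀ (u : RN N → ℝ) (M : ℝ), 0 < M →
      AEStronglyMeasurable u volume →
      eLpNorm u (ENNReal.ofReal (critExp N s)) volume ≤ ENNReal.ofReal M →
      ∀ x, gagDensity N s u x ≠ ⊤ →
        |u x| ^ critExp N s ≤ K * M ^ (critExp N s - 2) * (gagDensity N s u x).toReal := by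
  set p := critExp N s with hp
  have hp2 : 2 < p := critExp_gt_two hs hN
  set ω := unitVol N
  have hω : 0 < ω := unitVol_pos N
  have hNs : 0 < (N:ℝ) - 2 * s := by linarith
  set θ : ℝ := 2 * s / (N - 2 * s) with hθ
  have hpθ : p - 2 = 2 * θ := by
    rw [hp, hθ, critExp]; field_simp; ring
  set κ : ℝ := 4 * ω ^ (-(2 / p)) with hκ
  have hκ0 : 0 < κ := by positivity
  refine ⟨4 / ω * κ ^ θ, by positivity, fun u M hM hu huM x hD => ?_⟩
  set d := (gagDensity N s u x).toReal with hd
  have hd0 : 0 ≤ d := ENNReal.toReal_nonneg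
  rcases eq_or_ne (u x) 0 with h0 | h0
  · rw [h0, abs_zero, Real.zero_rpow (by linarith)]
    positivity
  set t := |u x| with ht
  have ht0 : 0 < t := abs_pos.2 h0
  have hA : 0 < κ * M ^ 2 / t ^ 2 := by positivity
  set r : ℝ := (κ * M ^ 2 / t ^ 2) ^ (((N:ℝ) - 2 * s)⁻¹) with hr
  have hr0 : 0 < r := by positivity
  have hrN : r ^ ((N:ℝ) - 2 * s) = κ * M ^ 2 / t ^ 2 := Real.rpow_inv_rpow hA.le hNs.ne'
  have hrs : r ^ (2 * s) = (κ * M ^ 2 / t ^ 2) ^ θ := by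
    rw [hr, ← Real.rpow_mul hA.le, hθ]; congr 1; field_simp
  set B := Metric.ball x r
  set b : ℝ := ω * r ^ N with hb
  have hb0 : 0 < b := by positivity
  have hvol : volume B = ENNReal.ofReal b := volume_ball_eq x hr0
  have hL : ∫⁻ y in B, ‖u y‖ₑ ≤ ENNReal.ofReal (M * b ^ (1 - 1 / p)) :=
    setLIntegral_enorm_le_of_eLpNorm_le (by linarith) hM.le hb0 hvol hu huM
  have hB : IntegrableOn u B volume := ⟨hu.restrict, hL.trans_lt ENNReal.ofReal_lt_top⟩
  have hmean : |∫ y in B, u y| ≤ M * b ^ (1 - 1 / p) := by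
    refine (norm_integral_le_integral_norm u).trans ?_
    rw [integral_norm_eq_lintegral_enorm hu.restrict]
    exact ENNReal.toReal_le_of_le_ofReal (by positivity) hL
  have hmain := sq_le_density_add_average hs hu x hr0 hB hD
  have hsec : ((∫ y in B, u y) / b) ^ 2 ≤ t ^ 2 / 4 := by
    have e1 : ((∫ y in B, u y) / b) ^ 2 ≤ (M * b ^ (1 - 1 / p) / b) ^ 2 := by
      rw [div_pow, div_pow, ← sq_abs (∫ y in B, u y)]
      gcongr
    have e2 : b ^ (1 - 1 / p) / b = b ^ (-(1 / p)) := by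
      rw [← Real.rpow_sub_one hb0.ne']; congr 1; ring
    have e3 : (b ^ (-(1 / p))) ^ 2 = ω ^ (-(2 / p)) * (r ^ ((N:ℝ) - 2 * s))⁻¹ := by
      rw [← Real.rpow_mul_natCast hb0.le, hb, Real.mul_rpow hω.le (by positivity),
        ← Real.rpow_natCast r N, ← Real.rpow_mul hr0.le, ← Real.rpow_neg hr0.le]
      congr 2
      · push_cast; ring
      · rw [hp, critExp]
        have : (N:ℝ) ≠ 0 := by linarith
        push_cast; field_simp
    refine e1.trans (le_of_eq ?_)
    rw [mul_div_assoc, mul_pow, e2, e3, hrN, hκ]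
    field_simp
  have hfirst : t ^ 2 ≤ 4 / ω * (κ * M ^ 2 / t ^ 2) ^ θ * d := by
    rw [← hrs]
    have e : u x ^ 2 = t ^ 2 := (sq_abs _).symm
    rw [e] at hmain
    have : r ^ (2 * s) / ω * d * 4 = 4 / ω * r ^ (2 * s) * d := by ring
    linarith
  have e5 : (κ * M ^ 2 / t ^ 2) ^ θ = κ ^ θ * M ^ (p - 2) / t ^ (p - 2) := by
    rw [Real.div_rpow (by positivity) (by positivity), Real.mul_rpow hκ0.le (by positivity), hpθ,
      Real.rpow_mul hM.le, Real.rpow_mul ht0.le, Real.rpow_two, Real.rpow_two]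
  have e6 : t ^ p = t ^ 2 * t ^ (p - 2) := by
    rw [← Real.rpow_two, ← Real.rpow_add ht0]; congr 1; ring
  rw [e6]
  calc t ^ 2 * t ^ (p - 2) ≤ 4 / ω * (κ * M ^ 2 / t ^ 2) ^ θ * d * t ^ (p - 2) := by gcongr
    _ = _ := by rw [e5]; field_simp

/-- The fractional Sobolev inequality for functions already known to lie in `L^{2*_s}`. -/
theorem exists_sobolev_const_of_memLp {N : ℕ} {s : ℝ} (hs : 0 < s) (hN : 2 * s < N) :
    ∃ K : ℝ, 0 < K ∧ ∀ u : RN N → ℝ, MemHs N s u →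
      MemLp u (ENNReal.ofReal (critExp N s)) volume →
      eLpNorm u (ENNReal.ofReal (critExp N s)) volume
        ≤ ENNReal.ofReal K * eLpNorm (gagQuot N s u) 2 volume := by
  obtain ⟨K, hK, hpt⟩ := exists_pointwise_sobolev_const hs hN
  set p := critExp N s with hp
  have hp2 : 2 < p := critExp_gt_two hs hN
  have hp0 : ENNReal.ofReal p ≠ 0 := by simpa using by linarith
  refine ⟨√K, by positivity, fun u hu hup => ?_⟩
  set M := (eLpNorm u (ENNReal.ofReal p) volume).toReal with hMdef
  have hMe : eLpNorm u (ENNReal.ofReal p) volume = ENNReal.ofReal M :=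
    (ENNReal.ofReal_toReal hup.2.ne).symm
  rcases (show 0 ≤ M from ENNReal.toReal_nonneg).eq_or_lt with h0 | hM
  · rw [hMe, ← h0, ENNReal.ofReal_zero]; exact zero_le
  set G := (eLpNorm (gagQuot N s u) 2 volume).toReal with hG
  have hMp : M ^ p = ∫ x, |u x| ^ p := by
    have hI : 0 ≤ ∫ x, ‖u x‖ ^ p := integral_nonneg fun _ => by positivity
    rw [hMdef, hup.eLpNorm_eq_integral_rpow_norm hp0 ENNReal.ofReal_ne_top,
      ENNReal.toReal_ofReal (by linarith : 0 ≤ p), ENNReal.toReal_ofReal (by positivity),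
      ← Real.rpow_mul hI, inv_mul_cancel₀ (by linarith), Real.rpow_one]
    rfl
  have hint : ∫ x, |u x| ^ p ≤ ∫ x, K * M ^ (p - 2) * (gagDensity N s u x).toReal := by
    refine integral_mono_ae (integrable_norm_rpow_ofReal (by linarith) hup)
      ((integrable_gagDensity hu).const_mul _) ?_
    filter_upwards [ae_gagDensity_ne_top hu] with x hx
    exact hpt u M hM hu.1.1 hMe.le x hx
  rw [integral_const_mul, integral_gagDensity hu, ← hMp] at hint
  have e6 : M ^ p = M ^ 2 * M ^ (p - 2) := by
    rw [← Real.rpow_two, ← Real.rpow_add hM]; congr 1; ring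
  have hM2 : M ^ 2 ≤ K * G ^ 2 := by
    rw [e6] at hint
    have h1 : M ^ 2 * M ^ (p - 2) ≤ (K * G ^ 2) * M ^ (p - 2) := by linarith
    exact le_of_mul_le_mul_right h1 (by positivity)
  have hG0 : 0 ≤ G := ENNReal.toReal_nonneg
  have hMG : M ≤ √K * G := by
    refine (sq_le_sq₀ hM.le (by positivity)).1 ?_
    rw [mul_pow, Real.sq_sqrt hK.le]
    exact hM2
  rw [hMe, ← ENNReal.ofReal_toReal hu.2.2.ne, ← ENNReal.ofReal_mul (by positivity)]
  exact ENNReal.ofReal_le_ofReal hMG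

/-- The fractional Sobolev inequality `‖u‖_{2*_s} ≤ K [u]`, by truncation. -/
theorem exists_sobolev_const {N : ℕ} {s : ℝ} (hs : 0 < s) (hN : 2 * s < N) :
    ∃ K : ℝ, 0 < K ∧ ∀ u : RN N → ℝ, MemHs N s u →
      MemLp u (ENNReal.ofReal (critExp N s)) volume ∧
      eLpNorm u (ENNReal.ofReal (critExp N s)) volume
        ≤ ENNReal.ofReal K * eLpNorm (gagQuot N s u) 2 volume := by
  obtain ⟨K, hK, hsob⟩ := exists_sobolev_const_of_memLp hs hN
  set p := critExp N s with hp
  have hp2 : 2 < p := critExp_gt_two hs hN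
  have hp0 : ENNReal.ofReal p ≠ 0 := by simpa using by linarith
  refine ⟨K, hK, fun u hu => ?_⟩
  set T : ℕ → RN N → ℝ := fun k x => max (-(k:ℝ)) (min (u x) k) with hT
  have hTm : ∀ k, AEStronglyMeasurable (T k) volume := fun k =>
    aestronglyMeasurable_const.sup (hu.1.1.inf aestronglyMeasurable_const)
  have hlip : ∀ (k : ℕ) (a b : ℝ),
      |max (-(k:ℝ)) (min a k) - max (-(k:ℝ)) (min b k)| ≤ |a - b| := fun k a b => by
    refine (abs_max_sub_max_le_max _ _ _ _).trans ?_
    rw [sub_self, abs_zero]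
    refine max_le (abs_nonneg _) ((abs_min_sub_min_le_max _ _ _ _).trans ?_)
    rw [sub_self, abs_zero]
    exact max_le le_rfl (abs_nonneg _)
  have hTu : ∀ k x, |T k x| ≤ |u x| := fun k x => by
    have := hlip k (u x) 0
    have hk : max (-(k:ℝ)) (min 0 (k:ℝ)) = 0 := by
      rw [min_eq_left (Nat.cast_nonneg k), max_eq_right (by simp)]
    rwa [hk, sub_zero, sub_zero] at this
  have hTk : ∀ k x, |T k x| ≤ k := fun k x =>
    abs_le.2 ⟨le_max_left _ _, max_le (by linarith [Nat.cast_nonneg (α := ℝ) k]) (min_le_right _ _)⟩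
  have hTq : ∀ k q, ‖gagQuot N s (T k) q‖ ≤ ‖gagQuot N s u q‖ := fun k q => by
    simp only [gagQuot, norm_div]
    gcongr
    exact hlip k _ _
  have hTHs : ∀ k, MemHs N s (T k) := fun k =>
    ⟨hu.1.mono (hTm k) (Eventually.of_forall (hTu k)),
      hu.2.mono (aestronglyMeasurable_gagQuot (hTm k)) (Eventually.of_forall (hTq k))⟩
  have hTp : ∀ k, MemLp (T k) (ENNReal.ofReal p) volume := fun k => by
    rw [← integrable_norm_rpow_iff (hTm k) hp0 ENNReal.ofReal_ne_top,
      ENNReal.toReal_ofReal (by linarith)]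
    refine ((hTHs k).1.integrable_sq.const_mul ((k:ℝ) ^ (p - 2))).mono'
      (((hTm k).norm.aemeasurable.pow_const _).aestronglyMeasurable)
      (Eventually.of_forall fun x => ?_)
    rw [Real.norm_of_nonneg (by positivity), Real.norm_eq_abs, ← sq_abs]
    have : |T k x| ^ p = |T k x| ^ (p - 2) * |T k x| ^ 2 := by
      rw [← Real.rpow_two, ← Real.rpow_add_of_nonneg (abs_nonneg _) (by linarith) zero_le_two]
      congr 1; ring
    rw [this]
    gcongr
    exact hTk k x
  have hbound : ∀ k, eLpNorm (T k) (ENNReal.ofReal p) volume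
      ≤ ENNReal.ofReal K * eLpNorm (gagQuot N s u) 2 volume := fun k =>
    (hsob (T k) (hTHs k) (hTp k)).trans (by gcongr; exact eLpNorm_mono (hTq k))
  have hlim : ∀ x, Tendsto (fun k => T k x) atTop (𝓝 (u x)) := fun x => by
    obtain ⟨k0, hk0⟩ := exists_nat_ge |u x|
    refine tendsto_const_nhds.congr' ?_
    filter_upwards [eventually_ge_atTop k0] with k hk
    have hk' : |u x| ≤ k := hk0.trans (by exact_mod_cast hk)
    simp only [hT]
    rw [min_eq_left ((le_abs_self _).trans hk'), max_eq_right (abs_le.1 hk').1]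
  have hfin : eLpNorm u (ENNReal.ofReal p) volume
      ≤ ENNReal.ofReal K * eLpNorm (gagQuot N s u) 2 volume :=
    (Lp.eLpNorm_lim_le_liminf_eLpNorm hTm u (Eventually.of_forall hlim)).trans
      (liminf_le_of_frequently_le' (Frequently.of_forall hbound))
  exact ⟨⟨hu.1.1, hfin.trans_lt (ENNReal.mul_lt_top ENNReal.ofReal_lt_top hu.2.2)⟩, hfin⟩

/-! ### Local compactness in the fractional Sobolev space -/

/-- Local compactness of the embedding `H^s → L²`: if the averages over balls of a bounded sequence
tend to zero, then so do the `L²` norms on bounded sets.  Averaging over balls of radius `r` changes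
a function by at most `r^s` times the Gagliardo seminorm in `L²`. -/
theorem tendsto_integral_ball_sq {N : ℕ} {s M : ℝ} (hs : 0 < s) {w : ℕ → RN N → ℝ}
    (hw : ∀ n, MemHs N s (w n)) (hG : ∀ n, (eLpNorm (gagQuot N s (w n)) 2 volume).toReal ≤ M)
    (hL : ∀ n, (eLpNorm (w n) 2 volume).toReal ≤ M)
    (hav : ∀ (x : RN N) (r : ℝ), 0 < r →
      Tendsto (fun n => ∫ y in Metric.ball x r, w n y) atTop (𝓝 0)) (R : ℝ) :
    Tendsto (fun n => ∫ x in Metric.ball (0 : RN N) R, w n x ^ 2) atTop (𝓝 0) := by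
  have hM0 : 0 ≤ M := ENNReal.toReal_nonneg.trans (hL 0)
  have hω := unitVol_pos N
  set S := Metric.ball (0 : RN N) R
  rw [Metric.tendsto_atTop']
  intro η hη
  obtain ⟨r, hr, hrη⟩ : ∃ r : ℝ, 0 < r ∧ 2 * (r ^ (2 * s) / unitVol N * M ^ 2) < η / 2 := by
    have h1 : Tendsto (fun r : ℝ => 2 * (r ^ (2 * s) / unitVol N * M ^ 2)) (𝓝[>] 0)
        (𝓝 (2 * (0 ^ (2 * s) / unitVol N * M ^ 2))) := by
      have : Continuous fun r : ℝ => 2 * (r ^ (2 * s) / unitVol N * M ^ 2) := by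
        have h2 : Continuous fun r : ℝ => r ^ (2 * s) :=
          continuous_id.rpow_const fun _ => Or.inr (by linarith)
        fun_prop
      exact (this.tendsto 0).mono_left nhdsWithin_le_nhds
    rw [Real.zero_rpow (by linarith), zero_div, zero_mul, mul_zero] at h1
    obtain ⟨r, h2, h3⟩ := ((h1.eventually (gt_mem_nhds (half_pos hη))).and self_mem_nhdsWithin).exists
    exact ⟨r, h3, h2⟩
  set b : ℝ := unitVol N * r ^ N with hb
  have hb0 : 0 < b := by positivity
  set A : ℕ → RN N → ℝ := fun n x => ∫ y in Metric.ball x r, w n y with hA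
  have hlin : ∀ n x, ∫⁻ y in Metric.ball x r, ‖w n y‖ₑ ≤ ENNReal.ofReal (M * b ^ (1 - 1 / (2:ℝ))) :=
    fun n x => setLIntegral_enorm_le_of_eLpNorm_le one_le_two hM0 hb0 (volume_ball_eq x hr)
      (hw n).1.1 (by
        rw [ENNReal.ofReal_ofNat, ← ENNReal.ofReal_toReal (hw n).1.2.ne]
        exact ENNReal.ofReal_le_ofReal (hL n))
  have hAb : ∀ n x, |A n x| ≤ M * b ^ (1 - 1 / (2:ℝ)) := fun n x => by
    refine (norm_integral_le_integral_norm (w n)).trans ?_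
    rw [integral_norm_eq_lintegral_enorm (hw n).1.1.restrict]
    exact ENNReal.toReal_le_of_le_ofReal (by positivity) (hlin n x)
  have hAm : ∀ n, AEStronglyMeasurable (A n) volume := fun n => by
    have hS : MeasurableSet {q : RN N × RN N | dist q.2 q.1 < r} :=
      measurableSet_lt (by fun_prop) measurable_const
    have h2 : AEStronglyMeasurable (fun p : RN N × RN N => w n p.2) (volume.prod volume) :=
      (hw n).1.1.comp_quasiMeasurePreserving Measure.quasiMeasurePreserving_snd
    have h3 := (h2.indicator hS).integral_prod_right'
    refine h3.congr (Eventually.of_forall fun x => ?_)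
    simp only [hA]
    rw [← integral_indicator measurableSet_ball]
    rfl
  have hfin : IsFiniteMeasure (volume.restrict S) := ⟨by
    rw [Measure.restrict_apply_univ]; exact measure_ball_lt_top⟩
  have hA2 : ∀ n, IntegrableOn (fun x => (A n x / b) ^ 2) S volume := fun n => by
    refine Measure.integrableOn_of_bounded (M := (M * b ^ (1 - 1 / (2:ℝ)) / b) ^ 2)
      measure_ball_lt_top.ne (((hAm n).aemeasurable.div_const b).pow_const 2).aestronglyMeasurable
      (Eventually.of_forall fun x => ?_)
    rw [Real.norm_eq_abs, abs_pow, abs_div, abs_of_pos hb0]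
    have := hAb n x
    gcongr
  have hA0 : Tendsto (fun n => ∫ x in S, (A n x / b) ^ 2) atTop (𝓝 (∫ _ in S, (0:ℝ))) := by
    refine tendsto_integral_of_dominated_convergence
      (fun _ => (M * b ^ (1 - 1 / (2:ℝ)) / b) ^ 2) (fun n => (hA2 n).1) (integrable_const _)
      (fun n => Eventually.of_forall fun x => ?_) (Eventually.of_forall fun x => ?_)
    · rw [Real.norm_eq_abs, abs_pow, abs_div, abs_of_pos hb0]
      have := hAb n x
      gcongr
    · simpa using ((hav x r hr).div_const b).pow 2
  rw [integral_zero] at hA0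
  obtain ⟨n0, hn0⟩ := eventually_atTop.1
    (hA0.eventually (gt_mem_nhds (show (0:ℝ) < η / 4 by positivity)))
  refine ⟨n0, fun n hn => ?_⟩
  rw [Real.dist_eq, sub_zero, abs_of_nonneg (integral_nonneg fun _ => sq_nonneg _)]
  have hD := integrable_gagDensity (hw n)
  have hle : ∫ x in S, w n x ^ 2 ≤ ∫ x in S, (2 * (r ^ (2 * s) / unitVol N)
      * (gagDensity N s (w n) x).toReal + 2 * (A n x / b) ^ 2) := by
    refine integral_mono_ae (hw n).1.integrable_sq.integrableOn
      ((hD.integrableOn.const_mul _).add ((hA2 n).const_mul 2))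
      (ae_restrict_of_ae ?_)
    filter_upwards [ae_gagDensity_ne_top (hw n)] with x hx
    have := sq_le_density_add_average hs (hw n).1.1 x hr
      ⟨(hw n).1.1.restrict, (hlin n x).trans_lt ENNReal.ofReal_lt_top⟩ hx
    simp only [hA]
    linarith
  have hsplit : ∫ x in S, (2 * (r ^ (2 * s) / unitVol N)
      * (gagDensity N s (w n) x).toReal + 2 * (A n x / b) ^ 2)
      = 2 * (r ^ (2 * s) / unitVol N) * (∫ x in S, (gagDensity N s (w n) x).toReal)
        + 2 * ∫ x in S, (A n x / b) ^ 2 := by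
    rw [integral_add (hD.integrableOn.const_mul _) ((hA2 n).const_mul 2), integral_const_mul,
      integral_const_mul]
  have h1 : ∫ x in S, (gagDensity N s (w n) x).toReal ≤ M ^ 2 := by
    refine (setIntegral_le_integral hD (Eventually.of_forall fun x => ENNReal.toReal_nonneg)).trans ?_
    rw [integral_gagDensity (hw n)]
    have := hG n
    gcongr
  have h2 : 2 * (r ^ (2 * s) / unitVol N) * (∫ x in S, (gagDensity N s (w n) x).toReal)
      ≤ 2 * (r ^ (2 * s) / unitVol N) * M ^ 2 := by gcongr
  have h3 := hn0 n hn.le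
  linarith

/-- If a sequence tends to zero in `L²_loc`, then so does the integral of every sequence that it
controls on bounded sets and that is uniformly small at infinity. -/
theorem eventually_integral_le_of_small_at_infinity {N : ℕ} {w : ℕ → RN N → ℝ}
    (hw : ∀ n, MemLp (w n) 2 volume)
    (hloc : ∀ R : ℝ, Tendsto (fun n => ∫ x in Metric.ball (0 : RN N) R, w n x ^ 2) atTop (𝓝 0))
    {a b : ℕ → RN N → ℝ} {c M : ℝ} (ha : ∀ n, Integrable (a n) volume)
    (hb : ∀ n, Integrable (b n) volume) (hb0 : ∀ n x, 0 ≤ b n x) (hbM : ∀ n, ∫ x, b n x ≤ M)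
    (h : ∀ δ > 0, ∃ R : ℝ, ∀ n x, (‖x‖ < R → a n x ≤ c * w n x ^ 2) ∧
      (R ≤ ‖x‖ → a n x ≤ δ * b n x)) {η : ℝ} (hη : 0 < η) :
    ∀ᶠ n in atTop, ∫ x, a n x ≤ η := by
  have hM : 0 ≤ M := (integral_nonneg (hb0 0)).trans (hbM 0)
  obtain ⟨R, hR⟩ := h (η / 2 / (M + 1)) (by positivity)
  set S := Metric.ball (0 : RN N) R with hS
  have h1 := (hloc R).const_mul c
  rw [mul_zero] at h1
  filter_upwards [h1.eventually (gt_mem_nhds (half_pos hη))] with n hn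
  have e1 : ∫ x in S, a n x ≤ c * ∫ x in S, w n x ^ 2 := by
    rw [← integral_const_mul]
    refine setIntegral_mono_on (ha n).integrableOn ((hw n).integrable_sq.integrableOn.const_mul c)
      measurableSet_ball fun x hx => (hR n x).1 ?_
    exact mem_ball_zero_iff.1 hx
  have e2 : ∫ x in Sᶜ, a n x ≤ η / 2 / (M + 1) * ∫ x in Sᶜ, b n x := by
    rw [← integral_const_mul]
    refine setIntegral_mono_on (ha n).integrableOn ((hb n).integrableOn.const_mul _)
      measurableSet_ball.compl fun x hx => (hR n x).2 ?_
    rw [hS, mem_compl_iff, mem_ball_zero_iff, not_lt] at hx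
    exact hx
  have e3 : ∫ x in Sᶜ, b n x ≤ M :=
    (setIntegral_le_integral (hb n) (Eventually.of_forall (hb0 n))).trans (hbM n)
  have e4 : η / 2 / (M + 1) * ∫ x in Sᶜ, b n x ≤ η / 2 := by
    calc _ ≤ η / 2 / (M + 1) * (M + 1) := by gcongr; linarith
      _ = η / 2 := by field_simp
  rw [← integral_add_compl measurableSet_ball (ha n)]
  linarith

theorem integral_sq_eq_eLpNorm {Ω : Type*} [MeasurableSpace Ω] {μ : Measure Ω} {f : Ω → ℝ}
    (hf : AEStronglyMeasurable f μ) : ∫ x, f x ^ 2 ∂μ = (eLpNorm f 2 μ).toReal ^ 2 := by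
  rw [← ENNReal.toReal_pow, eLpNorm_two_sq, integral_eq_lintegral_of_nonneg_ae
    (Eventually.of_forall fun x => sq_nonneg _) (hf.aemeasurable.pow_const 2).aestronglyMeasurable]
  congr 1
  refine lintegral_congr fun x => ?_
  rw [← ofReal_norm, ← ENNReal.ofReal_pow (norm_nonneg _), Real.norm_eq_abs, sq_abs]

/-- A sequence bounded in `L²` that tends to zero in `L²_loc` has a subsequence that tends to zero
almost everywhere. -/
theorem exists_subseq_tendsto_ae_zero {N : ℕ} {w : ℕ → RN N → ℝ} {M : ℝ}
    (hw : ∀ n, MemLp (w n) 2 volume) (hL : ∀ n, (eLpNorm (w n) 2 volume).toReal ≤ M)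
    (hloc : ∀ R : ℝ, Tendsto (fun n => ∫ x in Metric.ball (0 : RN N) R, w n x ^ 2) atTop (𝓝 0)) :
    ∃ φ : ℕ → ℕ, StrictMono φ ∧ ∀ᵐ x, Tendsto (fun k => w (φ k) x) atTop (𝓝 0) := by
  set g : RN N → ℝ := fun x => (1 + ‖x‖)⁻¹ with hg
  have hg0 : ∀ x, 0 < g x := fun x => by positivity
  have hg1 : ∀ x, g x ≤ 1 := fun x => inv_le_one_of_one_le₀ (by linarith [norm_nonneg x])
  have hgm : Measurable g := by fun_prop
  have hm : ∀ n, AEStronglyMeasurable (fun x => g x * w n x) volume := fun n =>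
    hgm.aestronglyMeasurable.mul (hw n).1
  have hgw : ∀ n, MemLp (fun x => g x * w n x) 2 volume := fun n => by
    refine (hw n).mono (hm n) (Eventually.of_forall fun x => ?_)
    rw [norm_mul, Real.norm_of_nonneg (hg0 x).le]
    exact mul_le_of_le_one_left (norm_nonneg _) (hg1 x)
  have key : Tendsto (fun n => ∫ x, (g x * w n x) ^ 2) atTop (𝓝 0) := by
    rw [Metric.tendsto_nhds]
    intro η hη
    have := eventually_integral_le_of_small_at_infinity hw hloc (c := 1) (M := M ^ 2)
      (a := fun n x => (g x * w n x) ^ 2) (b := fun n x => w n x ^ 2)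
      (fun n => (hgw n).integrable_sq) (fun n => (hw n).integrable_sq) (fun n x => sq_nonneg _)
      (fun n => ?_) (fun δ hδ => ?_) (half_pos hη)
    · filter_upwards [this] with n hn
      rw [Real.dist_eq, sub_zero, abs_of_nonneg (integral_nonneg fun _ => sq_nonneg _)]
      linarith
    · rw [integral_sq_eq_eLpNorm (hw n).1]
      have := hL n
      gcongr
    · refine ⟨δ⁻¹, fun n x => ⟨fun _ => ?_, fun hx => ?_⟩⟩
      · rw [mul_pow]
        gcongr
        exact pow_le_one₀ (hg0 x).le (hg1 x)
      · rw [mul_pow]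
        gcongr
        have h1 : g x ≤ δ := by
          rw [hg]
          refine inv_le_of_inv_le₀ hδ (by linarith [norm_nonneg x])
        calc g x ^ 2 = g x * g x := sq _
          _ ≤ 1 * δ := mul_le_mul (hg1 x) h1 (hg0 x).le zero_le_one
          _ = δ := one_mul δ
  have hin : TendstoInMeasure volume (fun n x => g x * w n x) atTop (fun _ : RN N => (0:ℝ)) := by
    refine tendstoInMeasure_of_tendsto_eLpNorm (p := 2) two_ne_zero hm aestronglyMeasurable_const ?_
    have h1 : ∀ n, eLpNorm ((fun x => g x * w n x) - fun _ => (0:ℝ)) 2 volume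
        = ENNReal.ofReal (√(∫ x, (g x * w n x) ^ 2)) := fun n => by
      rw [integral_sq_eq_eLpNorm (hm n), Real.sqrt_sq ENNReal.toReal_nonneg,
        ENNReal.ofReal_toReal (hgw n).2.ne]
      congr 1
      funext x
      simp
    simp_rw [h1]
    have := ENNReal.tendsto_ofReal (Real.continuous_sqrt.tendsto _ |>.comp key)
    simpa using this
  obtain ⟨φ, hφ, hae⟩ := hin.exists_seq_tendsto_ae
  refine ⟨φ, hφ, ?_⟩
  filter_upwards [hae] with x hx
  have h1 := hx.const_mul (g x)⁻¹
  rw [mul_zero] at h1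
  refine h1.congr fun k => ?_
  rw [inv_mul_cancel_left₀ (hg0 x).ne']

/-- Bounded sequences of a Hilbert space have weakly convergent subsequences. -/
theorem exists_weakly_convergent_subseq {H : Type*} [NormedAddCommGroup H] [InnerProductSpace ℝ H]
    [CompleteSpace H] {z : ℕ → H} {M : ℝ} (hz : ∀ n, ‖z n‖ ≤ M) :
    ∃ (w : H) (φ : ℕ → ℕ), StrictMono φ ∧
      ∀ f : H →L[ℝ] ℝ, Tendsto (fun k => f (z (φ k))) atTop (𝓝 (f w)) := by
  set Y := (Submodule.span ℝ (range z)).topologicalClosure with hY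
  have hsep : TopologicalSpace.IsSeparable (Y : Set H) := by
    rw [hY, Submodule.topologicalClosure_coe]
    exact ((countable_range z).isSeparable.span (R := ℝ)).closure
  have : TopologicalSpace.SeparableSpace Y := hsep.separableSpace
  have : CompleteSpace Y :=
    (Submodule.isClosed_topologicalClosure (Submodule.span ℝ (range z))).completeSpace_coe
  have hmem : ∀ n, z n ∈ Y := fun n =>
    Submodule.le_topologicalClosure _ (Submodule.subset_span (mem_range_self n))
  set y : ℕ → Y := fun n => ⟨z n, hmem n⟩ with hy
  set F : ℕ → WeakDual ℝ Y := fun n =>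
    StrongDual.toWeakDual (InnerProductSpace.toDual ℝ Y (y n)) with hF
  obtain ⟨g, -, φ, hφ, hg⟩ := WeakDual.isSeqCompact_closedBall (𝕜 := ℝ) (E := Y) 0 M
    (x := F) (fun n => by
      rw [mem_preimage, mem_closedBall_zero_iff]
      exact ((InnerProductSpace.toDual ℝ Y).norm_map (y n)).trans_le (hz n))
  set w : Y := (InnerProductSpace.toDual ℝ Y).symm (WeakDual.toStrongDual g) with hw
  refine ⟨w, φ, hφ, fun f => ?_⟩
  set y' : Y := (InnerProductSpace.toDual ℝ Y).symm (f.comp Y.subtypeL) with hy'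
  have hf : ∀ x : Y, f x = inner ℝ x y' := fun x => by
    rw [real_inner_comm, hy', InnerProductSpace.toDual_symm_apply]
    rfl
  have h1 : Tendsto (fun k => F (φ k) y') atTop (𝓝 (g y')) :=
    ((WeakDual.eval_continuous y').tendsto g).comp hg
  have h2 : g y' = f w := by
    rw [hf, hw, InnerProductSpace.toDual_symm_apply]
    rfl
  rw [h2] at h1
  refine h1.congr fun k => ?_
  exact (hf (y (φ k))).symm

/-! ### The Hilbert space of pairs -/

theorem Potential.inf_le {N : ℕ} (V : Potential N) (x : RN N) : V.inf ≤ V.toFun x := by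
  have hb : BddBelow (range V.toFun) := ⟨0, by rintro _ ⟨y, rfl⟩; exact (V.pos y).le⟩
  exact ciInf_le hb x

/-- The function `√V(ε x) u(x)`, whose `L²` norm is the potential part of the norm. -/
noncomputable def potFun {N : ℕ} (ε : ℝ) (V : Potential N) (u : RN N → ℝ) (x : RN N) : ℝ :=
  √(V.toFun (ε • x)) * u x

section Components

variable {N : ℕ} {s ε : ℝ} {V : Potential N} {u v : RN N → ℝ}

theorem potFun_sq (x : RN N) : potFun ε V u x ^ 2 = V.toFun (ε • x) * u x ^ 2 := by
  rw [potFun, mul_pow, Real.sq_sqrt (V.pos _).le]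

theorem potFun_sub : potFun ε V (u - v) = potFun ε V u - potFun ε V v := by
  funext x
  simp only [potFun, Pi.sub_apply]
  ring

theorem gagQuot_sub : gagQuot N s (u - v) = gagQuot N s u - gagQuot N s v := by
  funext p
  simp only [gagQuot, Pi.sub_apply]
  ring

theorem potFun_congr (h : u =ᵐ[volume] v) : potFun ε V u =ᵐ[volume] potFun ε V v := by
  filter_upwards [h] with x hx
  rw [potFun, potFun, hx]

theorem continuous_sqrt_potential : Continuous fun x : RN N => √(V.toFun (ε • x)) :=
  Real.continuous_sqrt.comp (V.cont.comp (continuous_const_smul ε))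

theorem aestronglyMeasurable_potFun (hu : AEStronglyMeasurable u volume) :
    AEStronglyMeasurable (potFun ε V u) volume :=
  continuous_sqrt_potential.aestronglyMeasurable.mul hu

theorem memLp_potFun_iff (hu : AEStronglyMeasurable u volume) :
    MemLp (potFun ε V u) 2 volume ↔ FinPot ε V u := by
  rw [memLp_two_iff_integrable_sq (aestronglyMeasurable_potFun hu), FinPot]
  simp_rw [potFun_sq]

theorem gagSq_eq (hu : AEStronglyMeasurable u volume) :
    gagSq N s u = (eLpNorm (gagQuot N s u) 2 volume).toReal ^ 2 := by
  rw [← gagForm_self, gagForm, ← integral_sq_eq_eLpNorm (aestronglyMeasurable_gagQuot hu)]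
  simp_rw [sq]

theorem integral_potential_eq (hu : AEStronglyMeasurable u volume) :
    ∫ x, V.toFun (ε • x) * u x ^ 2 = (eLpNorm (potFun ε V u) 2 volume).toReal ^ 2 := by
  rw [← integral_sq_eq_eLpNorm (aestronglyMeasurable_potFun hu)]
  simp_rw [potFun_sq]

theorem eLpNorm_two_le_potFun (hu : MemLp u 2 volume) (hp : FinPot ε V u) :
    (eLpNorm u 2 volume).toReal ≤ √(V.inf)⁻¹ * (eLpNorm (potFun ε V u) 2 volume).toReal := by
  have hV : 0 < V.inf := V.inf_pos
  refine (sq_le_sq₀ ENNReal.toReal_nonneg (mul_nonneg (Real.sqrt_nonneg _)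
    ENNReal.toReal_nonneg)).1 ?_
  rw [mul_pow, Real.sq_sqrt (by positivity), ← integral_sq_eq_eLpNorm hu.1,
    ← integral_potential_eq hu.1, ← integral_const_mul]
  refine integral_mono hu.integrable_sq (hp.const_mul _) fun x => ?_
  have := V.inf_le (ε • x)
  rw [← mul_assoc]
  refine le_mul_of_one_le_left (sq_nonneg _) ?_
  rw [inv_mul_eq_div, one_le_div hV]
  exact this

/-- An `L²` Cauchy sequence that converges almost everywhere along a subsequence converges in `L²`
to the same limit. -/
theorem tendsto_eLpNorm_of_cauchy_of_ae {Ω : Type*} [MeasurableSpace Ω] {μ : Measure Ω}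
    {f : ℕ → Ω → ℝ} {g : Ω → ℝ} (hf : ∀ n, MemLp (f n) 2 μ)
    (hC : ∀ η > 0, ∃ n0, ∀ m ≥ n0, ∀ n ≥ n0, (eLpNorm (f m - f n) 2 μ).toReal ≤ η)
    {φ : ℕ → ℕ} (hφ : StrictMono φ) (hg : AEStronglyMeasurable g μ)
    (hae : ∀ᵐ x ∂μ, Tendsto (fun k => f (φ k) x) atTop (𝓝 (g x))) :
    MemLp g 2 μ ∧ Tendsto (fun n => (eLpNorm (f n - g) 2 μ).toReal) atTop (𝓝 0) := by
  have key : ∀ η > 0, ∃ n0, ∀ m ≥ n0, eLpNorm (f m - g) 2 μ ≤ ENNReal.ofReal η := by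
    intro η hη
    obtain ⟨n0, hn0⟩ := hC η hη
    refine ⟨n0, fun m hm => ?_⟩
    refine (Lp.eLpNorm_lim_le_liminf_eLpNorm (f := fun k => f m - f (φ k))
      (fun k => (hf m).1.sub (hf _).1) (f m - g) ?_).trans ?_
    · filter_upwards [hae] with x hx using tendsto_const_nhds.sub hx
    · refine liminf_le_of_frequently_le' (Eventually.frequently ?_)
      filter_upwards [eventually_ge_atTop n0] with k hk
      rw [← ENNReal.ofReal_toReal ((hf m).sub (hf (φ k))).2.ne]
      exact ENNReal.ofReal_le_ofReal (hn0 m hm _ (hk.trans (hφ.id_le k)))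
  obtain ⟨n1, hn1⟩ := key 1 one_pos
  have hmem : MemLp (f n1 - g) 2 μ :=
    ⟨(hf n1).1.sub hg, (hn1 n1 le_rfl).trans_lt ENNReal.ofReal_lt_top⟩
  refine ⟨?_, ?_⟩
  · have := (hf n1).sub hmem
    rwa [sub_sub_cancel] at this
  · rw [Metric.tendsto_atTop]
    intro η hη
    obtain ⟨n0, hn0⟩ := key (η / 2) (by positivity)
    refine ⟨n0, fun m hm => ?_⟩
    rw [Real.dist_eq, sub_zero, abs_of_nonneg ENNReal.toReal_nonneg]
    have := ENNReal.toReal_le_of_le_ofReal (by positivity) (hn0 m hm)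
    linarith

theorem exists_limit_of_cauchy_component {w : ℕ → RN N → ℝ} (hw : ∀ n, MemHs N s (w n))
    (hp : ∀ n, FinPot ε V (w n))
    (hC : ∀ η > 0, ∃ n0, ∀ m ≥ n0, ∀ n ≥ n0,
      (eLpNorm (gagQuot N s (w m - w n)) 2 volume).toReal ≤ η ∧
      (eLpNorm (potFun ε V (w m - w n)) 2 volume).toReal ≤ η) :
    ∃ U : RN N → ℝ, MemHs N s U ∧ FinPot ε V U ∧
      Tendsto (fun n => (eLpNorm (gagQuot N s (w n - U)) 2 volume).toReal) atTop (𝓝 0) ∧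
      Tendsto (fun n => (eLpNorm (potFun ε V (w n - U)) 2 volume).toReal) atTop (𝓝 0) := by
  have hP : ∀ n, MemLp (potFun ε V (w n)) 2 volume := fun n =>
    (memLp_potFun_iff (hw n).1.1).2 (hp n)
  have hCp : ∀ η > 0, ∃ n0, ∀ m ≥ n0, ∀ n ≥ n0,
      (eLpNorm (potFun ε V (w m) - potFun ε V (w n)) 2 volume).toReal ≤ η := fun η hη => by
    obtain ⟨n0, h⟩ := hC η hη
    exact ⟨n0, fun m hm n hn => by rw [← potFun_sub]; exact (h m hm n hn).2⟩
  have hCg : ∀ η > 0, ∃ n0, ∀ m ≥ n0, ∀ n ≥ n0,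
      (eLpNorm (gagQuot N s (w m) - gagQuot N s (w n)) 2 volume).toReal ≤ η := fun η hη => by
    obtain ⟨n0, h⟩ := hC η hη
    exact ⟨n0, fun m hm n hn => by rw [← gagQuot_sub]; exact (h m hm n hn).1⟩
  have hcs : CauchySeq fun n => (hP n).toLp (potFun ε V (w n)) := by
    refine Metric.cauchySeq_iff.2 fun η hη => ?_
    obtain ⟨n0, h⟩ := hCp (η / 2) (by positivity)
    refine ⟨n0, fun m hm n hn => ?_⟩
    rw [dist_eq_norm, ← MemLp.toLp_sub, Lp.norm_toLp]
    exact (h m hm n hn).trans_lt (half_lt_self hη)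
  obtain ⟨L, hL⟩ := cauchySeq_tendsto_of_complete hcs
  have hm : TendstoInMeasure volume (fun n => potFun ε V (w n)) atTop (L : RN N → ℝ) := by
    refine tendstoInMeasure_of_tendsto_eLpNorm (p := 2) two_ne_zero (fun n => (hP n).1)
      (Lp.memLp L).1 ?_
    have h1 := ENNReal.tendsto_ofReal (tendsto_iff_norm_sub_tendsto_zero.1 hL)
    rw [ENNReal.ofReal_zero] at h1
    refine h1.congr fun n => ?_
    rw [Lp.norm_def, ENNReal.ofReal_toReal (Lp.memLp _).2.ne]
    refine eLpNorm_congr_ae ?_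
    filter_upwards [Lp.coeFn_sub ((hP n).toLp _) L, (hP n).coeFn_toLp] with x h2 h3
    rw [h2, Pi.sub_apply, Pi.sub_apply, h3]
  obtain ⟨φ, hφ, hae⟩ := hm.exists_seq_tendsto_ae
  set U : RN N → ℝ := fun x => (√(V.toFun (ε • x)))⁻¹ * L x with hU
  have hpos : ∀ x : RN N, 0 < √(V.toFun (ε • x)) := fun x => Real.sqrt_pos.2 (V.pos _)
  have hUm : AEStronglyMeasurable U volume :=
    ((continuous_sqrt_potential (V := V) (ε := ε)).inv₀
      fun x => (hpos x).ne').aestronglyMeasurable.mul (Lp.memLp L).1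
  have hwU : ∀ᵐ x, Tendsto (fun k => w (φ k) x) atTop (𝓝 (U x)) := by
    filter_upwards [hae] with x hx
    refine (hx.const_mul (√(V.toFun (ε • x)))⁻¹).congr fun k => ?_
    rw [potFun, inv_mul_cancel_left₀ (hpos x).ne']
  have hpU : ∀ᵐ x, Tendsto (fun k => potFun ε V (w (φ k)) x) atTop (𝓝 (potFun ε V U x)) := by
    filter_upwards [hwU] with x hx using hx.const_mul _
  have hgU : ∀ᵐ p : RN N × RN N,
      Tendsto (fun k => gagQuot N s (w (φ k)) p) atTop (𝓝 (gagQuot N s U p)) := by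
    have h1 : ∀ᵐ p : RN N × RN N, Tendsto (fun k => w (φ k) p.1) atTop (𝓝 (U p.1)) :=
      Measure.quasiMeasurePreserving_fst.ae hwU
    have h2 : ∀ᵐ p : RN N × RN N, Tendsto (fun k => w (φ k) p.2) atTop (𝓝 (U p.2)) :=
      Measure.quasiMeasurePreserving_snd.ae hwU
    filter_upwards [h1, h2] with p e1 e2 using (e1.sub e2).div_const _
  obtain ⟨a1, a2⟩ := tendsto_eLpNorm_of_cauchy_of_ae hP hCp hφ (aestronglyMeasurable_potFun hUm) hpU
  obtain ⟨b1, b2⟩ := tendsto_eLpNorm_of_cauchy_of_ae (fun n => (hw n).2) hCg hφ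
    (aestronglyMeasurable_gagQuot hUm) hgU
  have hUp : FinPot ε V U := (memLp_potFun_iff hUm).1 a1
  have hU2 : MemLp U 2 volume := by
    rw [memLp_two_iff_integrable_sq hUm]
    have hV : 0 < V.inf := V.inf_pos
    refine (hUp.const_mul (V.inf)⁻¹).mono' (hUm.aemeasurable.pow_const 2).aestronglyMeasurable
      (Eventually.of_forall fun x => ?_)
    rw [Real.norm_of_nonneg (sq_nonneg _), ← mul_assoc]
    refine le_mul_of_one_le_left (sq_nonneg _) ?_
    rw [inv_mul_eq_div, one_le_div hV]
    exact V.inf_le _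
  refine ⟨U, ⟨hU2, b1⟩, hUp, ?_, ?_⟩
  · simpa only [gagQuot_sub] using b2
  · simpa only [potFun_sub] using a2

end Components

namespace XSpace

variable {N : ℕ} {s ε : ℝ} {V W : Potential N}

theorem u_sub (z w : XSpace N s ε V W) : (z - w).u =ᵐ[volume] z.u - w.u :=
  AEEqFun.coeFn_sub z.val.1 w.val.1
theorem v_sub (z w : XSpace N s ε V W) : (z - w).v =ᵐ[volume] z.v - w.v :=
  AEEqFun.coeFn_sub z.val.2 w.val.2

theorem norm_sq_eq_sum (z : XSpace N s ε V W) :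
    ‖z‖ ^ 2 = (eLpNorm (gagQuot N s z.u) 2 volume).toReal ^ 2
      + (eLpNorm (gagQuot N s z.v) 2 volume).toReal ^ 2
      + ((eLpNorm (potFun ε V z.u) 2 volume).toReal ^ 2
      + (eLpNorm (potFun ε W z.v) 2 volume).toReal ^ 2) := by
  rw [norm_sq_eq, integral_add z.finPot_u z.finPot_v, gagSq_eq z.memHs_u.1.1,
    gagSq_eq z.memHs_v.1.1, integral_potential_eq z.memHs_u.1.1, integral_potential_eq z.memHs_v.1.1]

theorem gag_u_le (z : XSpace N s ε V W) : (eLpNorm (gagQuot N s z.u) 2 volume).toReal ≤ ‖z‖ := by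
  refine (sq_le_sq₀ ENNReal.toReal_nonneg (norm_nonneg _)).1 ?_
  rw [norm_sq_eq_sum, add_assoc]
  exact le_add_of_nonneg_right (by positivity)

theorem gag_v_le (z : XSpace N s ε V W) : (eLpNorm (gagQuot N s z.v) 2 volume).toReal ≤ ‖z‖ := by
  refine (sq_le_sq₀ ENNReal.toReal_nonneg (norm_nonneg _)).1 ?_
  rw [norm_sq_eq_sum, add_right_comm]
  exact le_add_of_nonneg_left (by positivity)

theorem pot_u_le (z : XSpace N s ε V W) : (eLpNorm (potFun ε V z.u) 2 volume).toReal ≤ ‖z‖ := by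
  refine (sq_le_sq₀ ENNReal.toReal_nonneg (norm_nonneg _)).1 ?_
  rw [norm_sq_eq_sum, add_left_comm]
  exact le_add_of_nonneg_right (by positivity)

theorem pot_v_le (z : XSpace N s ε V W) : (eLpNorm (potFun ε W z.v) 2 volume).toReal ≤ ‖z‖ := by
  refine (sq_le_sq₀ ENNReal.toReal_nonneg (norm_nonneg _)).1 ?_
  rw [norm_sq_eq_sum, ← add_assoc]
  exact le_add_of_nonneg_left (by positivity)

theorem eLpNorm_u_le (z : XSpace N s ε V W) :
    (eLpNorm z.u 2 volume).toReal ≤ √(V.inf)⁻¹ * ‖z‖ :=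
  (eLpNorm_two_le_potFun z.memHs_u.1 z.finPot_u).trans (by gcongr; exact z.pot_u_le)

theorem eLpNorm_v_le (z : XSpace N s ε V W) :
    (eLpNorm z.v 2 volume).toReal ≤ √(W.inf)⁻¹ * ‖z‖ :=
  (eLpNorm_two_le_potFun z.memHs_v.1 z.finPot_v).trans (by gcongr; exact z.pot_v_le)

/-- The element of `X_ε` given by a pair of functions. -/
noncomputable def ofPair {U U' : RN N → ℝ} (h1 : MemHs N s U) (h2 : MemHs N s U')
    (h3 : FinPot ε V U) (h4 : FinPot ε W U') : XSpace N s ε V W :=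
  ⟨(AEEqFun.mk U h1.1.1, AEEqFun.mk U' h2.1.1),
    ⟨h1.congr (AEEqFun.coeFn_mk _ _).symm, h2.congr (AEEqFun.coeFn_mk _ _).symm⟩,
    h3.congr (AEEqFun.coeFn_mk _ _).symm, h4.congr (AEEqFun.coeFn_mk _ _).symm⟩

instance : CompleteSpace (XSpace N s ε V W) := by
  refine Metric.complete_of_cauchySeq_tendsto fun z hz => ?_
  have hC : ∀ η > 0, ∃ n0, ∀ m ≥ n0, ∀ n ≥ n0, ‖z m - z n‖ ≤ η := fun η hη => by
    obtain ⟨n0, h⟩ := Metric.cauchySeq_iff.1 hz η hη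
    exact ⟨n0, fun m hm n hn => by rw [← dist_eq_norm]; exact (h m hm n hn).le⟩
  obtain ⟨U, hU1, hU2, hU3, hU4⟩ := exists_limit_of_cauchy_component (V := V) (ε := ε)
    (fun n => (z n).memHs_u) (fun n => (z n).finPot_u) fun η hη => by
      obtain ⟨n0, h⟩ := hC η hη
      refine ⟨n0, fun m hm n hn => ⟨?_, ?_⟩⟩
      · rw [← eLpNorm_congr_ae (gagQuot_congr (u_sub (z m) (z n)))]
        exact (gag_u_le _).trans (h m hm n hn)
      · rw [← eLpNorm_congr_ae (potFun_congr (u_sub (z m) (z n)))]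
        exact (pot_u_le _).trans (h m hm n hn)
  obtain ⟨U', hU1', hU2', hU3', hU4'⟩ := exists_limit_of_cauchy_component (V := W) (ε := ε)
    (fun n => (z n).memHs_v) (fun n => (z n).finPot_v) fun η hη => by
      obtain ⟨n0, h⟩ := hC η hη
      refine ⟨n0, fun m hm n hn => ⟨?_, ?_⟩⟩
      · rw [← eLpNorm_congr_ae (gagQuot_congr (v_sub (z m) (z n)))]
        exact (gag_v_le _).trans (h m hm n hn)
      · rw [← eLpNorm_congr_ae (potFun_congr (v_sub (z m) (z n)))]
        exact (pot_v_le _).trans (h m hm n hn)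
  set w : XSpace N s ε V W := ofPair hU1 hU1' hU2 hU2' with hw
  have e1 : ∀ n, (z n - w).u =ᵐ[volume] (z n).u - U := fun n =>
    (u_sub _ _).trans (EventuallyEq.rfl.sub (AEEqFun.coeFn_mk U hU1.1.1))
  have e2 : ∀ n, (z n - w).v =ᵐ[volume] (z n).v - U' := fun n =>
    (v_sub _ _).trans (EventuallyEq.rfl.sub (AEEqFun.coeFn_mk U' hU1'.1.1))
  refine ⟨w, tendsto_iff_norm_sub_tendsto_zero.2 ?_⟩
  have h1 := ((hU3.pow 2).add (hU3'.pow 2)).add ((hU4.pow 2).add (hU4'.pow 2))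
  have h2 : Tendsto (fun n => ‖z n - w‖ ^ 2) atTop (𝓝 0) := by
    simp_rw [norm_sq_eq_sum, fun n => eLpNorm_congr_ae (gagQuot_congr (s := s) (e1 n)) (p := 2),
      fun n => eLpNorm_congr_ae (gagQuot_congr (s := s) (e2 n)) (p := 2),
      fun n => eLpNorm_congr_ae (potFun_congr (ε := ε) (V := V) (e1 n)) (p := 2),
      fun n => eLpNorm_congr_ae (potFun_congr (ε := ε) (V := W) (e2 n)) (p := 2)]
    simpa using h1
  have h3 := (Real.continuous_sqrt.tendsto 0).comp h2
  rw [Real.sqrt_zero] at h3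
  refine h3.congr fun n => ?_
  rw [Function.comp, Real.sqrt_sq (norm_nonneg _)]

/-- A pair regarded as one function with values in the plane. -/
noncomputable def pair (z : XSpace N s ε V W) (x : RN N) : ℝ × ℝ := (z.u x, z.v x)

theorem pair_add (z w : XSpace N s ε V W) : (z + w).pair =ᵐ[volume] z.pair + w.pair := by
  filter_upwards [u_add z w, v_add z w] with x h1 h2
  simp only [pair, h1, h2, Pi.add_apply, Prod.mk_add_mk]

theorem pair_smul (c : ℝ) (z : XSpace N s ε V W) : (c • z).pair =ᵐ[volume] c • z.pair := by
  filter_upwards [u_smul c z, v_smul c z] with x h1 h2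
  simp only [pair, h1, h2, Pi.smul_apply, Prod.smul_mk]

theorem memLp_pair_and_le {r : ENNReal} (hr : 1 ≤ r) (z : XSpace N s ε V W)
    (hu : MemLp z.u r volume) (hv : MemLp z.v r volume) :
    MemLp z.pair r volume ∧ (eLpNorm z.pair r volume).toReal
      ≤ (eLpNorm z.u r volume).toReal + (eLpNorm z.v r volume).toReal := by
  have hle : ∀ x, ‖z.pair x‖ ≤ ‖z.u x‖ + ‖z.v x‖ := fun x =>
    max_le (le_add_of_nonneg_right (norm_nonneg _)) (le_add_of_nonneg_left (norm_nonneg _))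
  refine ⟨(hu.norm.add hv.norm).mono' (hu.1.prodMk hv.1) (Eventually.of_forall hle), ?_⟩
  rw [← ENNReal.toReal_add hu.2.ne hv.2.ne]
  refine ENNReal.toReal_mono (ENNReal.add_lt_top.2 ⟨hu.2, hv.2⟩).ne ?_
  refine (eLpNorm_mono_real hle).trans ?_
  refine (eLpNorm_add_le hu.1.norm hv.1.norm hr).trans (le_of_eq ?_)
  rw [eLpNorm_norm, eLpNorm_norm]

/-- The continuous linear map from `X_ε` to a Lebesgue space determined by a norm estimate. -/
noncomputable def embed (r : ENNReal) [Fact (1 ≤ r)] (C : ℝ)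
    (h : ∀ z : XSpace N s ε V W, MemLp z.pair r volume ∧
      (eLpNorm z.pair r volume).toReal ≤ C * ‖z‖) :
    XSpace N s ε V W →L[ℝ] Lp (ℝ × ℝ) r (volume : Measure (RN N)) :=
  LinearMap.mkContinuous
    { toFun := fun z => (h z).1.toLp z.pair
      map_add' := fun z w => by
        rw [← MemLp.toLp_add]
        exact MemLp.toLp_congr _ _ (pair_add z w)
      map_smul' := fun c z => by
        rw [RingHom.id_apply, ← MemLp.toLp_const_smul]
        exact MemLp.toLp_congr _ _ (pair_smul c z) } C fun z => by
      change ‖(h z).1.toLp z.pair‖ ≤ _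
      rw [Lp.norm_toLp]
      exact (h z).2

theorem coeFn_embed (r : ENNReal) [Fact (1 ≤ r)] (C : ℝ)
    (h : ∀ z : XSpace N s ε V W, MemLp z.pair r volume ∧
      (eLpNorm z.pair r volume).toReal ≤ C * ‖z‖) (z : XSpace N s ε V W) :
    embed r C h z =ᵐ[volume] z.pair := (h z).1.coeFn_toLp

theorem pair_two_bound (z : XSpace N s ε V W) : MemLp z.pair 2 volume ∧
    (eLpNorm z.pair 2 volume).toReal ≤ (√(V.inf)⁻¹ + √(W.inf)⁻¹) * ‖z‖ := by
  obtain ⟨h1, h2⟩ := memLp_pair_and_le one_le_two z z.memHs_u.1 z.memHs_v.1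
  refine ⟨h1, h2.trans ?_⟩
  rw [add_mul]
  exact add_le_add z.eLpNorm_u_le z.eLpNorm_v_le

theorem exists_pair_crit_bound (hs : 0 < s) (hN : 2 * s < N) : ∃ C : ℝ, 0 ≤ C ∧
    ∀ z : XSpace N s ε V W, MemLp z.pair (ENNReal.ofReal (critExp N s)) volume ∧
      (eLpNorm z.pair (ENNReal.ofReal (critExp N s)) volume).toReal ≤ C * ‖z‖ := by
  obtain ⟨K, hK, hsob⟩ := exists_sobolev_const hs hN
  have hp2 := critExp_gt_two hs hN
  refine ⟨2 * K, by positivity, fun z => ?_⟩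
  obtain ⟨u1, u2⟩ := hsob z.u z.memHs_u
  obtain ⟨v1, v2⟩ := hsob z.v z.memHs_v
  obtain ⟨h1, h2⟩ := memLp_pair_and_le (by
    rw [← ENNReal.ofReal_one]; exact ENNReal.ofReal_le_ofReal (by linarith)) z u1 v1
  refine ⟨h1, h2.trans ?_⟩
  have hle : ∀ w : RN N → ℝ, MemHs N s w → (eLpNorm (gagQuot N s w) 2 volume).toReal ≤ ‖z‖ →
      eLpNorm w (ENNReal.ofReal (critExp N s)) volume
        ≤ ENNReal.ofReal K * eLpNorm (gagQuot N s w) 2 volume →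
      (eLpNorm w (ENNReal.ofReal (critExp N s)) volume).toReal ≤ K * ‖z‖ := fun w hw hg h => by
    have := ENNReal.toReal_mono (ENNReal.mul_ne_top ENNReal.ofReal_ne_top hw.2.2.ne) h
    rw [ENNReal.toReal_mul, ENNReal.toReal_ofReal hK.le] at this
    exact this.trans (by gcongr)
  have := hle z.u z.memHs_u z.gag_u_le u2
  have := hle z.v z.memHs_v z.gag_v_le v2
  linarith

theorem eLpNorm_toReal_rpow {Ω F : Type*} [MeasurableSpace Ω] [NormedAddCommGroup F]
    {μ : Measure Ω} {f : Ω → F} {p : ℝ} (hp : 1 < p) (hf : MemLp f (ENNReal.ofReal p) μ) :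
    (eLpNorm f (ENNReal.ofReal p) μ).toReal ^ p = ∫ x, ‖f x‖ ^ p ∂μ := by
  have h0 : ENNReal.ofReal p ≠ 0 := by simpa using by linarith
  have hI : 0 ≤ ∫ x, ‖f x‖ ^ p ∂μ := integral_nonneg fun _ => by positivity
  rw [hf.eLpNorm_eq_integral_rpow_norm h0 ENNReal.ofReal_ne_top,
    ENNReal.toReal_ofReal (by linarith : 0 ≤ p), ENNReal.toReal_ofReal (by positivity),
    ← Real.rpow_mul hI, inv_mul_cancel₀ (by linarith), Real.rpow_one]

/-- The embedding of `X_ε` into the intermediate Lebesgue spaces. -/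
theorem exists_pair_bound (hs : 0 < s) (hN : 2 * s < N) {q : ℝ} (hq : 2 < q)
    (hqp : q < critExp N s) : ∃ C : ℝ, 0 ≤ C ∧
    ∀ z : XSpace N s ε V W, MemLp z.pair (ENNReal.ofReal q) volume ∧
      (eLpNorm z.pair (ENNReal.ofReal q) volume).toReal ≤ C * ‖z‖ := by
  obtain ⟨C, hC, hpair⟩ := exists_pair_crit_bound (ε := ε) (V := V) (W := W) hs hN
  set p := critExp N s with hp
  set C2 : ℝ := √(V.inf)⁻¹ + √(W.inf)⁻¹ with hC2
  have hC20 : 0 ≤ C2 := by positivity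
  obtain ⟨K, hK, hint⟩ := exists_interpolation_const hq.le hqp one_pos
  have hq0 : ENNReal.ofReal q ≠ 0 := by simpa using by linarith
  have hmem : ∀ z : XSpace N s ε V W, MemLp z.pair (ENNReal.ofReal q) volume := fun z => by
    have h2 := (pair_two_bound z).1
    have hm := h2.1
    rw [← integrable_norm_rpow_iff hm hq0 ENNReal.ofReal_ne_top, ENNReal.toReal_ofReal (by linarith)]
    refine ((h2.norm.integrable_sq.const_mul K).add
      ((integrable_norm_rpow_ofReal (by linarith) (hpair z).1).const_mul 1)).mono'
      (hm.norm.aemeasurable.pow_const _).aestronglyMeasurable (Eventually.of_forall fun x => ?_)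
    rw [Real.norm_of_nonneg (by positivity)]
    exact hint _ (norm_nonneg _)
  refine ⟨(K * C2 ^ 2 + C ^ p) ^ q⁻¹, by positivity, fun z => ⟨hmem z, ?_⟩⟩
  set l := ‖z‖ with hl
  rcases (norm_nonneg z).eq_or_lt with h0 | hl0
  · have hz : (eLpNorm z.pair (ENNReal.ofReal p) volume).toReal ≤ 0 := by
      have := (hpair z).2
      rwa [← h0, mul_zero] at this
    have hz' := le_antisymm hz ENNReal.toReal_nonneg
    rw [ENNReal.toReal_eq_zero_iff, or_iff_left (hpair z).1.2.ne,
      eLpNorm_eq_zero_iff (hpair z).1.1 (by simpa using by linarith)] at hz'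
    rw [eLpNorm_congr_ae hz', eLpNorm_zero]
    simp only [ENNReal.toReal_zero]
    positivity
  rw [← hl] at hl0
  have i2 := (pair_two_bound z).1.norm.integrable_sq
  have ip := integrable_norm_rpow_ofReal (by linarith) (hpair z).1
  have iq := integrable_norm_rpow_ofReal (by linarith) (hmem z)
  have hI : ∫ x, ‖z.pair x‖ ^ q ≤ l ^ q * (K * C2 ^ 2 + C ^ p) := by
    have hpt : ∀ x, ‖z.pair x‖ ^ q
        ≤ l ^ q * (K * (l ^ 2)⁻¹) * ‖z.pair x‖ ^ 2 + l ^ q * (l ^ p)⁻¹ * ‖z.pair x‖ ^ p := fun x => by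
      have := hint (‖z.pair x‖ / l) (by positivity)
      rw [Real.div_rpow (norm_nonneg _) hl0.le, Real.div_rpow (norm_nonneg _) hl0.le, div_pow,
        div_le_iff₀ (by positivity)] at this
      refine this.trans (le_of_eq ?_)
      field_simp
    have e1 := integral_mono iq ((i2.const_mul (l ^ q * (K * (l ^ 2)⁻¹))).add
      (ip.const_mul (l ^ q * (l ^ p)⁻¹))) hpt
    have e2 : ∫ x, (l ^ q * (K * (l ^ 2)⁻¹) * ‖z.pair x‖ ^ 2 + l ^ q * (l ^ p)⁻¹ * ‖z.pair x‖ ^ p)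
        = l ^ q * (K * (l ^ 2)⁻¹) * (∫ x, ‖z.pair x‖ ^ 2)
          + l ^ q * (l ^ p)⁻¹ * ∫ x, ‖z.pair x‖ ^ p := by
      rw [integral_add (i2.const_mul _) (ip.const_mul _), integral_const_mul, integral_const_mul]
    have e3 : ∫ x, ‖z.pair x‖ ^ 2 ≤ (C2 * l) ^ 2 := by
      rw [integral_sq_eq_eLpNorm (pair_two_bound z).1.1.norm, eLpNorm_norm]
      have := (pair_two_bound z).2
      gcongr
    have e4 : ∫ x, ‖z.pair x‖ ^ p ≤ (C * l) ^ p := by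
      rw [← eLpNorm_toReal_rpow (by linarith) (hpair z).1]
      have := (hpair z).2
      gcongr
      linarith
    refine e1.trans (le_trans (le_of_eq e2) ?_)
    calc _ ≤ l ^ q * (K * (l ^ 2)⁻¹) * (C2 * l) ^ 2 + l ^ q * (l ^ p)⁻¹ * (C * l) ^ p := by gcongr
      _ = _ := by
        rw [Real.mul_rpow hC hl0.le]
        field_simp
  rw [← eLpNorm_toReal_rpow (by linarith) (hmem z)] at hI
  have := Real.rpow_le_rpow (by positivity) hI (inv_nonneg.2 (by linarith : 0 ≤ q))
  rw [Real.rpow_rpow_inv ENNReal.toReal_nonneg (by linarith),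
    Real.mul_rpow (by positivity) (by positivity), Real.rpow_rpow_inv hl0.le (by linarith)] at this
  linarith

end XSpace

/-! ### The Nehari manifold of a functional with two homogeneous nonlinear terms -/

section Nehari

variable {E : Type*} [NormedAddCommGroup E] [InnerProductSpace ℝ E]

/-- A nonnegative functional that is positively homogeneous of degree `q` and Lipschitz on bounded
sets. -/
structure HomFunctional (q : ℝ) (A : E → ℝ) : Prop where
  nonneg : ∀ z, 0 ≤ A z
  hom : ∀ c : ℝ, 0 < c → ∀ z, A (c • z) = c ^ q * A z
  lip : ∀ M : ℝ, 0 ≤ M → ∃ L : ℝ, 0 ≤ L ∧ ∀ z w, ‖z‖ ≤ M → ‖w‖ ≤ M → |A z - A w| ≤ L * ‖z - w‖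

/-- The functional `½ ‖z‖² - A(z) - B(z) / p`. -/
noncomputable def energy (p : ℝ) (A B : E → ℝ) (z : E) : ℝ := 1 / 2 * ‖z‖ ^ 2 - (A z + 1 / p * B z)

variable {p q : ℝ} {A B : E → ℝ}

theorem HomFunctional.exists_le_rpow (hA : HomFunctional q A) (hq : 1 < q) :
    ∃ C : ℝ, 0 ≤ C ∧ ∀ z, A z ≤ C * ‖z‖ ^ q := by
  have h0 : A 0 = 0 := by
    have h1 := hA.hom 2 two_pos 0
    rw [smul_zero] at h1
    have h2 : (1:ℝ) < 2 ^ q := Real.one_lt_rpow one_lt_two (by linarith)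
    have h3 : (2 ^ q - 1) * A 0 = 0 := by linarith
    exact (mul_eq_zero.1 h3).resolve_left (by linarith)
  obtain ⟨L, hL, hl⟩ := hA.lip 1 zero_le_one
  refine ⟨L, hL, fun z => ?_⟩
  rcases eq_or_ne z 0 with rfl | hz
  · rw [h0]; positivity
  have hn : 0 < ‖z‖ := norm_pos_iff.2 hz
  have hu : ‖‖z‖⁻¹ • z‖ = 1 := norm_smul_inv_norm (𝕜 := ℝ) hz
  have h1 := hl (‖z‖⁻¹ • z) 0 hu.le (by simp)
  rw [h0, sub_zero, sub_zero, hu, mul_one] at h1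
  have h2 : A z = ‖z‖ ^ q * A (‖z‖⁻¹ • z) := by
    rw [← hA.hom _ hn, smul_smul, mul_inv_cancel₀ hn.ne', one_smul]
  rw [h2, mul_comm]
  gcongr
  exact (le_abs_self _).trans h1

theorem hasLineDerivAt_self_of_expansion {f : E → ℝ} {z : E} {a b c : ℝ}
    (h : ∀ t : ℝ, 0 < t → f (t • z) = a * t ^ 2 + b * t ^ q + c * t ^ p) :
    HasLineDerivAt ℝ f (2 * a + q * b + p * c) z z := by
  have h2 : HasDerivAt (fun t : ℝ => a * t ^ 2 + b * t ^ q + c * t ^ p)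
      (2 * a + q * b + p * c) 1 := by
    have d1 := (hasDerivAt_pow 2 (1:ℝ)).const_mul a
    have d2 := (Real.hasDerivAt_rpow_const (x := 1) (p := q) (Or.inl one_ne_zero)).const_mul b
    have d3 := (Real.hasDerivAt_rpow_const (x := 1) (p := p) (Or.inl one_ne_zero)).const_mul c
    refine ((d1.add d2).add d3).congr_deriv ?_
    simp only [Real.one_rpow, one_pow]
    push_cast
    ring
  have h3 : HasDerivAt (fun t : ℝ => a * (1 + t) ^ 2 + b * (1 + t) ^ q + c * (1 + t) ^ p)
      (2 * a + q * b + p * c) 0 :=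
    HasDerivAt.comp_const_add (f := fun t : ℝ => a * t ^ 2 + b * t ^ q + c * t ^ p) 1 0
      (by simpa using h2)
  refine h3.congr_of_eventuallyEq ?_
  filter_upwards [Ioi_mem_nhds (show (-1:ℝ) < 0 by norm_num)] with t ht
  have ht' : 0 < 1 + t := by have : -1 < t := ht; linarith
  rw [← h (1 + t) ht', add_smul, one_smul]

/-- The derivative of the energy at `z` in the direction `z`. -/
theorem nehariFun_energy (hp : p ≠ 0) (hA : HomFunctional q A) (hB : HomFunctional p B) :
    nehariFun (energy p A B) = fun z => ‖z‖ ^ 2 - q * A z - B z := by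
  funext z
  have h := hasLineDerivAt_self_of_expansion (f := energy p A B) (z := z) (q := q) (p := p)
    (a := 1 / 2 * ‖z‖ ^ 2) (b := -A z) (c := -(1 / p * B z)) fun t ht => by
      rw [energy, hA.hom t ht, hB.hom t ht, norm_smul, Real.norm_of_nonneg ht.le]
      ring
  rw [nehariFun, h.lineDeriv]
  field_simp
  ring

theorem nehari_identity (hp : p ≠ 0) (hA : HomFunctional q A) (hB : HomFunctional p B) {z : E}
    (hz : z ∈ nehari (energy p A B)) : ‖z‖ ^ 2 = q * A z + B z := by
  have := hz.2
  rw [nehariFun_energy hp hA hB] at this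
  simp only at this
  linarith

/-- On the Nehari manifold the constraint is strictly decreasing in the radial direction. -/
theorem fderiv_nehariFun_self_le (hq : 2 < q) (hqp : q < p) (hA : HomFunctional q A)
    (hB : HomFunctional p B) {z : E} (hz : z ∈ nehari (energy p A B))
    (hd : DifferentiableAt ℝ (nehariFun (energy p A B)) z) :
    fderiv ℝ (nehariFun (energy p A B)) z z ≤ -((q - 2) * ‖z‖ ^ 2) := by
  have hp : p ≠ 0 := by linarith
  have h := hasLineDerivAt_self_of_expansion (f := nehariFun (energy p A B)) (z := z) (q := q)
    (p := p) (a := ‖z‖ ^ 2) (b := -(q * A z)) (c := -B z) fun t ht => by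
      rw [nehariFun_energy hp hA hB]
      simp only
      rw [hA.hom t ht, hB.hom t ht, norm_smul, Real.norm_of_nonneg ht.le]
      ring
  rw [← hd.lineDeriv_eq_fderiv, h.lineDeriv, nehari_identity hp hA hB hz]
  nlinarith [hB.nonneg z, hA.nonneg z]

/-- On the Nehari manifold the full derivative is controlled by the constrained one: every vector
differs from a tangent vector by a multiple of `z`, on which the derivative vanishes. -/
theorem abs_fderiv_energy_le (hq : 2 < q) (hqp : q < p) (hA : HomFunctional q A)
    (hB : HomFunctional p B) {z : E} (hz : z ∈ nehari (energy p A B))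
    (hd : DifferentiableAt ℝ (energy p A B) z) {L : ℝ} (hL0 : 0 ≤ L)
    (hL : ‖fderiv ℝ (nehariFun (energy p A B)) z‖ ≤ L) (w : E) :
    |fderiv ℝ (energy p A B) z w| ≤
      ‖constrainedDeriv (energy p A B) z‖ * (‖w‖ + L * ‖w‖ / ((q - 2) * ‖z‖ ^ 2) * ‖z‖) := by
  set J := energy p A B
  have hzn : 0 < ‖z‖ := norm_pos_iff.2 hz.1
  have hker : ∀ y : E, fderiv ℝ (nehariFun J) z y = 0 →
      |fderiv ℝ J z y| ≤ ‖constrainedDeriv J z‖ * ‖y‖ := fun y hy =>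
    (constrainedDeriv J z).le_opNorm ⟨y, hy⟩
  have hJz : fderiv ℝ J z z = 0 := by
    rw [← hd.lineDeriv_eq_fderiv]; exact hz.2
  have hq2 : 0 < (q - 2) * ‖z‖ ^ 2 := mul_pos (by linarith) (by positivity)
  by_cases hI : DifferentiableAt ℝ (nehariFun J) z
  · have hneg := fderiv_nehariFun_self_le hq hqp hA hB hz hI
    set D := fderiv ℝ (nehariFun J) z with hD
    have hDz : D z < 0 := by linarith
    set c := D w / D z with hc
    have h1 : D (w - c • z) = 0 := by
      rw [map_sub, map_smul, smul_eq_mul, hc, div_mul_cancel₀ _ hDz.ne, sub_self]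
    have h2 := hker _ h1
    rw [map_sub, map_smul, hJz, smul_zero, sub_zero] at h2
    refine h2.trans ?_
    have hcb : |c| ≤ L * ‖w‖ / ((q - 2) * ‖z‖ ^ 2) := by
      rw [hc, abs_div]
      have e1 : |D w| ≤ L * ‖w‖ := (D.le_opNorm w).trans (by gcongr)
      have e2 : (q - 2) * ‖z‖ ^ 2 ≤ |D z| := by
        rw [abs_of_neg hDz]; linarith
      gcongr
    gcongr
    refine (norm_sub_le _ _).trans ?_
    rw [norm_smul, Real.norm_eq_abs]
    gcongr
  · have h0 : fderiv ℝ (nehariFun J) z = 0 := fderiv_zero_of_not_differentiableAt hI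
    refine (hker w (by rw [h0]; rfl)).trans ?_
    gcongr
    exact le_add_of_nonneg_right (by positivity)

/-- The Nehari manifold is a natural constraint. -/
theorem isCritical_of_isConstrainedCritical (hq : 2 < q) (hqp : q < p) (hA : HomFunctional q A)
    (hB : HomFunctional p B) {z : E} (hz : IsConstrainedCritical (energy p A B) z) :
    IsCritical (energy p A B) z := by
  obtain ⟨h1, h2, h3⟩ := hz
  have h4 : fderiv ℝ (energy p A B) z = 0 := by
    refine ContinuousLinearMap.ext fun w => ?_
    have := abs_fderiv_energy_le hq hqp hA hB h1 h2 (norm_nonneg _) le_rfl w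
    have h0 : ‖constrainedDeriv (energy p A B) z‖ = 0 := by
      rw [h3]; exact ContinuousLinearMap.opNorm_zero
    rw [h0, zero_mul] at this
    exact abs_nonpos_iff.1 this
  have h5 := h2.hasFDerivAt
  rwa [h4] at h5

/-- The Nehari manifold stays away from the origin. -/
theorem exists_nehari_lower_bound (hq : 2 < q) (hqp : q < p) (hA : HomFunctional q A)
    (hB : HomFunctional p B) : ∃ ρ : ℝ, 0 < ρ ∧ ∀ z ∈ nehari (energy p A B), ρ ≤ ‖z‖ := by
  obtain ⟨C1, hC1, h1⟩ := hA.exists_le_rpow (by linarith)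
  obtain ⟨C2, hC2, h2⟩ := hB.exists_le_rpow (by linarith)
  set c : ℝ := q * C1 + C2 + 1 with hc
  have hc0 : 0 < c := by positivity
  refine ⟨min 1 ((c⁻¹) ^ (q - 2)⁻¹), by positivity, fun z hz => ?_⟩
  by_contra! hlt
  obtain ⟨hlt1, hlt2⟩ := lt_min_iff.1 hlt
  have hzn : 0 < ‖z‖ := norm_pos_iff.2 hz.1
  have hid := nehari_identity (by linarith) hA hB hz
  have e1 : ‖z‖ ^ p ≤ ‖z‖ ^ q := Real.rpow_le_rpow_of_exponent_ge hzn hlt1.le hqp.le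
  have e2 : ‖z‖ ^ 2 < c * ‖z‖ ^ q := by
    have a1 := h1 z
    have a2 := h2 z
    have a3 := Real.rpow_pos_of_pos hzn q
    calc ‖z‖ ^ 2 = q * A z + B z := hid
      _ ≤ q * (C1 * ‖z‖ ^ q) + C2 * ‖z‖ ^ q := by
        refine add_le_add (by gcongr) (a2.trans (by gcongr))
      _ < c * ‖z‖ ^ q := by rw [hc]; linarith
  have e3 : ‖z‖ ^ q = ‖z‖ ^ 2 * ‖z‖ ^ (q - 2) := by
    rw [← Real.rpow_two, ← Real.rpow_add hzn]; congr 1; ring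
  have e4 : ‖z‖ ^ (q - 2) < c⁻¹ := by
    have := Real.rpow_lt_rpow hzn.le hlt2 (by linarith : 0 < q - 2)
    rwa [Real.rpow_inv_rpow (by positivity) (by linarith)] at this
  have e5 : c * ‖z‖ ^ q < ‖z‖ ^ 2 := by
    rw [e3]
    calc c * (‖z‖ ^ 2 * ‖z‖ ^ (q - 2)) < c * (‖z‖ ^ 2 * c⁻¹) := by gcongr
      _ = ‖z‖ ^ 2 := by field_simp
  linarith

theorem energy_ge_of_nehari (hq : 2 < q) (hqp : q < p) (hA : HomFunctional q A)
    (hB : HomFunctional p B) {z : E} (hz : z ∈ nehari (energy p A B)) :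
    (1 / 2 - 1 / q) * ‖z‖ ^ 2 ≤ energy p A B z := by
  have hid := nehari_identity (by linarith) hA hB hz
  have e1 : 1 / p ≤ 1 / q := one_div_le_one_div_of_le (by linarith) hqp.le
  have e2 : A z + 1 / q * B z = 1 / q * ‖z‖ ^ 2 := by
    rw [hid]
    have : q ≠ 0 := by linarith
    field_simp
  have := mul_le_mul_of_nonneg_right e1 (hB.nonneg z)
  rw [energy]
  linarith

/-- The constraint has derivatives bounded on bounded sets, with the junk value zero where it is not
differentiable. -/
theorem exists_norm_fderiv_nehariFun_le (hp : p ≠ 0) (hA : HomFunctional q A)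
    (hB : HomFunctional p B) {M : ℝ} (hM : 0 ≤ M) :
    ∃ L : ℝ, 0 ≤ L ∧ ∀ z, ‖z‖ ≤ M → ‖fderiv ℝ (nehariFun (energy p A B)) z‖ ≤ L := by
  obtain ⟨L1, hL1, h1⟩ := hA.lip (M + 1) (by linarith)
  obtain ⟨L2, hL2, h2⟩ := hB.lip (M + 1) (by linarith)
  refine ⟨2 * (M + 1) + |q| * L1 + L2, by positivity, fun z hz => ?_⟩
  rw [nehariFun_energy hp hA hB]
  refine norm_fderiv_le_of_lip' ℝ (by positivity) ?_
  filter_upwards [Metric.ball_mem_nhds z one_pos] with w hw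
  have hw1 : ‖w‖ ≤ M + 1 := by
    have h3 : ‖w - z‖ < 1 := by rwa [← dist_eq_norm]
    have := norm_le_norm_add_norm_sub' w z
    linarith
  have hz1 : ‖z‖ ≤ M + 1 := by linarith
  have e0 : |‖w‖ ^ 2 - ‖z‖ ^ 2| ≤ 2 * (M + 1) * ‖w - z‖ := by
    rw [sq_sub_sq, abs_mul, abs_of_nonneg (by positivity)]
    have := abs_norm_sub_norm_le w z
    gcongr
    linarith
  have e1 := h1 w z hw1 hz1
  have e2 := h2 w z hw1 hz1
  have hid : ‖w‖ ^ 2 - q * A w - B w - (‖z‖ ^ 2 - q * A z - B z)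
      = (‖w‖ ^ 2 - ‖z‖ ^ 2) - q * (A w - A z) - (B w - B z) := by ring
  rw [hid, Real.norm_eq_abs]
  calc _ ≤ |‖w‖ ^ 2 - ‖z‖ ^ 2| + |q * (A w - A z)| + |B w - B z| :=
        (abs_sub _ _).trans (add_le_add (abs_sub _ _) le_rfl)
    _ ≤ 2 * (M + 1) * ‖w - z‖ + |q| * (L1 * ‖w - z‖) + L2 * ‖w - z‖ := by
        rw [abs_mul q]
        gcongr
    _ = _ := by ring

/-- Along a constrained Palais–Smale sequence the full derivative, applied to a fixed vector, tends
to zero. -/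
theorem tendsto_fderiv_energy_apply (hq : 2 < q) (hqp : q < p) (hA : HomFunctional q A)
    (hB : HomFunctional p B) {z : ℕ → E} {M : ℝ} (hz : ∀ n, z n ∈ nehari (energy p A B))
    (hd : ∀ n, DifferentiableAt ℝ (energy p A B) (z n)) (hM : ∀ n, ‖z n‖ ≤ M)
    (hc : Tendsto (fun n => ‖constrainedDeriv (energy p A B) (z n)‖) atTop (𝓝 0)) (w : E) :
    Tendsto (fun n => fderiv ℝ (energy p A B) (z n) w) atTop (𝓝 0) := by
  have hM0 : 0 ≤ M := (norm_nonneg _).trans (hM 0)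
  obtain ⟨L, hL0, hL⟩ := exists_norm_fderiv_nehariFun_le (by linarith : p ≠ 0) hA hB hM0
  obtain ⟨ρ, hρ, hlow⟩ := exists_nehari_lower_bound hq hqp hA hB
  have hq2 : 0 < q - 2 := by linarith
  have h1 := hc.mul_const (‖w‖ + L * ‖w‖ / ((q - 2) * ρ ^ 2) * M)
  rw [zero_mul] at h1
  refine squeeze_zero_norm (fun n => ?_) h1
  refine (abs_fderiv_energy_le hq hqp hA hB (hz n) (hd n) hL0 (hL _ (hM n)) w).trans ?_
  have := hlow _ (hz n)
  have := hM n
  gcongr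

end Nehari

/-! ### Integral functionals and compactness on the space of pairs -/

namespace XSpace

variable {N : ℕ} {s ε : ℝ} {V W : Potential N} {F : ℝ × ℝ → ℝ} {r C : ℝ}

theorem integral_rpow_pair_le (hr : 1 < r) {z : XSpace N s ε V W}
    (hb : MemLp z.pair (ENNReal.ofReal r) volume ∧
      (eLpNorm z.pair (ENNReal.ofReal r) volume).toReal ≤ C * ‖z‖) {M : ℝ} (hC : 0 ≤ C)
    (hz : ‖z‖ ≤ M) : ∫ x, ‖z.pair x‖ ^ r ≤ (C * M) ^ r := by
  rw [← eLpNorm_toReal_rpow hr hb.1]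
  have := hb.2
  gcongr
  exact this.trans (by gcongr)

theorem homFunctional_integral (hr : 1 < r) (hF : HomLip r F) (h0 : ∀ x, 0 ≤ F x)
    (hb : ∀ z : XSpace N s ε V W, MemLp z.pair (ENNReal.ofReal r) volume ∧
      (eLpNorm z.pair (ENNReal.ofReal r) volume).toReal ≤ C * ‖z‖) :
    HomFunctional r (fun z : XSpace N s ε V W => ∫ x, F (z.pair x)) where
  nonneg z := integral_nonneg fun x => h0 _
  hom c hc z := by
    rw [← integral_const_mul]
    refine integral_congr_ae ?_
    filter_upwards [pair_smul c z] with x hx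
    rw [hx, Pi.smul_apply, hF.hom c hc]
  lip M hM := by
    have : Fact (1 ≤ ENNReal.ofReal r) := ⟨by
      rw [← ENNReal.ofReal_one]; exact ENNReal.ofReal_le_ofReal hr.le⟩
    set T := embed (ENNReal.ofReal r) C hb
    obtain ⟨L, hL, hl⟩ := hF.exists_lipschitz_const (μ := (volume : Measure (RN N))) hr
      (mul_nonneg (norm_nonneg T) hM)
    refine ⟨L * ‖T‖, by positivity, fun z w hz hw => ?_⟩
    have e : ∀ z : XSpace N s ε V W, ∫ x, F (z.pair x) = ∫ x, F (T z x) := fun z => by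
      refine integral_congr_ae ?_
      filter_upwards [coeFn_embed (ENNReal.ofReal r) C hb z] with x hx
      rw [hx]
    rw [e, e]
    refine (hl (T z) (T w) ((T.le_opNorm z).trans (by gcongr))
      ((T.le_opNorm w).trans (by gcongr))).trans ?_
    rw [← map_sub, mul_assoc]
    gcongr
    exact T.le_opNorm _

theorem contDiff_integral (hr : 1 < r) {F' : ℝ × ℝ → ℝ × ℝ →L[ℝ] ℝ}
    (hF : HasPowerGrowthDeriv r F F') (hom : ∀ t : ℝ, 0 < t → ∀ x, F (t • x) = t ^ r * F x)
    (hb : ∀ z : XSpace N s ε V W, MemLp z.pair (ENNReal.ofReal r) volume ∧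
      (eLpNorm z.pair (ENNReal.ofReal r) volume).toReal ≤ C * ‖z‖) :
    ContDiff ℝ 1 (fun z : XSpace N s ε V W => ∫ x, F (z.pair x)) := by
  have : Fact (1 ≤ ENNReal.ofReal r) := ⟨by
    rw [← ENNReal.ofReal_one]; exact ENNReal.ofReal_le_ofReal hr.le⟩
  have h1 := (hF.contDiff_integral (μ := (volume : Measure (RN N))) hom hr).comp
    (embed (ENNReal.ofReal r) C hb).contDiff
  convert h1 using 1
  funext z
  refine integral_congr_ae ?_
  filter_upwards [coeFn_embed (ENNReal.ofReal r) C hb z] with x hx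
  rw [hx]

/-- The linear functionals `z ↦ ∫_B u` and `z ↦ ∫_B v`. -/
theorem exists_average_functional (x : RN N) (r : ℝ) :
    ∃ f g : XSpace N s ε V W →L[ℝ] ℝ, (∀ z, f z = ∫ y in Metric.ball x r, z.u y) ∧
      ∀ z, g z = ∫ y in Metric.ball x r, z.v y := by
  have : Fact ((1:ENNReal) ≤ 2) := ⟨one_le_two⟩
  set T := embed (N := N) (s := s) (ε := ε) (V := V) (W := W) 2 _ pair_two_bound with hT
  have hB : MeasurableSet (Metric.ball x r) := measurableSet_ball
  have hv : volume (Metric.ball x r) ≠ ⊤ := measure_ball_lt_top.ne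
  set I : Lp ℝ 2 (volume : Measure (RN N)) := indicatorConstLp 2 hB hv (1:ℝ)
  refine ⟨(innerSL ℝ I).comp (((ContinuousLinearMap.fst ℝ ℝ ℝ).compLpL 2 volume).comp T),
    (innerSL ℝ I).comp (((ContinuousLinearMap.snd ℝ ℝ ℝ).compLpL 2 volume).comp T),
    fun z => ?_, fun z => ?_⟩
  · simp only [ContinuousLinearMap.comp_apply, innerSL_apply_apply]
    rw [L2.inner_indicatorConstLp_one hB hv]
    refine integral_congr_ae (ae_restrict_of_ae ?_)
    filter_upwards [(ContinuousLinearMap.fst ℝ ℝ ℝ).coeFn_compLpL (T z),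
      coeFn_embed 2 _ pair_two_bound z] with y h1 h2
    rw [h1, h2]
    rfl
  · simp only [ContinuousLinearMap.comp_apply, innerSL_apply_apply]
    rw [L2.inner_indicatorConstLp_one hB hv]
    refine integral_congr_ae (ae_restrict_of_ae ?_)
    filter_upwards [(ContinuousLinearMap.snd ℝ ℝ ℝ).coeFn_compLpL (T z),
      coeFn_embed 2 _ pair_two_bound z] with y h1 h2
    rw [h1, h2]
    rfl

/-- A bounded sequence of `X_ε` has a subsequence that, up to its weak limit, tends to zero weakly,
in `L²_loc`, and almost everywhere. -/
theorem exists_weak_subseq (hs : 0 < s) {z : ℕ → XSpace N s ε V W} {M : ℝ} (hM : ∀ n, ‖z n‖ ≤ M) :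
    ∃ (z0 : XSpace N s ε V W) (φ : ℕ → ℕ), StrictMono φ ∧
      (∀ f : XSpace N s ε V W →L[ℝ] ℝ, Tendsto (fun k => f (z (φ k) - z0)) atTop (𝓝 0)) ∧
      (∀ R : ℝ, Tendsto (fun k => ∫ x in Metric.ball (0 : RN N) R, (z (φ k) - z0).u x ^ 2)
        atTop (𝓝 0)) ∧
      (∀ R : ℝ, Tendsto (fun k => ∫ x in Metric.ball (0 : RN N) R, (z (φ k) - z0).v x ^ 2)
        atTop (𝓝 0)) ∧
      ∀ᵐ x, Tendsto (fun k => (z (φ k) - z0).pair x) atTop (𝓝 0) := by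
  obtain ⟨z0, φ, hφ, hw⟩ := exists_weakly_convergent_subseq hM
  have hw0 : ∀ f : XSpace N s ε V W →L[ℝ] ℝ,
      Tendsto (fun k => f (z (φ k) - z0)) atTop (𝓝 0) := fun f => by
    have := (hw f).sub_const (f z0)
    rw [sub_self] at this
    exact this.congr fun k => (map_sub f _ _).symm
  set M' : ℝ := M + ‖z0‖
  have hM' : ∀ k, ‖z (φ k) - z0‖ ≤ M' := fun k =>
    (norm_sub_le _ _).trans (add_le_add (hM _) le_rfl)
  have hM'0 : 0 ≤ M' := (norm_nonneg _).trans (hM' 0)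
  set Mu := max M' (√(V.inf)⁻¹ * M')
  set Mv := max M' (√(W.inf)⁻¹ * M')
  have gu : ∀ k, (eLpNorm (gagQuot N s (z (φ k) - z0).u) 2 volume).toReal ≤ Mu := fun k =>
    ((gag_u_le _).trans (hM' k)).trans (le_max_left _ _)
  have gv : ∀ k, (eLpNorm (gagQuot N s (z (φ k) - z0).v) 2 volume).toReal ≤ Mv := fun k =>
    ((gag_v_le _).trans (hM' k)).trans (le_max_left _ _)
  have lu : ∀ k, (eLpNorm (z (φ k) - z0).u 2 volume).toReal ≤ Mu := fun k =>
    ((eLpNorm_u_le _).trans (by gcongr; exact hM' k)).trans (le_max_right _ _)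
  have lv : ∀ k, (eLpNorm (z (φ k) - z0).v 2 volume).toReal ≤ Mv := fun k =>
    ((eLpNorm_v_le _).trans (by gcongr; exact hM' k)).trans (le_max_right _ _)
  have locu := tendsto_integral_ball_sq hs (fun k => (z (φ k) - z0).memHs_u) gu lu fun x r _ => by
    obtain ⟨f, -, hf, -⟩ := exists_average_functional (s := s) (ε := ε) (V := V) (W := W) x r
    simpa only [hf] using hw0 f
  have locv := tendsto_integral_ball_sq hs (fun k => (z (φ k) - z0).memHs_v) gv lv fun x r _ => by
    obtain ⟨-, g, -, hg⟩ := exists_average_functional (s := s) (ε := ε) (V := V) (W := W) x r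
    simpa only [hg] using hw0 g
  obtain ⟨ψ, hψ, hae⟩ := exists_subseq_tendsto_ae_zero (fun k => (z (φ k) - z0).memHs_u.1) lu locu
  obtain ⟨χ, hχ, hae'⟩ := exists_subseq_tendsto_ae_zero
    (fun k => (z (φ (ψ k)) - z0).memHs_v.1) (fun k => lv (ψ k))
    (fun R => (locv R).comp hψ.tendsto_atTop)
  have ht := (hψ.comp hχ).tendsto_atTop
  refine ⟨z0, φ ∘ ψ ∘ χ, hφ.comp (hψ.comp hχ), fun f => (hw0 f).comp ht,
    fun R => (locu R).comp ht, fun R => (locv R).comp ht, ?_⟩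
  filter_upwards [hae, hae'] with x h1 h2
  exact (h1.comp hχ.tendsto_atTop).prodMk_nhds h2

section Limits

variable {w : ℕ → XSpace N s ε V W} {z0 : XSpace N s ε V W} {M : ℝ}

/-- The Brezis–Lieb splitting along a sequence that tends to zero almost everywhere. -/
theorem tendsto_integral_split (hr : 1 < r) (hF : HomLip r F) (hC : 0 ≤ C)
    (hb : ∀ z : XSpace N s ε V W, MemLp z.pair (ENNReal.ofReal r) volume ∧
      (eLpNorm z.pair (ENNReal.ofReal r) volume).toReal ≤ C * ‖z‖)
    (hM : ∀ k, ‖w k‖ ≤ M) (hae : ∀ᵐ x, Tendsto (fun k => (w k).pair x) atTop (𝓝 0)) :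
    Tendsto (fun k => (∫ x, F ((w k + z0).pair x)) - ∫ x, F ((w k).pair x)) atTop
      (𝓝 (∫ x, F (z0.pair x))) := by
  refine (hF.tendsto_integral_add hr (fun k => (hb (w k)).1) (hb z0).1
    (fun k => integral_rpow_pair_le hr (hb (w k)) hC (hM k)) hae).congr fun k => ?_
  congr 1
  refine integral_congr_ae ?_
  filter_upwards [pair_add (w k) z0] with x hx
  rw [hx, Pi.add_apply]

theorem tendsto_integral_slope (hr : 1 < r) (hF : HomLip r F) (hC : 0 ≤ C)
    (hb : ∀ z : XSpace N s ε V W, MemLp z.pair (ENNReal.ofReal r) volume ∧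
      (eLpNorm z.pair (ENNReal.ofReal r) volume).toReal ≤ C * ‖z‖)
    (hM : ∀ k, ‖w k‖ ≤ M) (hae : ∀ᵐ x, Tendsto (fun k => (w k).pair x) atTop (𝓝 0))
    {t : ℕ → ℝ} (ht0 : ∀ n, 0 < t n) (ht1 : ∀ n, t n ≤ 1) (ht : Tendsto t atTop (𝓝 0)) :
    Tendsto (fun k => ((∫ x, F ((w k + z0 + t k • z0).pair x))
      - ∫ x, F ((w k + z0).pair x)) / t k) atTop (𝓝 (r * ∫ x, F (z0.pair x))) := by
  refine (hF.tendsto_integral_slope hr (fun k => (hb (w k)).1) (hb z0).1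
    (fun k => integral_rpow_pair_le hr (hb (w k)) hC (hM k)) hae ht0 ht1 ht).congr fun k => ?_
  congr 2
  · refine integral_congr_ae ?_
    filter_upwards [pair_add (w k) z0, pair_add (w k + z0) (t k • z0), pair_smul (t k) z0]
      with x h1 h2 h3
    rw [h2, Pi.add_apply, h1, h3, Pi.add_apply, Pi.smul_apply]
  · refine integral_congr_ae ?_
    filter_upwards [pair_add (w k) z0] with x hx
    rw [hx, Pi.add_apply]

end Limits

end XSpace

/-! ### Potentials at infinity -/

section PotentialAtInfinity

variable {N : ℕ} {ε : ℝ} {V : Potential N} {w : ℕ → RN N → ℝ} {M : ℝ}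

theorem Potential.exists_radius_le (hε : 0 < ε) {r : ℝ} (hr : (r : EReal) < V.atInfty) :
    ∃ R : ℝ, ∀ x : RN N, R ≤ ‖x‖ → r ≤ V.toFun (ε • x) := by
  have h1 : ∀ᶠ y in cocompact (RN N), (r : EReal) < (V.toFun y : EReal) :=
    eventually_lt_of_lt_liminf hr
  rw [← Metric.cobounded_eq_cocompact, (hasBasis_cobounded_norm (E := RN N)).eventually_iff] at h1
  obtain ⟨R, -, hR⟩ := h1
  refine ⟨R / ε, fun x hx => (EReal.coe_lt_coe_iff.1 (hR ?_)).le⟩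
  rw [mem_ofPred_eq, norm_smul, Real.norm_of_nonneg hε.le]
  rwa [div_le_iff₀' hε] at hx

theorem Potential.atInfty_nonneg (V : Potential N) : 0 ≤ V.atInfty :=
  le_liminf_of_le (by isBoundedDefault)
    (Eventually.of_forall fun x => EReal.coe_nonneg.2 (V.pos x).le)

/-- For functions that vanish in `L²_loc`, the limit of the potential at infinity is the worst
case. -/
theorem eventually_integral_atInfty_le (hε : 0 < ε) (hw : ∀ n, MemLp (w n) 2 volume)
    (hp : ∀ n, FinPot ε V (w n)) (hM : ∀ n, ∫ x, w n x ^ 2 ≤ M)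
    (hloc : ∀ R : ℝ, Tendsto (fun n => ∫ x in Metric.ball (0 : RN N) R, w n x ^ 2) atTop (𝓝 0))
    (hV : V.atInfty ≠ ⊤) {η : ℝ} (hη : 0 < η) :
    ∀ᶠ n in atTop, ∫ x, V.atInfty.toReal * w n x ^ 2
      ≤ (∫ x, V.toFun (ε • x) * w n x ^ 2) + η := by
  have i1 : ∀ n, Integrable (fun x => V.atInfty.toReal * w n x ^ 2) volume := fun n =>
    (hw n).integrable_sq.const_mul _
  have hbot : V.atInfty ≠ ⊥ := (EReal.bot_lt_zero.trans_le V.atInfty_nonneg).ne'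
  have h := eventually_integral_le_of_small_at_infinity hw hloc (c := V.atInfty.toReal)
    (a := fun n x => V.atInfty.toReal * w n x ^ 2 - V.toFun (ε • x) * w n x ^ 2)
    (b := fun n x => w n x ^ 2) (fun n => (i1 n).sub (hp n)) (fun n => (hw n).integrable_sq)
    (fun n x => sq_nonneg _) hM (fun δ hδ => by
      obtain ⟨R, hR⟩ := V.exists_radius_le hε (r := V.atInfty.toReal - δ) (by
        conv_rhs => rw [← EReal.coe_toReal hV hbot]
        exact EReal.coe_lt_coe_iff.2 (by linarith))
      refine ⟨R, fun n x => ⟨fun _ => ?_, fun hx => ?_⟩⟩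
      · have := mul_nonneg (V.pos (ε • x)).le (sq_nonneg (w n x))
        linarith
      · rw [← sub_mul]
        have := hR x hx
        gcongr
        linarith) hη
  filter_upwards [h] with n hn
  have e : ∫ x, (V.atInfty.toReal * w n x ^ 2 - V.toFun (ε • x) * w n x ^ 2)
      = (∫ x, V.atInfty.toReal * w n x ^ 2) - ∫ x, V.toFun (ε • x) * w n x ^ 2 :=
    integral_sub (i1 n) (hp n)
  linarith

/-- A coercive potential makes the embedding into `L²` compact. -/
theorem tendsto_integral_sq_of_atInfty_eq_top (hε : 0 < ε) (hw : ∀ n, MemLp (w n) 2 volume)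
    (hp : ∀ n, FinPot ε V (w n)) (hM : ∀ n, ∫ x, V.toFun (ε • x) * w n x ^ 2 ≤ M)
    (hloc : ∀ R : ℝ, Tendsto (fun n => ∫ x in Metric.ball (0 : RN N) R, w n x ^ 2) atTop (𝓝 0))
    (hV : V.atInfty = ⊤) : Tendsto (fun n => ∫ x, w n x ^ 2) atTop (𝓝 0) := by
  have h : ∀ η > 0, ∀ᶠ n in atTop, ∫ x, w n x ^ 2 ≤ η := fun η hη =>
    eventually_integral_le_of_small_at_infinity hw hloc (c := 1)
      (a := fun n x => w n x ^ 2) (b := fun n x => V.toFun (ε • x) * w n x ^ 2)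
      (fun n => (hw n).integrable_sq) hp
      (fun n x => mul_nonneg (V.pos _).le (sq_nonneg _)) hM (fun δ hδ => by
        obtain ⟨R, hR⟩ := V.exists_radius_le hε (r := δ⁻¹) (by rw [hV]; exact EReal.coe_lt_top _)
        refine ⟨R, fun n x => ⟨fun _ => (one_mul _).ge, fun hx => ?_⟩⟩
        have h1 := mul_le_mul_of_nonneg_right (hR x hx) (sq_nonneg (w n x))
        calc w n x ^ 2 = δ * (δ⁻¹ * w n x ^ 2) := by field_simp
          _ ≤ _ := by gcongr) hη
  rw [Metric.tendsto_atTop']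
  intro η hη
  obtain ⟨n0, hn0⟩ := eventually_atTop.1 (h (η / 2) (half_pos hη))
  refine ⟨n0, fun n hn => ?_⟩
  rw [Real.dist_0_eq_abs, abs_of_nonneg (integral_nonneg fun _ => sq_nonneg _)]
  have := hn0 n hn.le
  linarith

end PotentialAtInfinity

/-! ### The fibre maximum of the limit functional -/

theorem sub_le_rpow_div {r κ t : ℝ} (hr : 2 < r) (hκ : 1 ≤ κ) (ht : 0 ≤ t) :
    κ * t ^ 2 / 2 - κ ^ (r / (r - 2)) * (1 / 2 - 1 / r) ≤ t ^ r / r := by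
  have hκ0 : 0 < κ := by linarith
  have hr2 : r - 2 ≠ 0 := by linarith
  have hr0 : 0 < r := by linarith
  set m : ℝ := κ ^ (2 / (r - 2)) with hm
  have hm0 : 0 < m := by positivity
  have h1 : κ ^ (r / (r - 2)) = κ * m := by
    conv_rhs => rw [hm, ← Real.rpow_one_add' hκ0.le (by positivity)]
    congr 1
    field_simp
    ring
  have h2 : m ^ (r / 2) = κ * m := by
    rw [← h1, hm, ← Real.rpow_mul hκ0.le]
    congr 1
    field_simp
  have h3 : t ^ r = κ * m * (t ^ 2 / m) ^ (r / 2) := by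
    rw [Real.div_rpow (by positivity) hm0.le, h2, ← Real.rpow_two, ← Real.rpow_mul ht]
    have : 2 * (r / 2) = r := by ring
    rw [this]
    field_simp
  have h4 := one_add_mul_self_le_rpow_one_add (s := t ^ 2 / m - 1) (p := r / 2)
    (by linarith [show 0 ≤ t ^ 2 / m by positivity]) (by linarith)
  rw [add_sub_cancel] at h4
  rw [h1, h3, le_div_iff₀ hr0]
  calc _ = κ * m * (1 + r / 2 * (t ^ 2 / m - 1)) := by field_simp; ring
    _ ≤ _ := by gcongr

theorem fibre_le {p q κ t D a b : ℝ} (hq : 2 < q) (hqp : q < p) (hκ : 1 ≤ κ) (ht : 0 ≤ t)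
    (ha : 0 ≤ a) (hb : 0 ≤ b) (hD : D ≤ κ * (q * a + b)) :
    1 / 2 * (t ^ 2 * D) - (t ^ q * a + 1 / p * (t ^ p * b)) ≤
      κ ^ (q / (q - 2)) * ((q / 2 - 1) * a + (1 / 2 - 1 / p) * b) := by
  have hp0 : 0 < p := by linarith
  have hq0 : 0 < q := by linarith
  have h1 := mul_le_mul_of_nonneg_left (sub_le_rpow_div hq hκ ht) (mul_nonneg hq0.le ha)
  have h2 := mul_le_mul_of_nonneg_left (sub_le_rpow_div (hq.trans hqp) hκ ht) hb
  have h3 : κ ^ (p / (p - 2)) ≤ κ ^ (q / (q - 2)) := by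
    refine Real.rpow_le_rpow_of_exponent_le hκ ?_
    rw [div_le_div_iff₀ (by linarith) (by linarith)]
    nlinarith
  have h4 : 0 ≤ 1 / 2 - 1 / p := by
    have : 1 / p ≤ 1 / 2 := one_div_le_one_div_of_le two_pos (by linarith)
    linarith
  have h5 := mul_le_mul_of_nonneg_right h3 (mul_nonneg h4 hb)
  have h6 : t ^ 2 * D ≤ t ^ 2 * (κ * (q * a + b)) := by gcongr
  have e1 : q * a * (t ^ q / q) = t ^ q * a := by field_simp
  have e2 : b * (t ^ p / p) = 1 / p * (t ^ p * b) := by field_simp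
  have e3 : q * a * (κ * t ^ 2 / 2 - κ ^ (q / (q - 2)) * (1 / 2 - 1 / q))
      = q * a * (κ * t ^ 2 / 2) - κ ^ (q / (q - 2)) * ((q / 2 - 1) * a) := by field_simp
  rw [e1, e3] at h1
  rw [e2] at h2
  linarith

theorem gagSq_smul {N : ℕ} (s t : ℝ) (u : RN N → ℝ) :
    gagSq N s (t • u) = t ^ 2 * gagSq N s u := by
  unfold gagSq
  rw [← integral_const_mul]
  congr 1
  funext x
  simp only [Pi.smul_apply, smul_eq_mul]
  rw [← mul_sub, abs_mul, mul_pow, sq_abs t, mul_div_assoc]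

theorem HomLip.hom_of_nonneg {p : ℝ} {F : ℝ × ℝ → ℝ} (h : HomLip p F) (hp : 1 < p) {t : ℝ}
    (ht : 0 ≤ t) (x : ℝ × ℝ) : F (t • x) = t ^ p * F x := by
  rcases ht.eq_or_lt with rfl | ht
  · rw [zero_smul, h.zero hp, Real.zero_rpow (by linarith), zero_mul]
  · exact h.hom t ht x

theorem JConst_smul {N : ℕ} {s q α β a b t : ℝ} {Q : ℝ × ℝ → ℝ} (hQ : IsAdmissible N s q Q)
    (hα : 1 ≤ α) (hβ : 1 ≤ β) (ht : 0 ≤ t) (u v : RN N → ℝ) :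
    JConst N s a b α β Q (t • u) (t • v) =
      1 / 2 * (t ^ 2 * (gagSq N s u + gagSq N s v + ∫ x, (a * u x ^ 2 + b * v x ^ 2)))
        - (t ^ q * (∫ x, extQ Q (u x) (v x))
          + 1 / (α + β) * (t ^ (α + β) * ∫ x, critF α β (u x, v x))) := by
  have e1 : ∫ x, (a * (t • u) x ^ 2 + b * (t • v) x ^ 2)
      = t ^ 2 * ∫ x, (a * u x ^ 2 + b * v x ^ 2) := by
    rw [← integral_const_mul]
    congr 1
    funext x
    simp only [Pi.smul_apply, smul_eq_mul]
    ring
  have e2 : ∫ x, extQ Q ((t • u) x) ((t • v) x) = t ^ q * ∫ x, extQ Q (u x) (v x) := by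
    rw [← integral_const_mul]
    congr 1
    funext x
    exact hQ.homLip.hom_of_nonneg (by linarith [hQ.two_lt]) ht (u x, v x)
  have e3 : ∫ x, max ((t • u) x) 0 ^ α * max ((t • v) x) 0 ^ β
      = t ^ (α + β) * ∫ x, critF α β (u x, v x) := by
    rw [← integral_const_mul]
    congr 1
    funext x
    exact (critF_homLip hα hβ).hom_of_nonneg (by linarith) ht (u x, v x)
  rw [JConst, nonlinTerm, gagSq_smul, gagSq_smul, e1, e2, e3]
  ring

/-- If the limit quadratic form is at most `κ` times the nonlinear terms, the fibre through `(u, v)`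
bounds the limit level from above. -/
theorem mInfty_le {N : ℕ} {s q α β κ : ℝ} {Q : ℝ × ℝ → ℝ} {V W : Potential N}
    (hQ : IsAdmissible N s q Q) (hα : 1 ≤ α) (hβ : 1 ≤ β) (hqp : q < α + β) (hκ : 1 ≤ κ)
    (hVW : max V.atInfty W.atInfty ≠ ⊤) {u v : RN N → ℝ} (hu : MemHs N s u) (hv : MemHs N s v)
    (h0 : ¬(u =ᵐ[volume] 0 ∧ v =ᵐ[volume] 0))
    (hD : gagSq N s u + gagSq N s v
        + ∫ x, (V.atInfty.toReal * u x ^ 2 + W.atInfty.toReal * v x ^ 2)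
      ≤ κ * (q * (∫ x, extQ Q (u x) (v x)) + ∫ x, critF α β (u x, v x))) :
    mInfty s V W α β Q ≤ ((κ ^ (q / (q - 2)) * ((q / 2 - 1) * (∫ x, extQ Q (u x) (v x))
      + (1 / 2 - 1 / (α + β)) * ∫ x, critF α β (u x, v x)) : ℝ) : EReal) := by
  rw [mInfty, if_neg hVW]
  refine iInf_le_of_le u (iInf_le_of_le v (iInf_le_of_le ⟨hu, hv, h0⟩ ?_))
  refine iSup_le fun t => iSup_le fun ht => EReal.coe_le_coe_iff.2 ?_
  rw [JConst_smul hQ hα hβ ht]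
  exact fibre_le hQ.two_lt hqp hκ ht (integral_nonneg fun _ => hQ.extQ_nonneg _ _)
    (integral_nonneg fun _ => critF_nonneg _ _ _) hD

/-! ### Vanishing of the subcritical term -/

/-- A homogeneous function that vanishes where the coordinate `g` does is controlled by `g²`, up to
small multiples of two powers of the norm. -/
theorem exists_small_bound {p q C δ : ℝ} (hq : 2 < q) (hqp : q < p) (hC : 0 ≤ C)
    {F g : ℝ × ℝ → ℝ} (hF : ∀ x, F x ≤ C * (‖x‖ ^ (q - 1) * |g x|)) (hg : ∀ x, |g x| ≤ ‖x‖)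
    (hδ : 0 < δ) : ∃ K : ℝ, 0 ≤ K ∧ ∀ x, F x ≤ δ * (‖x‖ ^ q + ‖x‖ ^ p) + K * g x ^ 2 := by
  obtain ⟨K1, hK1, h1⟩ := exists_young_const (p := q) (δ := δ / (C + 1)) (by linarith)
    (by positivity)
  obtain ⟨K2, hK2, h2⟩ := exists_interpolation_const hq.le hqp (δ := δ / (C * K1 + 1))
    (by positivity)
  refine ⟨C * K1 * K2, by positivity, fun x => (hF x).trans ?_⟩
  have e1 := h1 ‖x‖ |g x| (norm_nonneg _) (abs_nonneg _)
  have e2 := h2 |g x| (abs_nonneg _)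
  have e3 : |g x| ^ p ≤ ‖x‖ ^ p := Real.rpow_le_rpow (abs_nonneg _) (hg x) (by linarith)
  rw [sq_abs] at e2
  have c1 : C * (δ / (C + 1)) ≤ δ := by
    rw [← mul_div_assoc, div_le_iff₀ (by positivity)]
    nlinarith
  have c2 : C * K1 * (δ / (C * K1 + 1)) ≤ δ := by
    rw [← mul_div_assoc, div_le_iff₀ (by positivity)]
    nlinarith [mul_nonneg hC hK1]
  calc C * (‖x‖ ^ (q - 1) * |g x|)
      ≤ C * (δ / (C + 1) * ‖x‖ ^ q + K1 * (K2 * g x ^ 2 + δ / (C * K1 + 1) * ‖x‖ ^ p)) := by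
        gcongr
        refine e1.trans ?_
        gcongr
        refine e2.trans ?_
        gcongr
    _ = C * (δ / (C + 1)) * ‖x‖ ^ q + C * K1 * (δ / (C * K1 + 1)) * ‖x‖ ^ p
        + C * K1 * K2 * g x ^ 2 := by ring
    _ ≤ δ * ‖x‖ ^ q + δ * ‖x‖ ^ p + C * K1 * K2 * g x ^ 2 := by gcongr
    _ = _ := by ring

theorem HomLip.exists_bound_of_vanishing {q : ℝ} {F : ℝ × ℝ → ℝ} (hF : HomLip q F) (hq : 1 < q)
    {g : ℝ × ℝ → ℝ} {P : ℝ × ℝ → ℝ × ℝ} (h0 : ∀ x, F (P x) = 0) (hP : ∀ x, ‖P x‖ ≤ ‖x‖)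
    (hg : ∀ x, ‖x - P x‖ ≤ |g x|) :
    ∃ C : ℝ, 0 ≤ C ∧ ∀ x, F x ≤ C * (‖x‖ ^ (q - 1) * |g x|) := by
  obtain ⟨C, hC, h⟩ := hF.lip
  refine ⟨C * 2 ^ (q - 1), by positivity, fun x => ?_⟩
  have h1 := h x (P x)
  rw [h0, sub_zero] at h1
  calc F x ≤ |F x| := le_abs_self _
    _ ≤ C * ((‖x‖ + ‖P x‖) ^ (q - 1) * ‖x - P x‖) := h1
    _ ≤ C * ((2 * ‖x‖) ^ (q - 1) * |g x|) := by
        have := hP x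
        have := hg x
        gcongr
        linarith
    _ = _ := by rw [Real.mul_rpow two_pos.le (norm_nonneg _)]; ring

theorem IsAdmissible.exists_fst_bound {N : ℕ} {s q : ℝ} {Q : ℝ × ℝ → ℝ}
    (hQ : IsAdmissible N s q Q) :
    ∃ C : ℝ, 0 ≤ C ∧ ∀ x : ℝ × ℝ, extQ Q x.1 x.2 ≤ C * (‖x‖ ^ (q - 1) * |x.1|) :=
  hQ.homLip.exists_bound_of_vanishing (g := fun x => x.1) (P := fun x => (0, x.2))
    (by linarith [hQ.two_lt]) (fun x => by simp [extQ])
    (fun x => by simp [Prod.norm_def]) (fun x => by simp [Prod.norm_def])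

theorem IsAdmissible.exists_snd_bound {N : ℕ} {s q : ℝ} {Q : ℝ × ℝ → ℝ}
    (hQ : IsAdmissible N s q Q) :
    ∃ C : ℝ, 0 ≤ C ∧ ∀ x : ℝ × ℝ, extQ Q x.1 x.2 ≤ C * (‖x‖ ^ (q - 1) * |x.2|) :=
  hQ.homLip.exists_bound_of_vanishing (g := fun x => x.2) (P := fun x => (x.1, 0))
    (by linarith [hQ.two_lt]) (fun x => by simp [extQ])
    (fun x => by simp [Prod.norm_def]) (fun x => by simp [Prod.norm_def])

theorem tendsto_integral_zero_of_small_bound {Ω : Type*} [MeasurableSpace Ω] {μ : Measure Ω}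
    {p q M1 M2 : ℝ} (hq : 1 < q) (hp : 1 < p) {F g : ℝ × ℝ → ℝ} (hF : HomLip q F)
    (h0 : ∀ x, 0 ≤ F x)
    (hs : ∀ δ > 0, ∃ K : ℝ, 0 ≤ K ∧ ∀ x, F x ≤ δ * (‖x‖ ^ q + ‖x‖ ^ p) + K * g x ^ 2)
    {f : ℕ → Ω → ℝ × ℝ} (hfq : ∀ n, MemLp (f n) (ENNReal.ofReal q) μ)
    (hfp : ∀ n, MemLp (f n) (ENNReal.ofReal p) μ) (hM1 : ∀ n, ∫ x, ‖f n x‖ ^ q ∂μ ≤ M1)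
    (hM2 : ∀ n, ∫ x, ‖f n x‖ ^ p ∂μ ≤ M2) (hgi : ∀ n, Integrable (fun x => g (f n x) ^ 2) μ)
    (hg : Tendsto (fun n => ∫ x, g (f n x) ^ 2 ∂μ) atTop (𝓝 0)) :
    Tendsto (fun n => ∫ x, F (f n x) ∂μ) atTop (𝓝 0) := by
  have m1 : 0 ≤ M1 := (integral_nonneg fun x => by positivity).trans (hM1 0)
  have m2 : 0 ≤ M2 := (integral_nonneg fun x => by positivity).trans (hM2 0)
  rw [Metric.tendsto_atTop']
  intro η hη
  obtain ⟨K, hK, hb⟩ := hs (η / 2 / (M1 + M2 + 1)) (by positivity)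
  have h1 := hg.const_mul K
  rw [mul_zero] at h1
  obtain ⟨n0, hn0⟩ := eventually_atTop.1 (h1.eventually (gt_mem_nhds (half_pos hη)))
  refine ⟨n0, fun n hn => ?_⟩
  rw [Real.dist_0_eq_abs, abs_of_nonneg (integral_nonneg fun _ => h0 _)]
  have i1 := integrable_norm_rpow_ofReal hq (hfq n)
  have i2 := integrable_norm_rpow_ofReal hp (hfp n)
  set δ := η / 2 / (M1 + M2 + 1) with hδ
  have hδ0 : 0 < δ := by positivity
  have e1 : ∫ x, F (f n x) ∂μ
      ≤ ∫ x, (δ * (‖f n x‖ ^ q + ‖f n x‖ ^ p) + K * g (f n x) ^ 2) ∂μ :=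
    integral_mono (hF.integrable hq (hfq n)) (((i1.add i2).const_mul δ).add ((hgi n).const_mul K))
      fun x => hb _
  have e2 : ∫ x, (δ * (‖f n x‖ ^ q + ‖f n x‖ ^ p) + K * g (f n x) ^ 2) ∂μ
      = (∫ x, δ * (‖f n x‖ ^ q + ‖f n x‖ ^ p) ∂μ) + ∫ x, K * g (f n x) ^ 2 ∂μ :=
    integral_add ((i1.add i2).const_mul δ) ((hgi n).const_mul K)
  have e3 : ∫ x, (‖f n x‖ ^ q + ‖f n x‖ ^ p) ∂μ
      = (∫ x, ‖f n x‖ ^ q ∂μ) + ∫ x, ‖f n x‖ ^ p ∂μ := integral_add i1 i2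
  rw [integral_const_mul, integral_const_mul, e3] at e2
  have e4 : δ * ((∫ x, ‖f n x‖ ^ q ∂μ) + ∫ x, ‖f n x‖ ^ p ∂μ) ≤ η / 2 := by
    calc _ ≤ δ * (M1 + M2 + 1) :=
          mul_le_mul_of_nonneg_left (by linarith [hM1 n, hM2 n]) hδ0.le
      _ = η / 2 := by rw [hδ]; field_simp
  have := hn0 n hn.le
  linarith

/-! ### The Sobolev quotient -/

theorem abs_rpow_mul_le {α β : ℝ} (hα : 1 ≤ α) (hβ : 1 ≤ β) (x : ℝ × ℝ) :
    |x.1| ^ α * |x.2| ^ β ≤ ‖x‖ ^ (α + β) := by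
  rw [Real.rpow_add_of_nonneg (norm_nonneg _) (by linarith) (by linarith)]
  have h1 : |x.1| ≤ ‖x‖ := norm_fst_le x
  have h2 : |x.2| ≤ ‖x‖ := norm_snd_le x
  gcongr

theorem sTilde_nonneg (N : ℕ) (s α β : ℝ) : 0 ≤ sTilde N s α β := by
  refine Real.sInf_nonneg ?_
  rintro r ⟨u, v, -, -, h, rfl⟩
  have h1 := gagForm_self_nonneg N s u
  have h2 := gagForm_self_nonneg N s v
  rw [gagForm_self] at h1 h2
  positivity

namespace XSpace

variable {N : ℕ} {s ε α β : ℝ} {V W : Potential N}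

theorem gagSq_add_le (z : XSpace N s ε V W) : gagSq N s z.u + gagSq N s z.v ≤ ‖z‖ ^ 2 := by
  rw [norm_sq_eq_sum, gagSq_eq z.memHs_u.1.1, gagSq_eq z.memHs_v.1.1]
  exact le_add_of_nonneg_right (by positivity)

theorem sTilde_le (hα : 1 ≤ α) (hβ : 1 ≤ β) (hp : 0 < critExp N s) (z : XSpace N s ε V W)
    (hz : MemLp z.pair (ENNReal.ofReal (α + β)) volume) (hB : 0 < ∫ x, critF α β (z.pair x)) :
    sTilde N s α β ≤ ‖z‖ ^ 2 / (∫ x, critF α β (z.pair x)) ^ (2 / critExp N s) := by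
  have hle : ∀ x, critF α β (z.pair x) ≤ |z.u x| ^ α * |z.v x| ^ β := fun x => by
    have h1 : max (z.u x) 0 ≤ |z.u x| := max_le (le_abs_self _) (abs_nonneg _)
    have h2 : max (z.v x) 0 ≤ |z.v x| := max_le (le_abs_self _) (abs_nonneg _)
    have h3 : 0 ≤ max (z.u x) 0 := le_max_right _ _
    have h4 : 0 ≤ max (z.v x) 0 := le_max_right _ _
    simp only [critF, pair]
    gcongr
  have hint : Integrable (fun x => |z.u x| ^ α * |z.v x| ^ β) volume := by
    refine (integrable_norm_rpow_ofReal (by linarith) hz).mono' ?_ (Eventually.of_forall fun x => ?_)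
    · have c1 : Continuous fun t : ℝ => |t| ^ α :=
        continuous_abs.rpow_const fun t => Or.inr (by linarith)
      have c2 : Continuous fun t : ℝ => |t| ^ β :=
        continuous_abs.rpow_const fun t => Or.inr (by linarith)
      exact (c1.comp_aestronglyMeasurable z.memHs_u.1.1).mul
        (c2.comp_aestronglyMeasurable z.memHs_v.1.1)
    · rw [Real.norm_of_nonneg (by positivity)]
      exact abs_rpow_mul_le hα hβ (z.pair x)
  have hBD : ∫ x, critF α β (z.pair x) ≤ ∫ x, |z.u x| ^ α * |z.v x| ^ β :=
    integral_mono ((critF_homLip hα hβ).integrable (by linarith) hz) hint hle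
  have hbdd : BddBelow {r : ℝ | ∃ u v : RN N → ℝ, MemHs N s u ∧ MemHs N s v ∧
      0 < (∫ x, |u x| ^ α * |v x| ^ β) ∧
      r = (gagSq N s u + gagSq N s v) / (∫ x, |u x| ^ α * |v x| ^ β) ^ (2 / critExp N s)} := by
    refine ⟨0, ?_⟩
    rintro r ⟨u, v, -, -, h, rfl⟩
    have h1 := gagForm_self_nonneg N s u
    have h2 := gagForm_self_nonneg N s v
    rw [gagForm_self] at h1 h2
    positivity
  refine (csInf_le hbdd ⟨z.u, z.v, z.memHs_u, z.memHs_v, hB.trans_le hBD, rfl⟩).trans ?_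
  have := z.gagSq_add_le
  gcongr

end XSpace

/-! ### The compactness threshold -/

namespace XSpace

variable {N : ℕ} {s ε α β q : ℝ} {V W : Potential N} {Q : ℝ × ℝ → ℝ}

/-- The subcritical term `∫ Q(u, v)`. -/
noncomputable def subTerm (Q : ℝ × ℝ → ℝ) (z : XSpace N s ε V W) : ℝ := ∫ x, extQ Q (z.u x) (z.v x)

/-- The critical term `∫ (u⁺)^α (v⁺)^β`. -/
noncomputable def critTerm (α β : ℝ) (z : XSpace N s ε V W) : ℝ := ∫ x, critF α β (z.pair x)

theorem JEps_eq_energy : (JEps α β Q : XSpace N s ε V W → ℝ)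
    = energy (α + β) (subTerm Q) (critTerm α β) := rfl

theorem eq_zero_of_ae_eq_zero (z : XSpace N s ε V W) (h : z.u =ᵐ[volume] 0 ∧ z.v =ᵐ[volume] 0) : z = 0 := by
  have f1 : z.val.1 = 0 := AEEqFun.ext (h.1.trans AEEqFun.coeFn_zero.symm)
  have f2 : z.val.2 = 0 := AEEqFun.ext (h.2.trans AEEqFun.coeFn_zero.symm)
  exact Subtype.ext (Prod.ext f1 f2)

theorem integral_u_sq_le {z : XSpace N s ε V W} {M : ℝ} (hM : ‖z‖ ≤ M) :
    ∫ x, z.u x ^ 2 ≤ (√(V.inf)⁻¹ * M) ^ 2 := by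
  rw [integral_sq_eq_eLpNorm z.memHs_u.1.1]
  have := z.eLpNorm_u_le
  gcongr
  exact this.trans (by gcongr)

theorem integral_v_sq_le {z : XSpace N s ε V W} {M : ℝ} (hM : ‖z‖ ≤ M) :
    ∫ x, z.v x ^ 2 ≤ (√(W.inf)⁻¹ * M) ^ 2 := by
  rw [integral_sq_eq_eLpNorm z.memHs_v.1.1]
  have := z.eLpNorm_v_le
  gcongr
  exact this.trans (by gcongr)

theorem integral_pot_u_le {z : XSpace N s ε V W} {M : ℝ} (hM : ‖z‖ ≤ M) :
    ∫ x, V.toFun (ε • x) * z.u x ^ 2 ≤ M ^ 2 := by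
  rw [integral_potential_eq z.memHs_u.1.1]
  have := z.pot_u_le
  gcongr
  exact this.trans hM

theorem integral_pot_v_le {z : XSpace N s ε V W} {M : ℝ} (hM : ‖z‖ ≤ M) :
    ∫ x, W.toFun (ε • x) * z.v x ^ 2 ≤ M ^ 2 := by
  rw [integral_potential_eq z.memHs_v.1.1]
  have := z.pot_v_le
  gcongr
  exact this.trans hM

section Level

variable {w : ℕ → XSpace N s ε V W} {M ℓ d : ℝ}

/-- Vanishing sequences that almost satisfy the Nehari constraint have at least the energy of the
limit problem. -/
theorem mInfty_le_of_vanishing (hε : 0 < ε) (hQ : IsAdmissible N s q Q) (hα : 1 ≤ α) (hβ : 1 ≤ β)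
    (hqp : q < α + β) (hVW : max V.atInfty W.atInfty ≠ ⊤) (hM : ∀ k, ‖w k‖ ≤ M)
    (hu : ∀ R : ℝ, Tendsto (fun k => ∫ x in Metric.ball (0 : RN N) R, (w k).u x ^ 2) atTop (𝓝 0))
    (hv : ∀ R : ℝ, Tendsto (fun k => ∫ x in Metric.ball (0 : RN N) R, (w k).v x ^ 2) atTop (𝓝 0))
    (hn : Tendsto (fun k => ‖w k‖ ^ 2) atTop (𝓝 ℓ)) (hℓ : 0 < ℓ)
    (hI : Tendsto (fun k => ‖w k‖ ^ 2 - q * subTerm Q (w k) - critTerm α β (w k)) atTop (𝓝 0))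
    (hJ : Tendsto (fun k => JEps α β Q (w k)) atTop (𝓝 d)) :
    mInfty s V W α β Q ≤ (d : EReal) := by
  have hV : V.atInfty ≠ ⊤ := fun h => hVW (by rw [h, max_eq_left le_top])
  have hW : W.atInfty ≠ ⊤ := fun h => hVW (by rw [h, max_eq_right le_top])
  have hG : Tendsto (fun k => (q / 2 - 1) * subTerm Q (w k)
      + (1 / 2 - 1 / (α + β)) * critTerm α β (w k)) atTop (𝓝 d) := by
    have := hJ.sub (hI.const_mul (1 / 2))
    rw [mul_zero, sub_zero] at this
    refine this.congr fun k => ?_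
    rw [JEps_eq_energy, energy]
    ring
  have hκ : ∀ κ : ℝ, 1 < κ → mInfty s V W α β Q ≤ ((κ ^ (q / (q - 2)) * d : ℝ) : EReal) := by
    intro κ hκ
    set η : ℝ := (κ - 1) * ℓ / 3 with hη
    have hη0 : 0 < η := by have : 0 < κ - 1 := by linarith
                           positivity
    have e1 := eventually_integral_atInfty_le hε (fun k => (w k).memHs_u.1)
      (fun k => (w k).finPot_u) (fun k => integral_u_sq_le (hM k)) hu hV (half_pos hη0)
    have e2 := eventually_integral_atInfty_le hε (fun k => (w k).memHs_v.1)
      (fun k => (w k).finPot_v) (fun k => integral_v_sq_le (hM k)) hv hW (half_pos hη0)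
    have e3 := hI.eventually (gt_mem_nhds hη0)
    have e4 := (hn.sub hI).eventually (lt_mem_nhds (show 2 * ℓ / 3 < ℓ - 0 by linarith))
    have e5 := hn.eventually (lt_mem_nhds hℓ)
    refine ge_of_tendsto (continuous_coe_real_ereal.continuousAt.tendsto.comp
      (hG.const_mul (κ ^ (q / (q - 2))))) ?_
    filter_upwards [e1, e2, e3, e4, e5] with k h1 h2 h3 h4 h5
    refine mInfty_le hQ hα hβ hqp hκ.le hVW (w k).memHs_u (w k).memHs_v (fun h => ?_) ?_
    · rw [eq_zero_of_ae_eq_zero _ h] at h5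
      simp at h5
    · have a1 : ∫ x, (V.atInfty.toReal * (w k).u x ^ 2 + W.atInfty.toReal * (w k).v x ^ 2)
          = (∫ x, V.atInfty.toReal * (w k).u x ^ 2) + ∫ x, W.atInfty.toReal * (w k).v x ^ 2 :=
        integral_add ((w k).memHs_u.1.integrable_sq.const_mul _)
          ((w k).memHs_v.1.integrable_sq.const_mul _)
      have a2 := norm_sq_eq (w k)
      have a3 : ∫ x, (V.toFun (ε • x) * (w k).u x ^ 2 + W.toFun (ε • x) * (w k).v x ^ 2)
          = (∫ x, V.toFun (ε • x) * (w k).u x ^ 2) + ∫ x, W.toFun (ε • x) * (w k).v x ^ 2 :=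
        integral_add (w k).finPot_u (w k).finPot_v
      change _ ≤ κ * (q * subTerm Q (w k) + critTerm α β (w k))
      have a4 := mul_le_mul_of_nonneg_left h4.le (by linarith : 0 ≤ κ - 1)
      have a5 : (κ - 1) * (2 * ℓ / 3) = 2 * η := by rw [hη]; ring
      linarith
  have hlim : Tendsto (fun κ : ℝ => ((κ ^ (q / (q - 2)) * d : ℝ) : EReal)) (𝓝[>] 1)
      (𝓝 ((1 ^ (q / (q - 2)) * d : ℝ) : EReal)) := by
    have h1 : Tendsto (fun κ : ℝ => κ ^ (q / (q - 2)) * d) (𝓝[>] 1)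
        (𝓝 (1 ^ (q / (q - 2)) * d)) :=
      ((Real.continuousAt_rpow_const 1 _ (Or.inl one_ne_zero)).tendsto.mul_const d).mono_left
        nhdsWithin_le_nhds
    exact continuous_coe_real_ereal.continuousAt.tendsto.comp h1
  rw [Real.one_rpow, one_mul] at hlim
  refine ge_of_tendsto hlim ?_
  filter_upwards [self_mem_nhdsWithin] with κ h using hκ κ h

/-- Sequences whose subcritical term vanishes and that almost satisfy the Nehari constraint have at
least the energy given by the Sobolev constant. -/
theorem sTilde_level_le (hs : 0 < s) (hN : 2 * s < N) (hα : 1 ≤ α) (hβ : 1 ≤ β)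
    (hαβ : α + β = critExp N s)
    (hn : Tendsto (fun k => ‖w k‖ ^ 2) atTop (𝓝 ℓ)) (hℓ : 0 < ℓ)
    (hI : Tendsto (fun k => ‖w k‖ ^ 2 - q * subTerm Q (w k) - critTerm α β (w k)) atTop (𝓝 0))
    (hJ : Tendsto (fun k => JEps α β Q (w k)) atTop (𝓝 d))
    (hA : Tendsto (fun k => subTerm Q (w k)) atTop (𝓝 0)) :
    s / N * sTilde N s α β ^ ((N : ℝ) / (2 * s)) ≤ d := by
  obtain ⟨C, -, hb⟩ := exists_pair_crit_bound (ε := ε) (V := V) (W := W) hs hN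
  rw [← hαβ] at hb
  have hp := critExp_gt_two hs hN
  have hN0 : (0:ℝ) < N := by linarith
  have hB : Tendsto (fun k => critTerm α β (w k)) atTop (𝓝 ℓ) := by
    have := (hn.sub (hA.const_mul q)).sub hI
    rw [mul_zero, sub_zero, sub_zero] at this
    exact this.congr fun k => by ring
  have hd : d = s / N * ℓ := by
    have h1 : Tendsto (fun k => JEps α β Q (w k)) atTop
        (𝓝 (1 / 2 * ℓ - (0 + 1 / (α + β) * ℓ))) :=
      (hn.const_mul (1 / 2)).sub (hA.add (hB.const_mul (1 / (α + β))))
    rw [tendsto_nhds_unique hJ h1, hαβ, critExp]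
    have : (N:ℝ) - 2 * s ≠ 0 := by linarith
    field_simp
    ring
  have hS : sTilde N s α β ≤ ℓ ^ (2 * s / N) := by
    have h1 : Tendsto (fun k => ‖w k‖ ^ 2 / critTerm α β (w k) ^ (2 / critExp N s)) atTop
        (𝓝 (ℓ / ℓ ^ (2 / critExp N s))) :=
      hn.div (hB.rpow_const (Or.inl hℓ.ne')) (Real.rpow_pos_of_pos hℓ _).ne'
    have h2 : ℓ / ℓ ^ (2 / critExp N s) = ℓ ^ (2 * s / N) := by
      rw [← Real.rpow_one_sub' hℓ.le]
      · congr 1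
        rw [critExp]
        have : (N:ℝ) - 2 * s ≠ 0 := by linarith
        field_simp
        ring
      · have : 2 / critExp N s < 1 := by rw [div_lt_one (by linarith)]; exact hp
        linarith
    rw [← h2]
    refine ge_of_tendsto h1 ?_
    filter_upwards [hB.eventually (lt_mem_nhds hℓ)] with k hk
    exact sTilde_le hα hβ (by linarith) (w k) (hb _).1 hk
  rw [hd]
  have h3 := Real.rpow_le_rpow (sTilde_nonneg N s α β) hS
    (by positivity : 0 ≤ (N:ℝ) / (2 * s))
  have h4 : (ℓ ^ (2 * s / (N:ℝ))) ^ ((N:ℝ) / (2 * s)) = ℓ := by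
    rw [← Real.rpow_mul hℓ.le]
    have : 2 * s / (N:ℝ) * ((N:ℝ) / (2 * s)) = 1 := by field_simp
    rw [this, Real.rpow_one]
  rw [h4] at h3
  gcongr

/-- If one of the potentials is coercive, the subcritical term vanishes along vanishing
sequences. -/
theorem tendsto_subTerm_zero (hs : 0 < s) (hN : 2 * s < N) (hε : 0 < ε) (hQ : IsAdmissible N s q Q)
    (hVW : max V.atInfty W.atInfty = ⊤) (hM : ∀ k, ‖w k‖ ≤ M)
    (hu : ∀ R : ℝ, Tendsto (fun k => ∫ x in Metric.ball (0 : RN N) R, (w k).u x ^ 2) atTop (𝓝 0))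
    (hv : ∀ R : ℝ, Tendsto (fun k => ∫ x in Metric.ball (0 : RN N) R, (w k).v x ^ 2) atTop (𝓝 0)) :
    Tendsto (fun k => subTerm Q (w k)) atTop (𝓝 0) := by
  obtain ⟨C1, hC1, hb1⟩ := exists_pair_crit_bound (ε := ε) (V := V) (W := W) hs hN
  obtain ⟨C2, hC2, hb2⟩ := exists_pair_bound (ε := ε) (V := V) (W := W) hs hN hQ.two_lt hQ.lt_crit
  have hq : 1 < q := by linarith [hQ.two_lt]
  have hp : 1 < critExp N s := by linarith [critExp_gt_two hs hN]
  rcases max_eq_top.1 hVW with h | h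
  · obtain ⟨C, hC, hF⟩ := hQ.exists_fst_bound
    exact tendsto_integral_zero_of_small_bound (g := fun x => x.1) hq hp hQ.homLip
      (fun x => hQ.extQ_nonneg _ _)
      (fun δ hδ => exists_small_bound hQ.two_lt hQ.lt_crit hC hF (fun x => norm_fst_le x) hδ)
      (f := fun k => (w k).pair) (fun k => (hb2 _).1) (fun k => (hb1 _).1)
      (fun k => integral_rpow_pair_le hq (hb2 _) hC2 (hM k))
      (fun k => integral_rpow_pair_le hp (hb1 _) hC1 (hM k))
      (fun k => (w k).memHs_u.1.integrable_sq)
      (tendsto_integral_sq_of_atInfty_eq_top hε (fun k => (w k).memHs_u.1)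
        (fun k => (w k).finPot_u) (fun k => integral_pot_u_le (hM k)) hu h)
  · obtain ⟨C, hC, hF⟩ := hQ.exists_snd_bound
    exact tendsto_integral_zero_of_small_bound (g := fun x => x.2) hq hp hQ.homLip
      (fun x => hQ.extQ_nonneg _ _)
      (fun δ hδ => exists_small_bound hQ.two_lt hQ.lt_crit hC hF (fun x => norm_snd_le x) hδ)
      (f := fun k => (w k).pair) (fun k => (hb2 _).1) (fun k => (hb1 _).1)
      (fun k => integral_rpow_pair_le hq (hb2 _) hC2 (hM k))
      (fun k => integral_rpow_pair_le hp (hb1 _) hC1 (hM k))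
      (fun k => (w k).memHs_v.1.integrable_sq)
      (tendsto_integral_sq_of_atInfty_eq_top hε (fun k => (w k).memHs_v.1)
        (fun k => (w k).finPot_v) (fun k => integral_pot_v_le (hM k)) hv h)

/-- A vanishing sequence that almost satisfies the Nehari constraint and does not tend to zero has
at least the threshold energy. -/
theorem level_le (hs : 0 < s) (hN : 2 * s < N) (hε : 0 < ε) (hQ : IsAdmissible N s q Q)
    (hα : 1 ≤ α) (hβ : 1 ≤ β) (hαβ : α + β = critExp N s) (hM : ∀ k, ‖w k‖ ≤ M)
    (hu : ∀ R : ℝ, Tendsto (fun k => ∫ x in Metric.ball (0 : RN N) R, (w k).u x ^ 2) atTop (𝓝 0))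
    (hv : ∀ R : ℝ, Tendsto (fun k => ∫ x in Metric.ball (0 : RN N) R, (w k).v x ^ 2) atTop (𝓝 0))
    (hn : Tendsto (fun k => ‖w k‖ ^ 2) atTop (𝓝 ℓ)) (hℓ : 0 < ℓ)
    (hI : Tendsto (fun k => ‖w k‖ ^ 2 - q * subTerm Q (w k) - critTerm α β (w k)) atTop (𝓝 0))
    (hJ : Tendsto (fun k => JEps α β Q (w k)) atTop (𝓝 d)) :
    min (mInfty s V W α β Q)
      ((s / (N : ℝ) * sTilde N s α β ^ ((N : ℝ) / (2 * s)) : ℝ) : EReal) ≤ (d : EReal) := by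
  by_cases hVW : max V.atInfty W.atInfty = ⊤
  · refine (min_le_right _ _).trans (EReal.coe_le_coe_iff.2 ?_)
    exact sTilde_level_le hs hN hα hβ hαβ hn hℓ hI hJ
      (tendsto_subTerm_zero hs hN hε hQ hVW hM hu hv)
  · exact (min_le_left _ _).trans (mInfty_le_of_vanishing hε hQ hα hβ (by rw [hαβ]; exact hQ.lt_crit)
      hVW hM hu hv hn hℓ hI hJ)

end Level

/-! ### The Palais–Smale condition -/

theorem homFunctional_subTerm (hs : 0 < s) (hN : 2 * s < N) (hQ : IsAdmissible N s q Q) :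
    HomFunctional q (subTerm Q : XSpace N s ε V W → ℝ) := by
  obtain ⟨C, -, hb⟩ := exists_pair_bound (ε := ε) (V := V) (W := W) hs hN hQ.two_lt hQ.lt_crit
  exact homFunctional_integral (by linarith [hQ.two_lt]) hQ.homLip (fun x => hQ.extQ_nonneg _ _) hb

theorem homFunctional_critTerm (hs : 0 < s) (hN : 2 * s < N) (hα : 1 ≤ α) (hβ : 1 ≤ β)
    (hαβ : α + β = critExp N s) :
    HomFunctional (α + β) (critTerm α β : XSpace N s ε V W → ℝ) := by
  obtain ⟨C, -, hb⟩ := exists_pair_crit_bound (ε := ε) (V := V) (W := W) hs hN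
  rw [← hαβ] at hb
  exact homFunctional_integral (by linarith) (critF_homLip hα hβ) (critF_nonneg α β) hb

theorem contDiff_JEps (hs : 0 < s) (hN : 2 * s < N) (hQ : IsAdmissible N s q Q)
    (hα : 1 < α) (hβ : 1 < β) (hαβ : α + β = critExp N s) :
    ContDiff ℝ 1 (JEps α β Q : XSpace N s ε V W → ℝ) := by
  obtain ⟨C, -, hb⟩ := exists_pair_crit_bound (ε := ε) (V := V) (W := W) hs hN
  obtain ⟨C', -, hb'⟩ := exists_pair_bound (ε := ε) (V := V) (W := W) hs hN hQ.two_lt hQ.lt_crit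
  rw [← hαβ] at hb
  have h1 : ContDiff ℝ 1 (subTerm Q : XSpace N s ε V W → ℝ) :=
    contDiff_integral (by linarith [hQ.two_lt]) hQ.hasPowerGrowthDeriv hQ.extQ_hom hb'
  have h2 : ContDiff ℝ 1 (critTerm α β : XSpace N s ε V W → ℝ) :=
    contDiff_integral (by linarith) (critF_hasPowerGrowthDeriv hα hβ)
      (critF_homLip hα.le hβ.le).hom hb
  exact (contDiff_const.mul (contDiff_norm_sq ℝ)).sub (h1.add (contDiff_const.mul h2))

/-- Step sizes along which difference quotients approximate derivatives that tend to zero. -/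
theorem exists_slope_tendsto_zero {E : Type*} [NormedAddCommGroup E] [NormedSpace ℝ E] {J : E → ℝ}
    {z : ℕ → E} {y : E} (hd : ∀ n, DifferentiableAt ℝ J (z n))
    (h : Tendsto (fun n => fderiv ℝ J (z n) y) atTop (𝓝 0)) :
    ∃ t : ℕ → ℝ, (∀ n, 0 < t n) ∧ (∀ n, t n ≤ 1) ∧ Tendsto t atTop (𝓝 0) ∧
      Tendsto (fun n => (J (z n + t n • y) - J (z n)) / t n) atTop (𝓝 0) := by
  have key : ∀ n : ℕ, ∃ t : ℝ, (0 < t ∧ t < 1 / ((n:ℝ) + 1)) ∧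
      |(J (z n + t • y) - J (z n)) / t - fderiv ℝ J (z n) y| < 1 / ((n:ℝ) + 1) := by
    intro n
    have hn : 0 < 1 / ((n:ℝ) + 1) := Nat.one_div_pos_of_nat
    have h1 := ((hd n).hasFDerivAt.hasLineDerivAt y).tendsto_slope_zero_right
    have h2 := (Metric.tendsto_nhds.1 h1 _ hn).and (Ioo_mem_nhdsGT hn)
    obtain ⟨t, ht1, ht2⟩ := h2.exists
    refine ⟨t, ht2, ?_⟩
    rw [Real.dist_eq, smul_eq_mul] at ht1
    rwa [div_eq_inv_mul]
  choose t ht1 ht2 using key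
  have h0 : Tendsto (fun n : ℕ => 1 / ((n:ℝ) + 1)) atTop (𝓝 0) :=
    tendsto_one_div_add_atTop_nhds_zero_nat
  refine ⟨t, fun n => (ht1 n).1, fun n => (ht1 n).2.le.trans ?_,
    squeeze_zero (fun n => (ht1 n).1.le) (fun n => (ht1 n).2.le) h0, ?_⟩
  · rw [div_le_one (by positivity)]
    linarith [show (0:ℝ) ≤ n from n.cast_nonneg]
  · have := (squeeze_zero_norm (fun n => (ht2 n).le) h0).add h
    rw [add_zero] at this
    exact this.congr fun n => by ring

theorem tendsto_norm_add_sq_sub {E : Type*} [NormedAddCommGroup E] [InnerProductSpace ℝ E]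
    {w : ℕ → E} {z0 : E} (hw : ∀ f : E →L[ℝ] ℝ, Tendsto (fun k => f (w k)) atTop (𝓝 0)) :
    Tendsto (fun k => ‖w k + z0‖ ^ 2 - ‖w k‖ ^ 2) atTop (𝓝 (‖z0‖ ^ 2)) := by
  have h := ((hw (innerSL ℝ z0)).const_mul 2).add_const (‖z0‖ ^ 2)
  rw [mul_zero, zero_add] at h
  refine h.congr fun k => ?_
  rw [norm_add_sq_real, innerSL_apply_apply, real_inner_comm]
  ring

theorem tendsto_norm_sq_slope {E : Type*} [NormedAddCommGroup E] [InnerProductSpace ℝ E]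
    {w : ℕ → E} {z0 : E} (hw : ∀ f : E →L[ℝ] ℝ, Tendsto (fun k => f (w k)) atTop (𝓝 0))
    {t : ℕ → ℝ} (ht0 : ∀ n, 0 < t n) (ht : Tendsto t atTop (𝓝 0)) :
    Tendsto (fun k => (‖w k + z0 + t k • z0‖ ^ 2 - ‖w k + z0‖ ^ 2) / t k) atTop
      (𝓝 (2 * ‖z0‖ ^ 2)) := by
  have h := (((hw (innerSL ℝ z0)).const_mul 2).add_const (2 * ‖z0‖ ^ 2)).add
    (ht.mul_const (‖z0‖ ^ 2))
  rw [mul_zero, zero_add, zero_mul, add_zero] at h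
  refine h.congr fun k => ?_
  have hk := (ht0 k).ne'
  rw [norm_add_sq_real (w k + z0), innerSL_apply_apply, real_inner_comm, inner_smul_right,
    inner_add_left, real_inner_self_eq_norm_sq, norm_smul, mul_pow, Real.norm_eq_abs, sq_abs]
  field_simp
  ring

theorem constrainedPS_JEps (hs : 0 < s) (hN : 2 * s < N) (hε : 0 < ε) (hQ : IsAdmissible N s q Q)
    (hα : 1 ≤ α) (hβ : 1 ≤ β) (hαβ : α + β = critExp N s) {d : ℝ}
    (hd : (d : EReal) < min (mInfty s V W α β Q)
        ((s / (N : ℝ) * sTilde N s α β ^ ((N : ℝ) / (2 * s)) : ℝ) : EReal)) :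
    ConstrainedPS (JEps α β Q : XSpace N s ε V W → ℝ) d := by
  intro z hz hdiff hJ hc
  rw [JEps_eq_energy] at hz hdiff hJ hc
  have hq : 2 < q := hQ.two_lt
  have hqp : q < α + β := by rw [hαβ]; exact hQ.lt_crit
  have hA := homFunctional_subTerm (ε := ε) (V := V) (W := W) hs hN hQ
  have hB := homFunctional_critTerm (ε := ε) (V := V) (W := W) hs hN hα hβ hαβ
  obtain ⟨C1, hC1, hb1⟩ := exists_pair_crit_bound (ε := ε) (V := V) (W := W) hs hN
  obtain ⟨C2, hC2, hb2⟩ := exists_pair_bound (ε := ε) (V := V) (W := W) hs hN hQ.two_lt hQ.lt_crit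
  rw [← hαβ] at hb1
  have hq1 : 1 < q := by linarith
  have hp1 : 1 < α + β := by linarith
  have hp0 : α + β ≠ 0 := by linarith
  obtain ⟨D, hD⟩ := hJ.bddAbove_range
  have hcq : 0 < 1 / 2 - 1 / q := by
    have : 1 / q < 1 / 2 := one_div_lt_one_div_of_lt two_pos hq
    linarith
  obtain ⟨M, hM⟩ : ∃ M, ∀ n, ‖z n‖ ≤ M := by
    refine ⟨√(D / (1 / 2 - 1 / q)), fun n => Real.le_sqrt_of_sq_le ?_⟩
    rw [le_div_iff₀' hcq]
    exact (energy_ge_of_nehari hq hqp hA hB (hz n)).trans (hD (mem_range_self n))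
  obtain ⟨z0, φ, hφ, hw, hlu, hlv, hae⟩ := exists_weak_subseq hs hM
  set w : ℕ → XSpace N s ε V W := fun k => z (φ k) - z0 with hwdef
  have hzw : ∀ k, z (φ k) = w k + z0 := fun k => (sub_add_cancel _ _).symm
  have hMw : ∀ k, ‖w k‖ ≤ M + ‖z0‖ := fun k =>
    (norm_sub_le _ _).trans (add_le_add (hM _) le_rfl)
  -- The weak limit satisfies the constraint: only the derivative in the direction `z0` is used, and
  -- it is passed to the limit through difference quotients.
  have hI0 : ‖z0‖ ^ 2 - q * subTerm Q z0 - critTerm α β z0 = 0 := by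
    obtain ⟨t, ht0, ht1, ht, hslope⟩ := exists_slope_tendsto_zero (fun k => hdiff (φ k))
      ((tendsto_fderiv_energy_apply hq hqp hA hB hz hdiff hM hc z0).comp hφ.tendsto_atTop)
    have h1 := tendsto_norm_sq_slope (w := w) (z0 := z0) hw ht0 ht
    have h2 := tendsto_integral_slope (w := w) (z0 := z0) hq1 hQ.homLip hC2 hb2 hMw hae ht0 ht1 ht
    have h3 := tendsto_integral_slope (w := w) (z0 := z0) hp1 (critF_homLip hα hβ) hC1 hb1 hMw hae ht0 ht1 ht
    have h4 := ((h1.const_mul (1 / 2)).sub h2).sub (h3.const_mul (1 / (α + β)))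
    have h5 := tendsto_nhds_unique hslope (h4.congr fun k => by
      rw [hzw]
      simp only [energy, subTerm, critTerm, pair]
      ring)
    have h6 : 1 / (α + β) * ((α + β) * ∫ x, critF α β (z0.pair x)) = critTerm α β z0 := by
      rw [critTerm]; field_simp
    rw [h6] at h5
    have h7 : ∫ x, extQ Q (z0.pair x).1 (z0.pair x).2 = subTerm Q z0 := rfl
    rw [h7] at h5
    linarith
  -- Energy and constraint split, so the differences carry the remaining energy.
  have s1 : Tendsto (fun k => ‖w k + z0‖ ^ 2 - ‖w k‖ ^ 2) atTop (𝓝 (‖z0‖ ^ 2)) :=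
    tendsto_norm_add_sq_sub hw
  have s2 : Tendsto (fun k => subTerm Q (w k + z0) - subTerm Q (w k)) atTop
      (𝓝 (subTerm Q z0)) := tendsto_integral_split hq1 hQ.homLip hC2 hb2 hMw hae
  have s3 : Tendsto (fun k => critTerm α β (w k + z0) - critTerm α β (w k)) atTop
      (𝓝 (critTerm α β z0)) := tendsto_integral_split hp1 (critF_homLip hα hβ) hC1 hb1 hMw hae
  have hI : Tendsto (fun k => ‖w k‖ ^ 2 - q * subTerm Q (w k) - critTerm α β (w k)) atTop
      (𝓝 0) := by
    have h := ((s1.sub (s2.const_mul q)).sub s3).neg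
    rw [hI0, neg_zero] at h
    refine h.congr fun k => ?_
    have := nehari_identity hp0 hA hB (hz (φ k))
    rw [hzw] at this
    linarith
  set J0 := energy (α + β) (subTerm Q) (critTerm α β) z0 with hJ0
  have hJw : Tendsto (fun k => JEps α β Q (w k)) atTop (𝓝 (d - J0)) := by
    have h := (hJ.comp hφ.tendsto_atTop).sub
      (((s1.const_mul (1 / 2)).sub s2).sub (s3.const_mul (1 / (α + β))))
    have e : 1 / 2 * ‖z0‖ ^ 2 - subTerm Q z0 - 1 / (α + β) * critTerm α β z0 = J0 := by
      rw [hJ0, energy]; ring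
    rw [e] at h
    refine h.congr fun k => ?_
    rw [JEps_eq_energy, Function.comp_apply, hzw]
    simp only [energy]
    ring
  have hJ0nn : 0 ≤ J0 := by
    have h1 : 0 ≤ (q / 2 - 1) * subTerm Q z0 := mul_nonneg (by linarith) (hA.nonneg _)
    have h2 : 0 ≤ (1 / 2 - 1 / (α + β)) * critTerm α β z0 := by
      have : 1 / (α + β) ≤ 1 / 2 := one_div_le_one_div_of_le two_pos (by linarith)
      exact mul_nonneg (by linarith) (hB.nonneg _)
    rw [hJ0, energy]
    linarith
  -- A positive limit of the norms of the differences would cost at least the threshold energy.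
  obtain ⟨ℓ, -, ψ, hψ, hℓ⟩ := tendsto_subseq_of_bounded (x := fun k => ‖w k‖ ^ 2)
    (s := Icc 0 ((M + ‖z0‖) ^ 2)) (Metric.isBounded_Icc _ _)
    (fun k => ⟨by positivity, by have := hMw k; gcongr⟩)
  have hψt := hψ.tendsto_atTop
  have hℓ0 : ℓ = 0 := by
    have hℓnn : 0 ≤ ℓ := ge_of_tendsto' hℓ fun k => by simp only [Function.comp_apply]; positivity
    by_contra hne
    have hpos : 0 < ℓ := lt_of_le_of_ne hℓnn (Ne.symm hne)
    have h := level_le hs hN hε hQ hα hβ hαβ (fun k => hMw (ψ k)) (fun R => (hlu R).comp hψt)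
      (fun R => (hlv R).comp hψt) hℓ hpos (hI.comp hψt) (hJw.comp hψt)
    have h2 : d < d - J0 := EReal.coe_lt_coe_iff.1 (hd.trans_le h)
    linarith
  have hconv : Tendsto (fun k => z (φ (ψ k))) atTop (𝓝 z0) := by
    rw [tendsto_iff_norm_sub_tendsto_zero]
    have h := (Real.continuous_sqrt.tendsto 0).comp (hℓ0 ▸ hℓ)
    rw [Real.sqrt_zero] at h
    exact h.congr fun k => Real.sqrt_sq (norm_nonneg _)
  refine ⟨φ ∘ ψ, hφ.comp hψ, z0, ⟨?_, ?_⟩, hconv⟩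
  · obtain ⟨ρ, hρ, hlow⟩ := exists_nehari_lower_bound hq hqp hA hB
    have := ge_of_tendsto' hconv.norm fun k => hlow _ (hz (φ (ψ k)))
    exact norm_pos_iff.1 (hρ.trans_le this)
  · rw [JEps_eq_energy, nehariFun_energy hp0 hA hB]
    exact hI0

end XSpace

theorem theorem6p4 (N : ℕ) (s ε q α β : ℝ) (hs0 : 0 < s) (hs1 : s < 1) (hN : 2 * s < (N : ℝ))
    (hε : 0 < ε) (V W : Potential N)
    (H1 : V.inf = W.inf ∧ ∃ x, V.toFun x = V.inf ∧ W.toFun x = V.inf)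
    (H2 : (V.inf : EReal) < max V.atInfty W.atInfty)
    (Q : ℝ × ℝ → ℝ) (hQ : IsAdmissible N s q Q)
    (hα : 1 ≤ α) (hβ : 1 ≤ β) (hαβ : α + β = critExp N s) :
    (1 < α → 1 < β → ContDiff ℝ 1 (JEps α β Q : XSpace N s ε V W → ℝ)) ∧
    (∀ d : ℝ,
      (d : EReal) < min (mInfty s V W α β Q)
        ((s / (N : ℝ) * sTilde N s α β ^ ((N : ℝ) / (2 * s)) : ℝ) : EReal) →
      ConstrainedPS (JEps α β Q : XSpace N s ε V W → ℝ) d) ∧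
    (∀ z : XSpace N s ε V W,
      IsConstrainedCritical (JEps α β Q) z → IsCritical (JEps α β Q) z) := by
  refine ⟨fun h1 h2 => XSpace.contDiff_JEps hs0 hN hQ h1 h2 hαβ,
    fun d hd => XSpace.constrainedPS_JEps hs0 hN hε hQ hα hβ hαβ hd, fun z hz => ?_⟩
  rw [XSpace.JEps_eq_energy] at hz ⊢
  exact isCritical_of_isConstrainedCritical hQ.two_lt (by rw [hαβ]; exact hQ.lt_crit)
    (XSpace.homFunctional_subTerm hs0 hN hQ) (XSpace.homFunctional_critTerm hs0 hN hα hβ hαβ) hz
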